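/- Let $\mathfrak g$ be a finite-dimensional complex simple Lie algebra with Cartan subalgebra $\mathfrak h$, root system $R$, a fixed set of simple roots $\{\alpha_i\}_{i\in I}$, positive roots $R^+$, root spaces $\mathfrak g_\alpha$, and $\mathfrak n^+=\bigoplus_{\alpha\in R^+}\mathfrak g_\alpha$. For $\alpha\in R^+$ let $x^\pm_\alpha\in\mathfrak g_{\pm\alpha}$ and $h_\alpha\in\mathfrak h$ span a copy of $\mathfrak{sl}_2$, and write $x_i^\pm=x_{\alpha_i}^\pm$, $h_i=h_{\alpha_i}$. Let $(\cdot,\cdot)$ be the form on $\mathfrak h^*$ induced by the Killing form, let $P^+$ be the set of dominant integral weights, and for $\mu\in P^+$ let $V(\mu)$ be the irreducible finite-dimensional $\mathfrak g$-module of highest weight $\mu$, generated by $v_\mu$ with relations $hv_\mu=\mu(h)v_\mu$ $(h\in\mathfrak h)$, $x_i^+v_\mu=0=(x_i^-)^{\mu(h_i)+1}v_\mu$ $(i\in I)$. Let $\mathfrak g\ltimes\mathfrak g_{\mathrm{ad}}$ be the Lie algebra $\mathfrak g\oplus\mathfrak g$ with $[(x,y),(x',y')]=([x,x'],[x,y']+[y,x'])$,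 and write $(y)_{\mathrm{ad}}=(0,y)$. It is graded with $\mathfrak g$ in degree $0$ and $\mathfrak g_{\mathrm{ad}}$ in degree $1$. Let $\mathcal G_2$ be the category of $\mathbb Z_{\ge 0}$-graded $\mathfrak g\ltimes\mathfrak g_{\mathrm{ad}}$-modules $V=\bigoplus_k V[k]$ with finite-dimensional graded pieces, with grading-preserving module maps as morphisms. For a $\mathfrak g$-module $V$ let $\mathrm{ev}_rV$ be $V$ placed in degree $r$ with $\mathfrak g_{\mathrm{ad}}$ acting by $0$. Put $\Lambda=P^+\times\mathbb Z_{\ge0}$, and let $\preccurlyeq$ be the partial order on $\Lambda$ generated by the relations that $(\mu,s)$ covers $(\lambda,r)$ if $s=r+1$ and $\mu-\lambda\in R\sqcup\{0\}$. A subset $\Gamma\subset\Lambda$ is interval closed if $\gamma,\gamma'\in\Gamma$ and $\gamma\preccurlyeq\gamma''\preccurlyeq\gamma'$ imply $\gamma''\in\Gamma$. For $\Gamma\subset\Lambda$ let $\mathcal G_2[\Gamma]$ be the full subcategory of those $V\in\mathcal G_2$ such that $\operatorname{Hom}_{\mathfrak g}(V(\lambda),V[r])\neq0$ implies $(\lambda,r)\in\Gamma$,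 and for $V\in\mathcal G_2$ let $V^\Gamma$ be the maximal quotient of $V$ lying in $\mathcal G_2[\Gamma]$. For $(\mu,r)\in\Lambda$ let $P(\mu,r)=U(\mathfrak g\ltimes\mathfrak g_{\mathrm{ad}})\otimes_{U(\mathfrak g)}\mathrm{ev}_rV(\mu)$ and let $p^\Gamma_{\mu,r}$ be the image of $1\otimes v_\mu$ in $P(\mu,r)^\Gamma$. For $\lambda\in P^+$ and $S\subset R$ put $$\Gamma(\lambda,S)=\Big\{(\mu,r)\in\Lambda:\ \mu=\lambda-\sum_{\beta\in S}n_\beta\beta,\ n_\beta\in\mathbb Z_{\ge0},\ \sum_{\beta\in S}n_\beta=r\Big\}.$$ **Theorem.** Let $\Psi\subset R^+$ be such that $\Psi=\{\alpha\in R:(\alpha,\xi)=\max_{\beta\in R}(\beta,\xi)\}$ for some $\xi\in P^+$, let $\lambda\in P^+$ and $\Gamma=\Gamma(\lambda,\Psi)$. Then $\Gamma$ is a finite, interval closed subset of $\Lambda$, and for every $(\mu,r)\in\Gamma$ the module $P(\mu,r)^\Gamma$ is finite-dimensional and is the projective cover of $\mathrm{ev}_rV(\mu)$ in $\mathcal G_2[\Gamma]$.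 Moreover, it is generated by $p=p^\Gamma_{\mu,r}$ with defining relations $$\mathfrak n^+p=0,\qquad hp=\mu(h)p\ (h\in\mathfrak h),\qquad (x_i^-)^{\mu(h_i)+1}p=0\ (i\in I),$$ $$(\mathfrak n^+)_{\mathrm{ad}}\,p=0=\mathfrak h_{\mathrm{ad}}\,p,\qquad (x^-_\alpha)_{\mathrm{ad}}\,p=0\ (\alpha\in R^+\setminus\Psi).$$ -/

import Mathlib

open CategoryTheory TensorProduct

universe u

namespace GradedAdjoint

noncomputable section

attribute [local instance 100] LieRing.ofAssociativeRing

/-! ### Modules over the enveloping algebra as Lie modules -/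

/-- A left module over `U(𝔞)` regarded as a Lie module: `⁅x, m⁆ = ι x • m`. -/
abbrev lieRingModuleOfUEA (A M : Type u) [LieRing A] [LieAlgebra ℂ A] [AddCommGroup M]
    [Module (UniversalEnvelopingAlgebra ℂ A) M] : LieRingModule A M where
  bracket x m := UniversalEnvelopingAlgebra.ι ℂ x • m
  add_lie x y m := by simp [add_smul]
  lie_add x m n := by simp
  leibniz_lie x y m := by
    simp [LieHom.map_lie, LieRing.of_associative_ring_bracket, sub_smul, mul_smul]

theorem lieModuleOfUEA (A M : Type u) [LieRing A] [LieAlgebra ℂ A] [AddCommGroup M]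
    [Module ℂ M] [Module (UniversalEnvelopingAlgebra ℂ A) M]
    [IsScalarTower ℂ (UniversalEnvelopingAlgebra ℂ A) M] :
    letI := lieRingModuleOfUEA A M
    LieModule ℂ A M :=
  letI := lieRingModuleOfUEA A M
  { smul_lie := fun t x m => by
      change UniversalEnvelopingAlgebra.ι ℂ (t • x) • m = t • (UniversalEnvelopingAlgebra.ι ℂ x • m)
      rw [map_smul, smul_assoc]
    lie_smul := fun t x m => by
      change UniversalEnvelopingAlgebra.ι ℂ x • (t • m) = t • (UniversalEnvelopingAlgebra.ι ℂ x • m)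
      exact smul_algebra_smul_comm t _ m }

/-- The action of `U(𝔞)` on a Lie module. -/
def ueaAct (A M : Type u) [LieRing A] [LieAlgebra ℂ A] [AddCommGroup M] [Module ℂ M]
    [LieRingModule A M] [LieModule ℂ A M] :
    UniversalEnvelopingAlgebra ℂ A →ₐ[ℂ] Module.End ℂ M :=
  UniversalEnvelopingAlgebra.lift ℂ (LieModule.toEnd ℂ A M)

/-- `M` is the `𝔞`-module generated by `p` with defining relations `s p = 0`, `s ∈ S`: the map
`U(𝔞) → M`, `u ↦ u p`, is onto, and its kernel is the left ideal generated by `S`. -/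
def IsPresentedBy {A M : Type u} [LieRing A] [LieAlgebra ℂ A] [AddCommGroup M] [Module ℂ M]
    [LieRingModule A M] [LieModule ℂ A M] (p : M) (S : Set (UniversalEnvelopingAlgebra ℂ A)) :
    Prop :=
  (∀ m : M, ∃ u, ueaAct A M u p = m) ∧
  ∀ u, ueaAct A M u p = 0 ↔ u ∈ Submodule.span (UniversalEnvelopingAlgebra ℂ A) S

/-! ### The Lie algebra `𝔤 ⋉ 𝔤_ad` -/

/-- The Lie algebra `𝔤 ⋉ 𝔤_ad`, with underlying vector space `𝔤 ⊕ 𝔤`. -/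
def SemiAd (L : Type u) : Type u := L × L

section SemiAd

variable (L : Type u) [LieRing L] [LieAlgebra ℂ L]

instance : AddCommGroup (SemiAd L) := inferInstanceAs (AddCommGroup (L × L))

instance : Module ℂ (SemiAd L) := inferInstanceAs (Module ℂ (L × L))

instance : LieRing (SemiAd L) where
  bracket a a' := ((⁅a.1, a'.1⁆, ⁅a.1, a'.2⁆ + ⁅a.2, a'.1⁆) : L × L)
  add_lie a b c := Prod.ext (add_lie a.1 b.1 c.1) (by
    change ⁅a.1 + b.1, c.2⁆ + ⁅a.2 + b.2, c.1⁆ =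
      (⁅a.1, c.2⁆ + ⁅a.2, c.1⁆) + (⁅b.1, c.2⁆ + ⁅b.2, c.1⁆)
    simp only [add_lie]; abel)
  lie_add a b c := Prod.ext (lie_add a.1 b.1 c.1) (by
    change ⁅a.1, b.2 + c.2⁆ + ⁅a.2, b.1 + c.1⁆ =
      (⁅a.1, b.2⁆ + ⁅a.2, b.1⁆) + (⁅a.1, c.2⁆ + ⁅a.2, c.1⁆)
    simp only [lie_add]; abel)
  lie_self a := Prod.ext (lie_self a.1) (by
    change ⁅a.1, a.2⁆ + ⁅a.2, a.1⁆ = 0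
    rw [← lie_skew a.1 a.2, neg_add_cancel])
  leibniz_lie a b c := Prod.ext (leibniz_lie a.1 b.1 c.1) (by
    change ⁅a.1, ⁅b.1, c.2⁆ + ⁅b.2, c.1⁆⁆ + ⁅a.2, ⁅b.1, c.1⁆⁆ =
      (⁅⁅a.1, b.1⁆, c.2⁆ + ⁅⁅a.1, b.2⁆ + ⁅a.2, b.1⁆, c.1⁆) +
        (⁅b.1, ⁅a.1, c.2⁆ + ⁅a.2, c.1⁆⁆ + ⁅b.2, ⁅a.1, c.1⁆⁆)
    rw [lie_add, lie_add, add_lie, leibniz_lie a.1 b.1 c.2, leibniz_lie a.1 b.2 c.1,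
      leibniz_lie a.2 b.1 c.1]
    abel)

instance : LieAlgebra ℂ (SemiAd L) where
  lie_smul t a b := Prod.ext (lie_smul t a.1 b.1) (by
    change ⁅a.1, t • b.2⁆ + ⁅a.2, t • b.1⁆ = t • (⁅a.1, b.2⁆ + ⁅a.2, b.1⁆)
    simp)

variable {L}

/-- The embedding of `𝔤`, `x ↦ (x, 0)`. -/
def inG : L →ₗ⁅ℂ⁆ SemiAd L where
  toFun x := ((x, 0) : L × L)
  map_add' _ _ := Prod.ext rfl (add_zero (0 : L)).symm
  map_smul' t _ := Prod.ext rfl (smul_zero t).symm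
  map_lie' {x y} := Prod.ext rfl (by
    change (0 : L) = ⁅x, (0 : L)⁆ + ⁅(0 : L), y⁆
    simp)

/-- The embedding of `𝔤_ad`, `y ↦ (y)_ad = (0, y)`. -/
def inAd : L →ₗ[ℂ] SemiAd L where
  toFun y := ((0, y) : L × L)
  map_add' _ _ := Prod.ext (add_zero (0 : L)).symm rfl
  map_smul' t _ := Prod.ext (smul_zero t).symm rfl

theorem inG_add_inAd (a : SemiAd L) : inG a.1 + inAd a.2 = a :=
  Prod.ext (add_zero a.1) (zero_add a.2)

theorem lie_inAd_inAd (x y : L) : ⁅(inAd x : SemiAd L), inAd y⁆ = 0 :=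
  Prod.ext (by change ⁅(0 : L), (0 : L)⁆ = 0; simp) (by
    change ⁅(0 : L), y⁆ + ⁅x, (0 : L)⁆ = 0; simp)

end SemiAd

/-! ### Graded modules -/

/-- The projections of a grading determine it. -/
theorem isInternal_of_proj {M : Type u} [AddCommGroup M] [Module ℂ M] (A : ℕ → Submodule ℂ M)
    (p : ℕ → M →ₗ[ℂ] M) (hp : ∀ j k, ∀ m ∈ A k, p j m = if j = k then m else 0)
    (htop : ⨆ k, A k = ⊤) : DirectSum.IsInternal A := by
  rw [DirectSum.isInternal_submodule_iff_iSupIndep_and_iSup_eq_top]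
  refine ⟨?_, htop⟩
  intro i
  rw [Submodule.disjoint_def]
  intro x hx hx'
  have h1 : p i x = x := by simpa using hp i i x hx
  have h2 : (⨆ j, ⨆ (_ : j ≠ i), A j) ≤ LinearMap.ker (p i) := by
    refine iSup₂_le fun j hj m hm => ?_
    rw [LinearMap.mem_ker, hp i j m hm, if_neg hj.symm]
  rw [← h1]
  exact h2 hx'

/-- A `ℤ₊`-graded `𝔤 ⋉ 𝔤_ad`-module, where `𝔤` has degree `0` and `𝔤_ad` has degree `1`
(the graded pieces may be infinite-dimensional). -/
structure GrMod (L : Type u) [LieRing L] [LieAlgebra ℂ L] where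
  carrier : Type u
  [addCommGroup : AddCommGroup carrier]
  [module : Module ℂ carrier]
  [lieRingModule : LieRingModule (SemiAd L) carrier]
  [lieModule : LieModule ℂ (SemiAd L) carrier]
  deg : ℕ → Submodule ℂ carrier
  isInternal : DirectSum.IsInternal deg
  lie_inG_mem : ∀ (k : ℕ) (x : L) (v : carrier), v ∈ deg k → ⁅(inG x : SemiAd L), v⁆ ∈ deg k
  lie_inAd_mem : ∀ (k : ℕ) (y : L) (v : carrier), v ∈ deg k →
    ⁅(inAd y : SemiAd L), v⁆ ∈ deg (k + 1)

attribute [instance] GrMod.addCommGroup GrMod.module GrMod.lieRingModule GrMod.lieModule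

namespace GrMod

variable {L : Type u} [LieRing L] [LieAlgebra ℂ L]

/-- Morphisms of graded modules: module maps which preserve the grading. -/
@[ext]
structure Hom (M N : GrMod L) where
  toLieHom : M.carrier →ₗ⁅ℂ, SemiAd L⁆ N.carrier
  map_deg : ∀ k, ∀ v ∈ M.deg k, toLieHom v ∈ N.deg k

instance : Category (GrMod L) where
  Hom M N := Hom M N
  id M := ⟨LieModuleHom.id, fun _ _ hv => hv⟩
  comp f g := ⟨g.toLieHom.comp f.toLieHom, fun k v hv => g.map_deg k _ (f.map_deg k v hv)⟩

/-- Each graded piece `V[k]` is a `𝔤`-module. -/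
instance (M : GrMod L) (k : ℕ) : LieRingModule L (M.deg k) where
  bracket x v := ⟨⁅(inG x : SemiAd L), (v : M.carrier)⁆, M.lie_inG_mem k x v v.2⟩
  add_lie x y v := Subtype.ext (by simp)
  lie_add x v w := Subtype.ext (by simp)
  leibniz_lie x y v := Subtype.ext (by simp)

instance (M : GrMod L) (k : ℕ) : LieModule ℂ L (M.deg k) where
  smul_lie t x v := Subtype.ext (by
    change ⁅(inG (t • x) : SemiAd L), (v : M.carrier)⁆ = t • ⁅(inG x : SemiAd L), (v : M.carrier)⁆
    simp)
  lie_smul t x v := Subtype.ext (by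
    change ⁅(inG x : SemiAd L), t • (v : M.carrier)⁆ = t • ⁅(inG x : SemiAd L), (v : M.carrier)⁆
    simp)

/-- The projection of a graded module onto its piece of degree `k`. -/
def proj (M : GrMod L) (k : ℕ) : M.carrier →ₗ[ℂ] M.carrier :=
  (M.deg k).subtype ∘ₗ DirectSum.component ℂ ℕ (fun i => M.deg i) k ∘ₗ
    (LinearEquiv.ofBijective (DirectSum.coeLinearMap M.deg) M.isInternal).symm.toLinearMap

theorem proj_mem (M : GrMod L) (k : ℕ) (m : M.carrier) : M.proj k m ∈ M.deg k :=
  Subtype.mem _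

theorem proj_of_mem (M : GrMod L) (j k : ℕ) (m : M.carrier) (hm : m ∈ M.deg k) :
    M.proj j m = if j = k then m else 0 := by
  have h : (LinearEquiv.ofBijective (DirectSum.coeLinearMap M.deg) M.isInternal).symm m =
      DirectSum.lof ℂ ℕ (fun i => M.deg i) k ⟨m, hm⟩ := by
    rw [LinearEquiv.symm_apply_eq]
    exact (DirectSum.coeLinearMap_lof M.deg k ⟨m, hm⟩).symm
  simp only [proj, LinearMap.comp_apply, LinearEquiv.coe_coe, h]
  split_ifs with hjk
  · subst hjk
    simp [DirectSum.component.lof_self]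
  · rw [DirectSum.component.of, dif_neg (Ne.symm hjk)]
    simp

/-- Graded submodules: submodules containing the homogeneous components of their elements. -/
structure GrSub (M : GrMod L) where
  toLie : LieSubmodule ℂ (SemiAd L) M.carrier
  homogeneous : ∀ k, ∀ m ∈ toLie, M.proj k m ∈ toLie

/-- The quotient of a graded module by a graded submodule. -/
def quot (M : GrMod L) (N : M.GrSub) : GrMod L where
  carrier := M.carrier ⧸ N.toLie
  deg k := (M.deg k).map (LieSubmodule.Quotient.mk' N.toLie : M.carrier →ₗ[ℂ] M.carrier ⧸ N.toLie)
  isInternal := by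
    refine isInternal_of_proj _
      (fun k => Submodule.mapQ N.toLie.toSubmodule N.toLie.toSubmodule (M.proj k)
        (fun m hm => N.homogeneous k m hm)) ?_ ?_
    · rintro j k _ ⟨m, hm, rfl⟩
      change Submodule.Quotient.mk (M.proj j m) = _
      rw [M.proj_of_mem j k m hm]
      split_ifs <;> rfl
    · rw [← Submodule.map_iSup, M.isInternal.submodule_iSup_eq_top, Submodule.map_top,
        LinearMap.range_eq_top]
      exact LieSubmodule.Quotient.surjective_mk' N.toLie
  lie_inG_mem := by
    rintro k x _ ⟨m, hm, rfl⟩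
    exact ⟨_, M.lie_inG_mem k x m hm, (LieSubmodule.Quotient.mk' N.toLie).map_lie _ _⟩
  lie_inAd_mem := by
    rintro k x _ ⟨m, hm, rfl⟩
    exact ⟨_, M.lie_inAd_mem k x m hm, (LieSubmodule.Quotient.mk' N.toLie).map_lie _ _⟩

end GrMod

/-- The objects of `𝒢₂`: graded modules with finite-dimensional graded pieces. -/
def InG2 {L : Type u} [LieRing L] [LieAlgebra ℂ L] (M : GrMod L) : Prop :=
  ∀ k, FiniteDimensional ℂ (M.deg k)

/-- The action of `𝔤 ⋉ 𝔤_ad` on a `𝔤`-module by `(x, y) v = x v`. -/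
abbrev evLieRingModule (L V : Type u) [LieRing L] [LieAlgebra ℂ L] [AddCommGroup V]
    [LieRingModule L V] : LieRingModule (SemiAd L) V where
  bracket a v := ⁅a.1, v⁆
  add_lie a c v := add_lie a.1 c.1 v
  lie_add a v w := lie_add a.1 v w
  leibniz_lie a c v := leibniz_lie a.1 c.1 v

theorem evLieModule (L V : Type u) [LieRing L] [LieAlgebra ℂ L] [AddCommGroup V] [Module ℂ V]
    [LieRingModule L V] [LieModule ℂ L V] :
    letI := evLieRingModule L V
    LieModule ℂ (SemiAd L) V :=
  letI := evLieRingModule L V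
  { smul_lie := fun t a v => smul_lie t a.1 v
    lie_smul := fun t a v => lie_smul t a.1 v }

/-- The graded module `ev_r V`: the `𝔤`-module `V` placed in degree `r`, with `𝔤_ad` acting by
zero. -/
def evModule {L : Type u} [LieRing L] [LieAlgebra ℂ L] (r : ℕ) (V : Type u) [AddCommGroup V]
    [Module ℂ V] [LieRingModule L V] [LieModule ℂ L V] : GrMod L where
  carrier := V
  lieRingModule := evLieRingModule L V
  lieModule := evLieModule L V
  deg s := if s = r then ⊤ else ⊥
  isInternal := by
    refine isInternal_of_proj _ (fun k => if k = r then LinearMap.id else 0) ?_ ?_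
    · intro j k m hm
      by_cases hk : k = r
      · subst hk
        split_ifs <;> rfl
      · rw [if_neg hk, Submodule.mem_bot] at hm
        subst hm
        simp
    · refine eq_top_iff.2 (le_trans ?_ (le_iSup _ r))
      simp
  lie_inG_mem k x v hv := by
    by_cases hk : k = r
    · simp [hk]
    · rw [if_neg hk, Submodule.mem_bot] at hv
      subst hv
      change ⁅x, (0 : V)⁆ ∈ _
      rw [lie_zero]
      exact Submodule.zero_mem _
  lie_inAd_mem k x v _ := by
    change ⁅(0 : L), v⁆ ∈ _
    rw [zero_lie]
    exact Submodule.zero_mem _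

/-! ### Inducing from `𝔤` to `𝔤 ⋉ 𝔤_ad` -/

section Induced

variable (L : Type u) [LieRing L] [LieAlgebra ℂ L]

/-- `U(𝔤)`. -/
abbrev UG : Type u := UniversalEnvelopingAlgebra ℂ L

/-- `U(𝔤 ⋉ 𝔤_ad)`. -/
abbrev UT : Type u := UniversalEnvelopingAlgebra ℂ (SemiAd L)

variable {L}

/-- The generator `x` or `(x)_ad` of `U(𝔤 ⋉ 𝔤_ad)`. -/
def gen : L ⊕ L → UT L
  | .inl x => UniversalEnvelopingAlgebra.ι ℂ (inG x)
  | .inr y => UniversalEnvelopingAlgebra.ι ℂ (inAd y)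

/-- The degree of a generator: `0` on `𝔤` and `1` on `𝔤_ad`. -/
def genDeg : L ⊕ L → ℕ
  | .inl _ => 0
  | .inr _ => 1

/-- `U(𝔤 ⋉ 𝔤_ad)[k]`, spanned by the monomials in the generators of total degree `k`. -/
def uDeg (k : ℕ) : Submodule ℂ (UT L) :=
  Submodule.span ℂ {u | ∃ l : List (L ⊕ L), (l.map genDeg).sum = k ∧ (l.map gen).prod = u}

variable (L) in
/-- The inclusion `U(𝔤) → U(𝔤 ⋉ 𝔤_ad)`. -/
def uIncl : UG L →ₐ[ℂ] UT L :=
  UniversalEnvelopingAlgebra.lift ℂ ((UniversalEnvelopingAlgebra.ι ℂ).comp inG)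

variable (L) in
/-- The algebra map `U → U[X]`, sending `x ↦ x` and `(y)_ad ↦ (y)_ad X`; its coefficients are the
projections onto the graded pieces. -/
def uCoact : UT L →ₐ[ℂ] Polynomial (UT L) :=
  UniversalEnvelopingAlgebra.lift ℂ
    { toFun := fun a => Polynomial.C (UniversalEnvelopingAlgebra.ι ℂ (inG a.1)) +
        Polynomial.C (UniversalEnvelopingAlgebra.ι ℂ (inAd a.2)) * Polynomial.X
      map_add' := fun a c => by
        change Polynomial.C (UniversalEnvelopingAlgebra.ι ℂ (inG (a.1 + c.1))) +
          Polynomial.C (UniversalEnvelopingAlgebra.ι ℂ (inAd (a.2 + c.2))) * Polynomial.X = _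
        simp only [map_add, add_mul]
        abel
      map_smul' := fun t a => by
        change Polynomial.C (UniversalEnvelopingAlgebra.ι ℂ (inG (t • a.1))) +
          Polynomial.C (UniversalEnvelopingAlgebra.ι ℂ (inAd (t • a.2))) * Polynomial.X = _
        simp only [map_smul, ← Polynomial.smul_C, smul_mul_assoc, smul_add, RingHom.id_apply]
      map_lie' := fun {a c} => by
        have hcomm : UniversalEnvelopingAlgebra.ι ℂ (inAd a.2 : SemiAd L) *
            UniversalEnvelopingAlgebra.ι ℂ (inAd c.2 : SemiAd L) =
            UniversalEnvelopingAlgebra.ι ℂ (inAd c.2 : SemiAd L) *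
            UniversalEnvelopingAlgebra.ι ℂ (inAd a.2 : SemiAd L) := by
          rw [← sub_eq_zero, ← LieRing.of_associative_ring_bracket, ← LieHom.map_lie,
            lie_inAd_inAd, map_zero]
        have h1 : (inG (⁅a, c⁆ : SemiAd L).1 : SemiAd L) = ⁅(inG a.1 : SemiAd L), inG c.1⁆ :=
          (inG : L →ₗ⁅ℂ⁆ SemiAd L).map_lie a.1 c.1
        have h2 : (inAd (⁅a, c⁆ : SemiAd L).2 : SemiAd L) =
            ⁅(inG a.1 : SemiAd L), inAd c.2⁆ + ⁅(inAd a.2 : SemiAd L), inG c.1⁆ := by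
          refine Prod.ext ?_ ?_
          · change (0 : L) = ⁅a.1, (0 : L)⁆ + ⁅(0 : L), c.1⁆
            simp
          · change ⁅a.1, c.2⁆ + ⁅a.2, c.1⁆ =
              (⁅a.1, c.2⁆ + ⁅(0 : L), (0 : L)⁆) + (⁅(0 : L), (0 : L)⁆ + ⁅a.2, c.1⁆)
            simp
        rw [h1, h2, map_add, LieHom.map_lie, LieHom.map_lie, LieHom.map_lie]
        simp only [LieRing.of_associative_ring_bracket]
        have hX : ∀ (d : UT L) (q : Polynomial (UT L)),
            Polynomial.X * (Polynomial.C d * q) = Polynomial.C d * (Polynomial.X * q) := by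
          intro d q
          rw [← mul_assoc, Polynomial.X_mul_C, mul_assoc]
        have hC : ∀ q : Polynomial (UT L),
            Polynomial.C (UniversalEnvelopingAlgebra.ι ℂ (inAd a.2 : SemiAd L)) *
              (Polynomial.C (UniversalEnvelopingAlgebra.ι ℂ (inAd c.2 : SemiAd L)) * q) =
            Polynomial.C (UniversalEnvelopingAlgebra.ι ℂ (inAd c.2 : SemiAd L)) *
              (Polynomial.C (UniversalEnvelopingAlgebra.ι ℂ (inAd a.2 : SemiAd L)) * q) := by
          intro q
          rw [← mul_assoc, ← mul_assoc, ← Polynomial.C_mul, ← Polynomial.C_mul, hcomm]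
        simp only [Polynomial.C_add, Polynomial.C_sub, Polynomial.C_mul, add_mul, mul_add, sub_mul,
          mul_assoc, Polynomial.X_mul_C, hX, hC]
        abel }

theorem uCoact_gen (a : L ⊕ L) : uCoact L (gen a) = Polynomial.monomial (genDeg a) (gen a) := by
  rcases a with x | y
  · rw [uCoact, gen, UniversalEnvelopingAlgebra.lift_ι_apply]
    change Polynomial.C (UniversalEnvelopingAlgebra.ι ℂ (inG x)) +
      Polynomial.C (UniversalEnvelopingAlgebra.ι ℂ (inAd (0 : L))) * Polynomial.X = _
    simp [genDeg]
  · rw [uCoact, gen, UniversalEnvelopingAlgebra.lift_ι_apply]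
    change Polynomial.C (UniversalEnvelopingAlgebra.ι ℂ (inG (0 : L))) +
      Polynomial.C (UniversalEnvelopingAlgebra.ι ℂ (inAd y)) * Polynomial.X = _
    simp [genDeg, Polynomial.C_mul_X_eq_monomial]

theorem uCoact_prod (l : List (L ⊕ L)) : uCoact L (l.map gen).prod =
    Polynomial.monomial (l.map genDeg).sum (l.map gen).prod := by
  induction l with
  | nil => simp
  | cons a l ih =>
    simp only [List.map_cons, List.prod_cons, List.sum_cons, map_mul, ih, uCoact_gen,
      Polynomial.monomial_mul_monomial]

variable (L) in
/-- The projection of `U(𝔤 ⋉ 𝔤_ad)` onto its piece of degree `k`. -/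
def uCoeff (k : ℕ) : UT L →ₗ[ℂ] UT L :=
  (Polynomial.lcoeff (UT L) k).restrictScalars ℂ ∘ₗ (uCoact L).toLinearMap

theorem uCoact_of_mem {k : ℕ} {u : UT L} (hu : u ∈ uDeg k) :
    uCoact L u = Polynomial.monomial k u := by
  induction hu using Submodule.span_induction with
  | mem x hx => obtain ⟨l, rfl, rfl⟩ := hx; exact uCoact_prod l
  | zero => simp
  | add x y _ _ hx hy => rw [map_add, hx, hy, map_add]
  | smul t x _ hx => rw [map_smul, hx, Polynomial.smul_monomial]

theorem uCoeff_of_mem {j k : ℕ} {u : UT L} (hu : u ∈ uDeg k) :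
    uCoeff L j u = if j = k then u else 0 := by
  change (uCoact L u).coeff j = _
  rw [uCoact_of_mem hu, Polynomial.coeff_monomial]
  simp only [eq_comm]

theorem iSup_uDeg : ⨆ k, (uDeg k : Submodule ℂ (UT L)) = ⊤ := by
  have hadj : Algebra.adjoin ℂ (Set.range (gen : L ⊕ L → UT L)) = ⊤ := by
    set S := Algebra.adjoin ℂ (Set.range (gen : L ⊕ L → UT L)) with hS
    have hmem : ∀ a : SemiAd L, UniversalEnvelopingAlgebra.ι ℂ a ∈ S := by
      intro a
      rw [← inG_add_inAd a, map_add]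
      exact S.add_mem (Algebra.subset_adjoin ⟨.inl a.1, rfl⟩)
        (Algebra.subset_adjoin ⟨.inr a.2, rfl⟩)
    let f : SemiAd L →ₗ⁅ℂ⁆ S :=
      { toFun := fun a => ⟨UniversalEnvelopingAlgebra.ι ℂ a, hmem a⟩
        map_add' := fun a c => Subtype.ext (map_add _ a c)
        map_smul' := fun t a => Subtype.ext (map_smul _ t a)
        map_lie' := fun {a c} => Subtype.ext (by
          simp [LieHom.map_lie, LieRing.of_associative_ring_bracket]) }
    have h : S.val.comp (UniversalEnvelopingAlgebra.lift ℂ f) = AlgHom.id ℂ (UT L) := by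
      apply UniversalEnvelopingAlgebra.hom_ext
      ext a
      simp [f]
    rw [eq_top_iff]
    intro u _
    rw [← AlgHom.id_apply (R := ℂ) u, ← h]
    exact Subtype.mem _
  have hspan := congrArg Subalgebra.toSubmodule hadj
  rw [Algebra.adjoin_eq_span, Algebra.top_toSubmodule] at hspan
  rw [← top_le_iff, ← hspan, Submodule.span_le]
  intro u hu
  obtain ⟨l, hl, rfl⟩ := Submonoid.exists_list_of_mem_closure hu
  have : ∃ l' : List (L ⊕ L), l'.map gen = l := by
    rw [← Set.mem_range, Set.range_list_map]
    exact hl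
  obtain ⟨l', rfl⟩ := this
  exact Submodule.mem_iSup_of_mem (l'.map genDeg).sum (Submodule.subset_span ⟨l', rfl, rfl⟩)

theorem gen_mul_mem (a : L ⊕ L) {k : ℕ} {u : UT L} (hu : u ∈ uDeg k) :
    gen a * u ∈ uDeg (k + genDeg a) := by
  induction hu using Submodule.span_induction with
  | mem x hx =>
    obtain ⟨l, rfl, rfl⟩ := hx
    exact Submodule.subset_span ⟨a :: l, by simp [add_comm], by simp⟩
  | zero => simp
  | add x y _ _ hx hy => rw [mul_add]; exact Submodule.add_mem _ hx hy
  | smul t x _ hx => rw [mul_smul_comm]; exact Submodule.smul_mem _ t hx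

theorem uIncl_coeff (k : ℕ) (u : UT L) (a : UG L) :
    uCoeff L k (u * uIncl L a) = uCoeff L k u * uIncl L a := by
  have h : (uCoact L).comp (uIncl L) = (Polynomial.CAlgHom (R := ℂ) (A := UT L)).comp (uIncl L) := by
    apply UniversalEnvelopingAlgebra.hom_ext
    ext x
    have hx : uIncl L (UniversalEnvelopingAlgebra.ι ℂ x) = gen (.inl x) :=
      UniversalEnvelopingAlgebra.lift_ι_apply ..
    change (uCoact L (uIncl L (UniversalEnvelopingAlgebra.ι ℂ x))).coeff _ =
      (Polynomial.C (uIncl L (UniversalEnvelopingAlgebra.ι ℂ x))).coeff _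
    rw [hx, uCoact_gen]
    rfl
  change (uCoact L (u * uIncl L a)).coeff k = (uCoact L u).coeff k * uIncl L a
  have h' : uCoact L (uIncl L a) = Polynomial.C (uIncl L a) := DFunLike.congr_fun h a
  rw [map_mul, h', Polynomial.coeff_mul_C]

variable (V : Type u) [AddCommGroup V] [Module ℂ V] [Module (UG L) V]

/-- The relations `u a ⊗ v = u ⊗ a v`, for `a ∈ U(𝔤)`. -/
def balRel : Set (UT L ⊗[ℂ] V) :=
  {w | ∃ (c : UT L) (a : UG L) (v : V), w = (c * uIncl L a) ⊗ₜ[ℂ] v - c ⊗ₜ[ℂ] (a • v)}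

/-- The tensor product `U(𝔤 ⋉ 𝔤_ad) ⊗_{U(𝔤)} V`. -/
def Ind : Type u := (UT L ⊗[ℂ] V) ⧸ Submodule.span (UT L) (balRel (L := L) V)

instance : AddCommGroup (Ind (L := L) V) :=
  inferInstanceAs (AddCommGroup ((UT L ⊗[ℂ] V) ⧸ Submodule.span (UT L) (balRel (L := L) V)))

instance : Module (UT L) (Ind (L := L) V) :=
  inferInstanceAs (Module (UT L) ((UT L ⊗[ℂ] V) ⧸ Submodule.span (UT L) (balRel (L := L) V)))

instance : Module ℂ (Ind (L := L) V) :=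
  inferInstanceAs (Module ℂ ((UT L ⊗[ℂ] V) ⧸ Submodule.span (UT L) (balRel (L := L) V)))

instance : IsScalarTower ℂ (UT L) (Ind (L := L) V) :=
  inferInstanceAs
    (IsScalarTower ℂ (UT L) ((UT L ⊗[ℂ] V) ⧸ Submodule.span (UT L) (balRel (L := L) V)))

variable {V}

/-- The quotient map onto `U(𝔤 ⋉ 𝔤_ad) ⊗_{U(𝔤)} V`. -/
def Ind.mk : UT L ⊗[ℂ] V →ₗ[UT L] Ind (L := L) V :=
  Submodule.mkQ _

theorem Ind.mk_surjective : Function.Surjective (Ind.mk (L := L) (V := V)) :=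
  Submodule.mkQ_surjective _

variable (V)

/-- The projection of `U(𝔤 ⋉ 𝔤_ad) ⊗_{U(𝔤)} V` onto `U[k] ⊗ V`. -/
def Ind.proj (k : ℕ) : Ind (L := L) V →ₗ[ℂ] Ind (L := L) V :=
  ((Submodule.span (UT L) (balRel (L := L) V)).restrictScalars ℂ).liftQ
    ((Ind.mk.restrictScalars ℂ) ∘ₗ (uCoeff L k).rTensor V) (by
      intro w hw
      refine Submodule.closure_induction (p := fun w _ => w ∈ LinearMap.ker
        ((Ind.mk.restrictScalars ℂ) ∘ₗ (uCoeff L k).rTensor V)) ?_ ?_ ?_ hw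
      · exact Submodule.zero_mem _
      · intro x y _ _ hx hy
        exact Submodule.add_mem _ hx hy
      · rintro c _ ⟨u, a, v, rfl⟩
        rw [LinearMap.mem_ker, LinearMap.comp_apply, LinearMap.restrictScalars_apply, smul_sub,
          TensorProduct.smul_tmul', TensorProduct.smul_tmul', map_sub, LinearMap.rTensor_tmul,
          LinearMap.rTensor_tmul, smul_eq_mul, smul_eq_mul, ← mul_assoc, uIncl_coeff]
        exact (Submodule.Quotient.mk_eq_zero _).2 (Submodule.subset_span ⟨_, a, v, rfl⟩))

theorem Ind.proj_mk (k : ℕ) (u : UT L) (v : V) :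
    Ind.proj V k (Ind.mk (u ⊗ₜ[ℂ] v)) = Ind.mk (uCoeff L k u ⊗ₜ[ℂ] v) := rfl

/-- The piece of degree `k` of `U(𝔤 ⋉ 𝔤_ad) ⊗_{U(𝔤)} ev_r V`: the span of the `u ⊗ v` with `u` of
degree `j`, `j + r = k`. -/
def indDeg (r k : ℕ) : Submodule ℂ (Ind (L := L) V) :=
  Submodule.span ℂ {w | ∃ (j : ℕ) (c : UT L) (v : V),
    j + r = k ∧ c ∈ uDeg j ∧ w = Ind.mk (c ⊗ₜ[ℂ] v)}

theorem isInternal_indDeg (r : ℕ) : DirectSum.IsInternal (indDeg (L := L) V r) := by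
  refine isInternal_of_proj _ (fun k => if r ≤ k then Ind.proj V (k - r) else 0) ?_ ?_
  · intro j k m hm
    induction hm using Submodule.span_induction with
    | mem x hx =>
      obtain ⟨i, c, v, rfl, hc, rfl⟩ := hx
      by_cases hj : r ≤ j
      · simp only [hj, if_true, Ind.proj_mk, uCoeff_of_mem hc]
        have : j - r = i ↔ j = i + r := by omega
        simp only [this]
        split_ifs <;> simp
      · have : j ≠ i + r := by omega
        simp [hj, this]
    | zero => simp
    | add x y _ _ hx hy => rw [map_add, hx, hy]; split_ifs <;> simp
    | smul t x _ hx => rw [map_smul, hx]; split_ifs <;> simp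
  · rw [eq_top_iff]
    rintro w -
    obtain ⟨w, rfl⟩ := Ind.mk_surjective w
    induction w using TensorProduct.induction_on with
    | zero => simp
    | add x y hx hy => rw [map_add]; exact Submodule.add_mem _ hx hy
    | tmul c v =>
      have hc : c ∈ ⨆ k, (uDeg k : Submodule ℂ (UT L)) := by
        rw [iSup_uDeg]
        trivial
      induction hc using Submodule.iSup_induction' with
      | mem j c hc =>
        exact Submodule.mem_iSup_of_mem (p := indDeg V r) (j + r)
          (Submodule.subset_span ⟨j, c, v, rfl, hc, rfl⟩)
      | zero => simp
      | add x y _ _ hx hy =>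
        rw [TensorProduct.add_tmul, map_add]
        exact Submodule.add_mem _ hx hy

theorem gen_smul_mem_indDeg (r : ℕ) (a : L ⊕ L) (k : ℕ) (w : Ind (L := L) V)
    (hw : w ∈ indDeg V r k) : gen a • w ∈ indDeg V r (k + genDeg a) := by
  induction hw using Submodule.span_induction with
  | mem w hw =>
    obtain ⟨j, c, v, rfl, hc, rfl⟩ := hw
    exact Submodule.subset_span
      ⟨j + genDeg a, gen a * c, v, by omega, gen_mul_mem a hc, rfl⟩
  | zero => simp
  | add y z _ _ hy hz =>
    rw [smul_add]
    exact Submodule.add_mem _ hy hz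
  | smul t y _ hy =>
    rw [smul_algebra_smul_comm]
    exact Submodule.smul_mem _ t hy

/-- The graded `𝔤 ⋉ 𝔤_ad`-module `U(𝔤 ⋉ 𝔤_ad) ⊗_{U(𝔤)} ev_r V`. -/
def indModule (r : ℕ) : GrMod L where
  carrier := Ind (L := L) V
  lieRingModule := lieRingModuleOfUEA _ _
  lieModule := lieModuleOfUEA _ _
  deg := indDeg V r
  isInternal := isInternal_indDeg V r
  lie_inG_mem k x w hw := gen_smul_mem_indDeg V r (.inl x) k w hw
  lie_inAd_mem k x w hw := gen_smul_mem_indDeg V r (.inr x) k w hw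

end Induced

/-! ### Weights and the modules `V(μ)` -/

section Weights

variable {L : Type u} [LieRing L] [LieAlgebra ℂ L] [FiniteDimensional ℂ L]
  [LieAlgebra.IsKilling ℂ L] {H : LieSubalgebra ℂ L} [H.IsCartanSubalgebra]

/-- The form on `𝔥^*` induced by the restriction of the Killing form to `𝔥`. Its values on the
real span of the roots, hence on pairs of a root and a weight in `P⁺`, are real numbers. -/
def form (lam mu : Module.Dual ℂ H) : ℂ :=
  killingForm ℂ L ((LieAlgebra.IsKilling.cartanEquivDual H).symm lam : H)
    ((LieAlgebra.IsKilling.cartanEquivDual H).symm mu : H)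

/-- The root `α ∈ R` as an element of `𝔥^*`. -/
abbrev rt (α : H.root) : Module.Dual ℂ H := (LieAlgebra.IsKilling.rootSystem H).root α

/-- The coroot `h_α ∈ 𝔥`. -/
abbrev crt (α : H.root) : H := (LieAlgebra.IsKilling.rootSystem H).coroot α

/-- The root space `𝔤_α`. -/
abbrev rsp (α : H.root) : Submodule ℂ L := (LieAlgebra.rootSpace H (α.1 : H → ℂ)).toSubmodule

/-- The root space `𝔤_{-α} = ℂ x_α^-`. -/
abbrev rspNeg (α : H.root) : Submodule ℂ L :=
  (LieAlgebra.rootSpace H (-(α.1 : H → ℂ))).toSubmodule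

variable (b : (LieAlgebra.IsKilling.rootSystem H).Base)

/-- `𝔫⁺`, the sum of the root spaces of the positive roots. -/
def nPlus : Submodule ℂ L := ⨆ α : {α : H.root // b.IsPos α}, rsp α.1

/-- The set `P⁺` of dominant integral weights: the `μ` with `μ(h_i) ∈ ℤ₊` for the simple coroots
`h_i`, equivalently the `ℤ₊`-span of the fundamental weights. -/
def DomWt : Type u := {mu : Module.Dual ℂ H // ∀ i ∈ b.support, ∃ n : ℕ, mu (crt i) = n}

/-- The defining relations of `V(μ)`. -/
def irrRel (mu : DomWt b) : Set (UG L) :=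
  {a | ∃ h : H, a = UniversalEnvelopingAlgebra.ι ℂ (h : L) - algebraMap ℂ (UG L) (mu.1 h)} ∪
  {a | ∃ i ∈ b.support, ∃ x ∈ rsp i, a = UniversalEnvelopingAlgebra.ι ℂ x} ∪
  {a | ∃ i ∈ b.support, ∃ x ∈ rspNeg i, ∃ n : ℕ, mu.1 (crt i) = n ∧
    a = UniversalEnvelopingAlgebra.ι ℂ x ^ (n + 1)}

/-- The `𝔤`-module `V(μ)`, given by a generator `v_μ` and the defining relations. -/
def Irr (mu : DomWt b) : Type u := UG L ⧸ Submodule.span (UG L) (irrRel b mu)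

instance (mu : DomWt b) : AddCommGroup (Irr b mu) :=
  inferInstanceAs (AddCommGroup (UG L ⧸ Submodule.span (UG L) (irrRel b mu)))

instance (mu : DomWt b) : Module (UG L) (Irr b mu) :=
  inferInstanceAs (Module (UG L) (UG L ⧸ Submodule.span (UG L) (irrRel b mu)))

instance (mu : DomWt b) : Module ℂ (Irr b mu) :=
  inferInstanceAs (Module ℂ (UG L ⧸ Submodule.span (UG L) (irrRel b mu)))

instance (mu : DomWt b) : IsScalarTower ℂ (UG L) (Irr b mu) :=
  inferInstanceAs (IsScalarTower ℂ (UG L) (UG L ⧸ Submodule.span (UG L) (irrRel b mu)))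

instance (mu : DomWt b) : LieRingModule L (Irr b mu) := lieRingModuleOfUEA L _

instance (mu : DomWt b) : LieModule ℂ L (Irr b mu) := lieModuleOfUEA L _

/-- The generator `v_μ` of `V(μ)`. -/
def irrGen (mu : DomWt b) : Irr b mu := Submodule.mkQ (Submodule.span (UG L) (irrRel b mu)) 1

/-! ### The poset `Λ = P⁺ × ℤ₊` and the categories `𝒢₂[Γ]` -/

/-- `Λ = P⁺ × ℤ₊`. -/
abbrev Lam : Type u := DomWt b × ℕ

variable {b}

/-- `Covers γ' γ`: the element `γ' = (μ, s)` covers `γ = (λ, r)`. -/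
def Covers (γ' γ : Lam b) : Prop :=
  γ'.2 = γ.2 + 1 ∧ ((∃ α : H.root, γ'.1.1 - γ.1.1 = rt α) ∨ γ'.1.1 - γ.1.1 = 0)

/-- The partial order `γ ≼ γ'` generated by the cover relation. -/
def Prec (γ γ' : Lam b) : Prop := Relation.ReflTransGen (fun x y => Covers y x) γ γ'

/-- Interval closed subsets of `Λ`. -/
def IntervalClosed (Γ : Set (Lam b)) : Prop :=
  ∀ γ ∈ Γ, ∀ γ' ∈ Γ, ∀ γ'', Prec γ γ'' → Prec γ'' γ' → γ'' ∈ Γ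

/-- The subset `Γ(λ, S)` of `Λ`, for a set `S` of roots. -/
def GammaSet (lam : DomWt b) (S : Set H.root) : Set (Lam b) :=
  {γ | ∃ n : H.root → ℕ, (∀ β, β ∉ S → n β = 0) ∧
    γ.1.1 = lam.1 - ∑ β, n β • rt β ∧ ∑ β, n β = γ.2}

/-- The multiplicity `[V : ev_r V(λ)] = dim Hom_𝔤(V(λ), V[r])`. -/
def mult (M : GrMod L) (γ : Lam b) : Cardinal.{u} :=
  Module.rank ℂ (Irr b γ.1 →ₗ⁅ℂ, L⁆ M.deg γ.2)

/-- The objects of `𝒢₂[Γ]`. -/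
def inG2Gamma (Γ : Set (Lam b)) : ObjectProperty (GrMod L) :=
  fun M => InG2 M ∧ ∀ γ, mult M γ ≠ 0 → γ ∈ Γ

/-- The category `𝒢₂[Γ]`. -/
abbrev G2Gamma (Γ : Set (Lam b)) : Type (u + 1) := (inG2Gamma Γ).FullSubcategory

/-- The kernel of `V → V^Γ`: the smallest graded submodule whose quotient is in `𝒢₂[Γ]`, that is,
the intersection of the graded submodules with quotient in `𝒢₂[Γ]`. -/
def truncKer (M : GrMod L) (Γ : Set (Lam b)) : M.GrSub where
  toLie := ⨅ N : {N : M.GrSub // inG2Gamma Γ (M.quot N)}, N.1.toLie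
  homogeneous k m hm := by
    rw [LieSubmodule.mem_iInf] at hm ⊢
    exact fun N => N.1.homogeneous k m (hm N)

/-- The maximal quotient `V^Γ` of `V` which lies in `𝒢₂[Γ]`. -/
def trunc (M : GrMod L) (Γ : Set (Lam b)) : GrMod L := M.quot (truncKer M Γ)

/-- The module `ev_r V(μ)`. -/
def evIrr (γ : Lam b) : GrMod L := evModule γ.2 (Irr b γ.1)

/-- The module `P(μ, r) = U(𝔤 ⋉ 𝔤_ad) ⊗_{U(𝔤)} ev_r V(μ)`. -/
def P (γ : Lam b) : GrMod L := indModule (Irr b γ.1) γ.2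

/-- The generator `p_{μ,r} = 1 ⊗ v_μ` of `P(μ, r)`. -/
def pGen (γ : Lam b) : (P γ).carrier :=
  (Ind.mk ((1 : UT L) ⊗ₜ[ℂ] irrGen b γ.1) : Ind (L := L) (Irr b γ.1))

/-- The image `p_{μ,r}^Γ` of `p_{μ,r}` in `P(μ, r)^Γ`. -/
def pGenTrunc (γ : Lam b) (Γ : Set (Lam b)) : (trunc (P γ) Γ).carrier :=
  LieSubmodule.Quotient.mk' (truncKer (P γ) Γ).toLie (pGen γ)

/-- The relations `𝔫⁺ p = 0`, `h p = μ(h) p`, `(x_i^-)^{μ(h_i)+1} p = 0`. -/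
def hwRel (mu : DomWt b) : Set (UT L) :=
  {a | ∃ x ∈ nPlus b, a = UniversalEnvelopingAlgebra.ι ℂ (inG x)} ∪
  {a | ∃ h : H, a = UniversalEnvelopingAlgebra.ι ℂ (inG (h : L)) -
    algebraMap ℂ (UT L) (mu.1 h)} ∪
  {a | ∃ i ∈ b.support, ∃ x ∈ rspNeg i, ∃ n : ℕ, mu.1 (crt i) = n ∧
    a = UniversalEnvelopingAlgebra.ι ℂ (inG x) ^ (n + 1)}

variable (b) in
/-- The relations `(𝔫⁺)_ad p = 0 = 𝔥_ad p`, `(x_α^-)_ad p = 0` for `α ∈ R⁺ \ Ψ`. -/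
def adRel (Ψ : Set H.root) : Set (UT L) :=
  {a | ∃ x ∈ nPlus b, a = UniversalEnvelopingAlgebra.ι ℂ (inAd x)} ∪
  {a | ∃ h : H, a = UniversalEnvelopingAlgebra.ι ℂ (inAd (h : L))} ∪
  {a | ∃ α : H.root, b.IsPos α ∧ α ∉ Ψ ∧ ∃ x ∈ rspNeg α,
    a = UniversalEnvelopingAlgebra.ι ℂ (inAd x)}

end Weights

/-- `π : P ⟶ X` is a projective cover: `P` is projective and `π` is an essential epimorphism. -/
def IsProjectiveCover {C : Type*} [Category C] {P X : C} (π : P ⟶ X) : Prop :=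
  Projective P ∧ Epi π ∧ ∀ (Q : C) (g : Q ⟶ P), Epi (g ≫ π) → Epi g

end

end GradedAdjoint

set_option linter.unusedSectionVars false

/-! Let M be the maximum of (β, ξ) over the roots β. It is positive, since M = 0 would put some α
and -α both in Ψ. Everything rests on the potential (μ, ξ) + rM on Λ. A covering step raises r by
one and changes μ by a root α or by 0, so the potential grows by (α, ξ) + M or by M. This is never
negative, and it is zero exactly when the step is by a root α with -α ∈ Ψ. On Γ the potential is
constant, equal to (λ, ξ). Hence Γ is interval closed, and it is finite because (μ, ξ) ≥ 0 for
dominant μ, which bounds r.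

The relations hold in P(μ, r)^Γ: if y ∈ 𝔤 has weight ε with (ε, ξ) > -M and (y)_ad p ≠ 0, raising
this vector to a highest weight vector gives an element of Γ whose potential exceeds (λ, ξ), a
contradiction (`inAd_lie_eq_zero_of_lt`).

Conversely, take a module generated by p with these relations. Let Z_k be the span of the vectors
obtained from p by applying k elements of the (𝔤_{-β})_ad, β ∈ Ψ. Elements of 𝔤_ad commute, so 𝔥_ad
and all the other root vectors of 𝔤_ad kill Z_k. It follows that Z_k is 𝔫⁺-stable and generates the
piece of degree r + k over 𝔤. Its weights are μ minus sums of k elements of Ψ, and a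
finite-dimensional 𝔤-module generated by such a space has its highest weights among the weights of
that space (`IsHW.mem_of_lieSpan_eq_top`). So the module is in 𝒢₂[Γ] (`inG2Gamma_of_relations`), and
the two halves identify the kernel of P(μ, r) → P(μ, r)^Γ (`truncKer_P`).

For projectivity, P(μ, r) is presented by the highest weight relations, so a map from P(μ, r)^Γ to
an object of 𝒢₂[Γ] is a highest weight vector of weight μ in degree r, or zero. Such vectors lift
along surjections (`IsHW.exists_lift`); the Casimir operator and 𝔰𝔩₂-theory give this directly,
without a decomposition into irreducibles. The cover is essential because P(μ, r)^Γ and V(μ) agree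
in degree r. That P(μ, r) has finite-dimensional pieces requires V(μ), defined by generators and
relations, to be finite-dimensional; this comes from a bound on the length of its weights
(`finiteDimensional_of_isHW`). Nowhere is it needed that v_μ ≠ 0. -/

namespace GradedAdjoint

noncomputable section

attribute [local instance 100] LieRing.ofAssociativeRing

attribute [-simp] LieAlgebra.IsKilling.rootSystem_root_apply
  LieAlgebra.IsKilling.rootSystem_coroot_apply

/-! ### The form on 𝔥^*: reality and positivity on integral weights -/

section Form

open LieAlgebra LieAlgebra.IsKilling Module

variable {L : Type u} [LieRing L] [LieAlgebra ℂ L] [FiniteDimensional ℂ L]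
  [LieAlgebra.IsKilling ℂ L] {H : LieSubalgebra ℂ L} [H.IsCartanSubalgebra]

/-- The element of `𝔥` dual to `lam ∈ 𝔥^*` with respect to the Killing form. -/
abbrev dualElt (lam : Dual ℂ H) : H := (cartanEquivDual H).symm lam

theorem killingForm_dualElt (lam : Dual ℂ H) (h : H) :
    killingForm ℂ L (dualElt lam : H) h = lam h :=
  LinearMap.BilinForm.apply_toDual_symm_apply (hB := traceForm_cartan_nondegenerate ℂ L H) _ _

theorem form_eq (lam mu : Dual ℂ H) : form lam mu = lam (dualElt mu) :=
  killingForm_dualElt lam _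

theorem form_comm (lam mu : Dual ℂ H) : form lam mu = form mu lam :=
  LieModule.traceForm_comm ℂ L L _ _

theorem form_eq' (lam mu : Dual ℂ H) : form lam mu = mu (dualElt lam) := by
  rw [form_comm, form_eq]

/-- The bilinear form on `𝔥^*` induced by the Killing form. -/
def formB : LinearMap.BilinForm ℂ (Dual ℂ H) :=
  LinearMap.mk₂ ℂ form (fun a c d => by simp [form_eq]) (fun t a c => by simp [form_eq])
    (fun a c d => by simp [form_eq']) (fun t a c => by simp [form_eq'])

theorem formB_apply (lam mu : Dual ℂ H) : formB lam mu = form lam mu := rfl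

/-- The trace defining the Killing form on 𝔥 is computed on the root spaces. This is the source of
all positivity below. -/
theorem form_eq_sum (lam mu : Dual ℂ H) :
    form lam mu = ∑ α : H.root, form (rt α) lam * form (rt α) mu := by
  have h := congrArg (fun B => B (dualElt lam) (dualElt mu)) (restrict_killingForm_eq_sum (H := H))
  rw [← Finset.sum_coe_sort] at h
  rw [form]
  simp only [form_eq]
  exact h.trans (by simp [LinearMap.sum_apply, rt]; rfl)

theorem form_rt_self_ne_zero (α : H.root) : form (rt α) (rt α) ≠ 0 := by
  rw [form_eq]
  exact root_apply_cartanEquivDual_symm_ne_zero (LieSubalgebra.isNonZero_coe_root α)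

theorem apply_crt (α : H.root) (lam : Dual ℂ H) :
    lam (crt α) = 2 * (form (rt α) (rt α))⁻¹ * form (rt α) lam := by
  rw [form_eq' (rt α) lam]
  have : crt α = 2 • (form (rt α) (rt α))⁻¹ • dualElt (rt α) := by
    rw [form_eq]; rfl
  rw [this]
  simp [mul_assoc]

theorem form_rt (α : H.root) (lam : Dual ℂ H) :
    form (rt α) lam = lam (crt α) * form (rt α) (rt α) / 2 := by
  rw [apply_crt]
  have := form_rt_self_ne_zero α
  field_simp

theorem rt_apply_crt_self (α : H.root) : rt α (crt α) = 2 :=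
  root_apply_coroot (LieSubalgebra.isNonZero_coe_root α)

theorem exists_int_rt_apply_crt (α β : H.root) : ∃ n : ℤ, rt α (crt β) = n :=
  ⟨_, apply_coroot_eq_cast β.1 α.1⟩

/-- Since (β, α) = β(h_α)(α, α)/2, the sum formula reads (α, α) = (α, α)² ∑ β(h_α)²/4. The β(h_α)
are integers, so (α, α) is the inverse of a positive rational number. -/
theorem exists_form_rt_self (α : H.root) : ∃ c : ℝ, 0 < c ∧ form (rt α) (rt α) = c := by
  have h1 : form (rt α) (rt α) = (form (rt α) (rt α)) ^ 2 * ∑ β : H.root, (rt β (crt α)) ^ 2 / 4 := by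
    conv_lhs => rw [form_eq_sum]
    rw [Finset.mul_sum]
    refine Finset.sum_congr rfl fun β _ => ?_
    rw [form_comm (rt β), form_rt α (rt β)]
    ring
  choose n hn using fun β => exists_int_rt_apply_crt β α
  have h2 : ∑ β : H.root, (rt β (crt α)) ^ 2 / 4 = ((∑ β : H.root, (n β : ℝ) ^ 2 / 4 : ℝ) : ℂ) := by
    push_cast
    exact Finset.sum_congr rfl fun β _ => by rw [hn]
  have h3 : 0 ≤ ∑ β : H.root, (n β : ℝ) ^ 2 / 4 := Finset.sum_nonneg fun β _ => by positivity
  set s := ∑ β : H.root, (n β : ℝ) ^ 2 / 4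
  have h0 := form_rt_self_ne_zero α
  rw [h2] at h1
  have h4 : form (rt α) (rt α) * (s : ℂ) = 1 := by
    have : form (rt α) (rt α) * (form (rt α) (rt α) * (s : ℂ)) = form (rt α) (rt α) * 1 := by
      rw [mul_one]
      conv_rhs => rw [h1]
      ring
    exact mul_left_cancel₀ h0 this
  have h5 : s ≠ 0 := by rintro h; rw [h] at h4; simp at h4
  refine ⟨s⁻¹, inv_pos.2 (lt_of_le_of_ne h3 h5.symm), ?_⟩
  rw [Complex.ofReal_inv]
  exact eq_inv_of_mul_eq_one_left h4

/-- The real part of the form on `𝔥^*`. -/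
def ip (lam mu : Dual ℂ H) : ℝ := (form lam mu).re

theorem ip_comm (lam mu : Dual ℂ H) : ip lam mu = ip mu lam := by rw [ip, form_comm, ip]

theorem ip_add_left (a c d : Dual ℂ H) : ip (a + c) d = ip a d + ip c d := by
  simp [ip, ← formB_apply]

theorem ip_add_right (a c d : Dual ℂ H) : ip d (a + c) = ip d a + ip d c := by
  simp [ip, ← formB_apply]

theorem ip_sub_left (a c d : Dual ℂ H) : ip (a - c) d = ip a d - ip c d := by
  simp [ip, ← formB_apply]

theorem ip_sub_right (a c d : Dual ℂ H) : ip d (a - c) = ip d a - ip d c := by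
  simp [ip, ← formB_apply]

theorem ip_neg_left (a d : Dual ℂ H) : ip (-a) d = - ip a d := by
  simp [ip, ← formB_apply]

theorem ip_zero_left (d : Dual ℂ H) : ip 0 d = 0 := by
  simp [ip, ← formB_apply]

theorem ip_nsmul_left (n : ℕ) (a d : Dual ℂ H) : ip (n • a) d = n * ip a d := by
  simp [ip, ← formB_apply]

theorem ip_nsmul_right (n : ℕ) (a d : Dual ℂ H) : ip d (n • a) = n * ip d a := by
  simp [ip, ← formB_apply]

theorem ip_sum_left {ι : Type*} (s : Finset ι) (f : ι → Dual ℂ H) (d : Dual ℂ H) :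
    ip (∑ i ∈ s, f i) d = ∑ i ∈ s, ip (f i) d := by
  simp [ip, ← formB_apply, LinearMap.sum_apply]

theorem ip_sum_right {ι : Type*} (s : Finset ι) (f : ι → Dual ℂ H) (d : Dual ℂ H) :
    ip d (∑ i ∈ s, f i) = ∑ i ∈ s, ip d (f i) := by
  simp [ip, ← formB_apply]

theorem ip_rt_self_pos (α : H.root) : 0 < ip (rt α) (rt α) := by
  obtain ⟨c, hc, h⟩ := exists_form_rt_self α
  simpa [ip, h] using hc

theorem ip_rt_of_int {α : H.root} {lam : Dual ℂ H} {n : ℤ} (h : lam (crt α) = n) :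
    ip (rt α) lam = n * ip (rt α) (rt α) / 2 := by
  obtain ⟨c, hc, h'⟩ := exists_form_rt_self α
  rw [ip, form_rt, h, ip, h']
  have : ((n : ℂ) * (c : ℂ) / 2) = (((n : ℝ) * c / 2 : ℝ) : ℂ) := by push_cast; ring
  rw [this, Complex.ofReal_re, Complex.ofReal_re]

/-- The weights `lam` with `lam(h_α) ∈ ℤ` for all roots `α`. -/
def IsIntegral (lam : Dual ℂ H) : Prop := ∀ α : H.root, ∃ n : ℤ, lam (crt α) = n

theorem isIntegral_rt (α : H.root) : IsIntegral (rt α) := fun β => exists_int_rt_apply_crt α β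

theorem IsIntegral.add {lam mu : Dual ℂ H} (h : IsIntegral lam) (h' : IsIntegral mu) :
    IsIntegral (lam + mu) := fun α => by
  obtain ⟨n, hn⟩ := h α
  obtain ⟨m, hm⟩ := h' α
  exact ⟨n + m, by simp [hn, hm]⟩

theorem IsIntegral.neg {lam : Dual ℂ H} (h : IsIntegral lam) : IsIntegral (-lam) := fun α => by
  obtain ⟨n, hn⟩ := h α
  exact ⟨-n, by simp [hn]⟩

theorem IsIntegral.sub {lam mu : Dual ℂ H} (h : IsIntegral lam) (h' : IsIntegral mu) :
    IsIntegral (lam - mu) := by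
  rw [sub_eq_add_neg]; exact h.add h'.neg

theorem isIntegral_zero : IsIntegral (0 : Dual ℂ H) := fun α => ⟨0, by simp⟩

theorem form_rt_eq_ip {lam : Dual ℂ H} (h : IsIntegral lam) (α : H.root) :
    form (rt α) lam = (ip (rt α) lam : ℂ) := by
  obtain ⟨n, hn⟩ := h α
  obtain ⟨c, hc, h'⟩ := exists_form_rt_self α
  rw [ip_rt_of_int hn, form_rt, hn, ip, h']
  push_cast
  simp

/-- On integral weights every factor of the sum formula is real, so passing to real parts loses
nothing and the form is a sum of squares on the diagonal. -/
theorem ip_eq_sum {lam mu : Dual ℂ H} (h : IsIntegral lam) (h' : IsIntegral mu) :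
    ip lam mu = ∑ α : H.root, ip (rt α) lam * ip (rt α) mu := by
  rw [ip, form_eq_sum]
  simp only [form_rt_eq_ip h, form_rt_eq_ip h']
  simp [← Complex.ofReal_mul]

theorem ip_sq_le {lam : Dual ℂ H} (h : IsIntegral lam) (α : H.root) :
    ip (rt α) lam ^ 2 ≤ ip lam lam := by
  rw [ip_eq_sum h h, sq]
  exact Finset.single_le_sum (f := fun α : H.root => ip (rt α) lam * ip (rt α) lam)
    (fun β _ => mul_self_nonneg _) (Finset.mem_univ α)

/-- The root `-α`. -/
def negRt (α : H.root) : H.root := ⟨-α.1, by simpa using LieSubalgebra.isNonZero_coe_root α⟩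

theorem rt_negRt (α : H.root) : rt (negRt α) = - rt α := rfl

theorem rt_ne_zero (α : H.root) : rt α ≠ 0 := (rootSystem H).ne_zero α

theorem rt_injective : Function.Injective (rt : H.root → Dual ℂ H) := (rootSystem H).root.injective

theorem negRt_negRt (α : H.root) : negRt (negRt α) = α := by
  apply rt_injective; simp [rt_negRt]

theorem rsp_negRt (α : H.root) : rsp (negRt α) = rspNeg α := rfl

theorem rspNeg_negRt (α : H.root) : rspNeg (negRt α) = rsp α := by
  rw [← rsp_negRt, negRt_negRt]

theorem lie_of_mem_rsp {α : H.root} {x : L} (hx : x ∈ rsp α) (h : H) : ⁅(h : L), x⁆ = rt α h • x :=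
  lie_eq_smul_of_mem_rootSpace hx h

theorem lie_mem_of_rsp_rspNeg {α : H.root} {x y : L} (hx : x ∈ rsp α) (hy : y ∈ rspNeg α) :
    ⁅x, y⁆ = killingForm ℂ L x y • (dualElt (rt α) : L) :=
  lie_eq_killingForm_smul_of_mem_rootSpace_of_mem_rootSpace_neg hx hy

/-- `𝔤` is spanned by `𝔥` and the root spaces. -/
theorem eq_top_of_cartan_of_rsp (S : Submodule ℂ L) (h0 : ∀ h : H, (h : L) ∈ S)
    (h1 : ∀ α : H.root, rsp α ≤ S) : S = ⊤ := by
  have h := LieAlgebra.cartan_sup_iSup_rootSpace_eq_top (K := ℂ) (L := L) (H := H)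
  rw [← LieSubmodule.toSubmodule_inj, LieSubmodule.top_toSubmodule] at h
  rw [eq_top_iff, ← h]
  simp only [LieSubmodule.sup_toSubmodule, LieSubmodule.iSup_toSubmodule]
  refine sup_le (fun x hx => h0 ⟨x, hx⟩) (iSup₂_le fun α hα => h1 ⟨α, by simpa using hα⟩)

theorem exists_isSl2Triple (α : H.root) : ∃ e ∈ rsp α, ∃ f ∈ rspNeg α,
    IsSl2Triple (crt α : L) e f := by
  have hα := LieSubalgebra.isNonZero_coe_root α
  obtain ⟨h, e, f, ht, he, hf⟩ := exists_isSl2Triple_of_weight_isNonZero hα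
  obtain rfl := ht.h_eq_coroot hα he hf
  exact ⟨e, he, f, hf, ht⟩

theorem exists_smul_eq_of_mem_rsp {α : H.root} {e : L} (he : e ∈ rsp α) (h0 : e ≠ 0) {x : L}
    (hx : x ∈ rsp α) : ∃ t : ℂ, x = t • e := by
  have h := finrank_rootSpace_eq_one α.1 (LieSubalgebra.isNonZero_coe_root α)
  obtain ⟨t, ht⟩ := exists_smul_eq_of_finrank_eq_one h (x := ⟨e, he⟩)
    (by simpa [Subtype.ext_iff] using h0) ⟨x, hx⟩
  exact ⟨t, (congrArg Subtype.val ht).symm⟩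

theorem isNilpotent_toEnd_of_mem_rsp {M : Type*} [AddCommGroup M] [Module ℂ M] [LieRingModule L M]
    [LieModule ℂ L M] [FiniteDimensional ℂ M] {α : H.root} {x : L} (hx : x ∈ rsp α) :
    IsNilpotent (LieModule.toEnd ℂ L M x) :=
  LieModule.isNilpotent_toEnd_of_mem_rootSpace M H (LieSubalgebra.isNonZero_coe_root α) hx

end Form

/-! ### Positive roots, dominant weights, 2ρ and the Casimir eigenvalue -/

section Positive

open LieAlgebra LieAlgebra.IsKilling Module

variable {L : Type u} [LieRing L] [LieAlgebra ℂ L] [FiniteDimensional ℂ L]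
  [LieAlgebra.IsKilling ℂ L] {H : LieSubalgebra ℂ L} [H.IsCartanSubalgebra]
  (b : (LieAlgebra.IsKilling.rootSystem H).Base)

/-- `Q⁺`, the `ℤ₊`-span of the simple roots. -/
def posCone : AddSubmonoid (Dual ℂ H) := AddSubmonoid.closure {x | ∃ i ∈ b.support, x = rt i}

variable {b}

theorem rt_mem_posCone_of_support {i : H.root} (hi : i ∈ b.support) : rt i ∈ posCone b :=
  AddSubmonoid.subset_closure ⟨i, hi, rfl⟩

theorem rt_mem_posCone {α : H.root} (hα : b.IsPos α) : rt α ∈ posCone b := by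
  refine hα.induction_on_add (p := fun α => rt α ∈ posCone b)
    (fun i hi => rt_mem_posCone_of_support hi) ?_
  intro i j k hk hi hj
  rw [rt, hk]
  exact add_mem hi (rt_mem_posCone_of_support hj)

theorem isPos_or_isPos_negRt (b : (LieAlgebra.IsKilling.rootSystem H).Base) (α : H.root) :
    b.IsPos α ∨ b.IsPos (negRt α) := by
  let := (rootSystem H).indexNeg
  have h : -α = negRt α := by
    apply rt_injective
    rw [rt_negRt]
    change (rootSystem H).root (-α) = _
    simp
  rw [← h]
  exact RootPairing.Base.IsPos.or_neg b α

theorem isPos_negRt_iff {α : H.root} : b.IsPos (negRt α) ↔ ¬ b.IsPos α := by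
  let := (rootSystem H).indexNeg
  have h : -α = negRt α := by
    apply rt_injective
    rw [rt_negRt]
    change (rootSystem H).root (-α) = _
    simp
  rw [← h]
  exact RootPairing.Base.IsPos.neg_iff_not b α

variable (b) in
/-- The linear functional which is `1` on the simple roots. -/
def ht : Dual ℂ H →ₗ[ℂ] ℂ := b.toWeightBasis.constr ℂ (fun _ => (1 : ℂ))

theorem ht_rt_of_support {i : H.root} (hi : i ∈ b.support) : ht b (rt i) = 1 := by
  have := b.toWeightBasis.constr_basis ℂ (fun _ => (1 : ℂ)) ⟨i, hi⟩
  simpa [ht] using this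

/-- Heights on Q⁺ are natural numbers that detect zero. This supports inductions on height and shows
that a sum of elements of Q⁺ vanishes only if each does. -/
theorem exists_ht_eq {δ : Dual ℂ H} (hδ : δ ∈ posCone b) : ∃ n : ℕ, ht b δ = n ∧ (n = 0 → δ = 0) := by
  induction hδ using AddSubmonoid.closure_induction with
  | mem x hx =>
    obtain ⟨i, hi, rfl⟩ := hx
    exact ⟨1, by simp [ht_rt_of_support hi], by simp⟩
  | zero => exact ⟨0, by simp, by simp⟩
  | add x y _ _ hx hy =>
    obtain ⟨n, hn, hn'⟩ := hx
    obtain ⟨m, hm, hm'⟩ := hy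
    refine ⟨n + m, by simp [hn, hm], fun h => ?_⟩
    rw [hn' (by omega), hm' (by omega), add_zero]

theorem ne_zero_of_rt_add {α : H.root} (hα : b.IsPos α) {δ : Dual ℂ H} (hδ : δ ∈ posCone b) :
    rt α + δ ≠ 0 := by
  intro h
  obtain ⟨n, hn, hn'⟩ := exists_ht_eq (rt_mem_posCone hα)
  obtain ⟨m, hm, -⟩ := exists_ht_eq hδ
  have h1 := congrArg (ht b) h
  rw [map_add, hn, hm, map_zero] at h1
  have h2 : n + m = 0 := by exact_mod_cast h1
  exact rt_ne_zero α (hn' (by omega))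

theorem isIntegral_of_mem_posCone {δ : Dual ℂ H} (hδ : δ ∈ posCone b) : IsIntegral δ := by
  induction hδ using AddSubmonoid.closure_induction with
  | mem x hx => obtain ⟨i, hi, rfl⟩ := hx; exact isIntegral_rt i
  | zero => exact isIntegral_zero
  | add x y _ _ hx hy => exact hx.add hy

theorem isIntegral_of_support {mu : Dual ℂ H} (h : ∀ i ∈ b.support, ∃ n : ℤ, mu (crt i) = n) :
    IsIntegral mu := by
  have key : ∀ x ∈ AddSubmonoid.closure ((rootSystem H).coroot '' b.support), ∃ n : ℤ, mu x = n := by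
    intro x hx
    induction hx using AddSubmonoid.closure_induction with
    | mem x hx => obtain ⟨i, hi, rfl⟩ := hx; exact h i hi
    | zero => exact ⟨0, by simp⟩
    | add x y _ _ hx hy =>
      obtain ⟨n, hn⟩ := hx
      obtain ⟨m, hm⟩ := hy
      exact ⟨n + m, by simp [hn, hm]⟩
  intro α
  rcases b.coroot_mem_or_neg_mem α with h | h
  · exact key _ h
  · obtain ⟨n, hn⟩ := key _ h
    rw [map_neg] at hn
    exact ⟨-n, by rw [Int.cast_neg, ← hn, neg_neg]⟩

theorem DomWt.isIntegral (mu : DomWt b) : IsIntegral mu.1 :=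
  isIntegral_of_support fun i hi => by
    obtain ⟨n, hn⟩ := mu.2 i hi
    exact ⟨n, by simp [hn]⟩

theorem ip_nonneg_of_mem_posCone {δ : Dual ℂ H} (hδ : δ ∈ posCone b) (mu : DomWt b) :
    0 ≤ ip δ mu.1 := by
  induction hδ using AddSubmonoid.closure_induction with
  | mem x hx =>
    obtain ⟨i, hi, rfl⟩ := hx
    obtain ⟨n, hn⟩ := mu.2 i hi
    rw [ip_rt_of_int (n := n) (by simp [hn])]
    have := ip_rt_self_pos i
    positivity
  | zero => simp [ip_zero_left]
  | add x y _ _ hx hy => rw [ip_add_left]; positivity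

/-- In the sum over roots the two factors always have the same sign: both are nonnegative at a
positive root and nonpositive at a negative one. -/
theorem ip_domWt_nonneg (mu nu : DomWt b) : 0 ≤ ip mu.1 nu.1 := by
  rw [ip_eq_sum mu.isIntegral nu.isIntegral]
  refine Finset.sum_nonneg fun α _ => ?_
  rcases isPos_or_isPos_negRt b α with h | h
  · exact mul_nonneg (ip_nonneg_of_mem_posCone (rt_mem_posCone h) mu)
      (ip_nonneg_of_mem_posCone (rt_mem_posCone h) nu)
  · have h1 := ip_nonneg_of_mem_posCone (rt_mem_posCone h) mu
    have h2 := ip_nonneg_of_mem_posCone (rt_mem_posCone h) nu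
    rw [rt_negRt, ip_neg_left] at h1 h2
    nlinarith

variable (b) in
open Classical in
/-- `2ρ`, the sum of the positive roots. -/
def twoRho : Dual ℂ H := ∑ α ∈ Finset.univ.filter (fun α : H.root => b.IsPos α), rt α

theorem rt_reflectionPerm (i α : H.root) :
    rt ((rootSystem H).reflectionPerm i α) = rt α - rt α (crt i) • rt i := by
  rw [rt, (rootSystem H).root_reflectionPerm, (rootSystem H).reflection_apply_root]
  rfl

/-- The simple reflection s_i permutes the positive roots other than α_i and changes the sign of
their values at h_i. These values therefore sum to zero, and only α_i(h_i) = 2 remains. -/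
theorem twoRho_apply_crt {i : H.root} (hi : i ∈ b.support) : twoRho b (crt i) = 2 := by
  classical
  have hip : b.IsPos i := RootPairing.Base.isPos_of_mem_support hi
  have h0 : twoRho b = rt i + ∑ α ∈ (Finset.univ.filter (fun α : H.root => b.IsPos α)).erase i, rt α := by
    rw [Finset.add_sum_erase _ _ (by simpa using hip)]
    unfold twoRho
    congr
  have h1 : (∑ α ∈ (Finset.univ.filter (fun α : H.root => b.IsPos α)).erase i, rt α) (crt i) = 0 := by
    rw [LinearMap.sum_apply]
    set s := (Finset.univ.filter (fun α : H.root => b.IsPos α)).erase i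
    have h2 : ∑ α ∈ s, rt α (crt i) = ∑ α ∈ s, - rt α (crt i) := by
      have hs : ∀ α ∈ s, (rootSystem H).reflectionPerm i α ∈ s := by
        intro α hα
        simp only [s, Finset.mem_erase, Finset.mem_filter, Finset.mem_univ, true_and] at hα ⊢
        refine ⟨fun h => ?_, hα.2.reflectionPerm hi hα.1⟩
        have h4 : (rootSystem H).reflectionPerm i ((rootSystem H).reflectionPerm i α) =
          (rootSystem H).reflectionPerm i i := by rw [h]
        have h5 : α = negRt i := by
          apply rt_injective
          rw [(rootSystem H).reflectionPerm_self] at h4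
          rw [h4, rt_reflectionPerm, rt_apply_crt_self, rt_negRt, two_smul]; abel
        rw [h5, isPos_negRt_iff] at hα
        exact hα.2 hip
      refine Finset.sum_bij' (fun α _ => (rootSystem H).reflectionPerm i α)
        (fun α _ => (rootSystem H).reflectionPerm i α) hs hs ?_ ?_ ?_
      · intro α _; exact (rootSystem H).reflectionPerm_self i α
      · intro α _; exact (rootSystem H).reflectionPerm_self i α
      · intro α _
        rw [rt_reflectionPerm]
        simp only [LinearMap.sub_apply, LinearMap.smul_apply, rt_apply_crt_self, smul_eq_mul]
        ring
    rw [Finset.sum_neg_distrib] at h2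
    exact self_eq_neg.1 h2
  rw [h0, LinearMap.add_apply, h1, rt_apply_crt_self, add_zero]

theorem ip_rt_twoRho {i : H.root} (hi : i ∈ b.support) : ip (rt i) (twoRho b) = ip (rt i) (rt i) := by
  rw [ip_rt_of_int (n := 2) (by simp [twoRho_apply_crt hi])]
  push_cast; ring

/-- Pairing with 2ρ controls height: (α_i, 2ρ) = (α_i, α_i) for simple α_i, so the least value of
(α, α) serves as the constant. -/
theorem exists_ip_twoRho_ge (b : (LieAlgebra.IsKilling.rootSystem H).Base) :
    ∃ c : ℝ, 0 < c ∧ ∀ δ ∈ posCone b, ∀ n : ℕ, ht b δ = n → c * n ≤ ip δ (twoRho b) := by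
  obtain ⟨c, hc, hc'⟩ : ∃ c : ℝ, 0 < c ∧ ∀ i : H.root, c ≤ ip (rt i) (rt i) := by
    rcases isEmpty_or_nonempty H.root with h | h
    · exact ⟨1, one_pos, fun i => h.elim i⟩
    · obtain ⟨j, hj⟩ := Finite.exists_min (fun i : H.root => ip (rt i) (rt i))
      exact ⟨_, ip_rt_self_pos j, hj⟩
  refine ⟨c, hc, fun δ hδ => ?_⟩
  induction hδ using AddSubmonoid.closure_induction with
  | mem x hx =>
    obtain ⟨i, hi, rfl⟩ := hx
    intro n hn
    rw [ht_rt_of_support hi] at hn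
    have : n = 1 := by exact_mod_cast hn.symm
    subst this
    rw [ip_rt_twoRho hi]
    simpa using hc' i
  | zero =>
    intro n hn
    have : n = 0 := by simpa using hn.symm
    simp [this, ip_zero_left]
  | add x y hx' hy' hx hy =>
    intro n hn
    obtain ⟨p, hp, -⟩ := exists_ht_eq hx'
    obtain ⟨q, hq, -⟩ := exists_ht_eq hy'
    have : n = p + q := by
      rw [map_add, hp, hq] at hn
      exact_mod_cast hn.symm
    subst this
    have h1 := hx p hp
    have h2 := hy q hq
    rw [ip_add_left]
    push_cast
    linarith

variable (b) in
/-- The eigenvalue of the Casimir operator on a highest weight vector. -/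
def casimirValue (nu : Dual ℂ H) : ℂ := form nu nu + form nu (twoRho b)

/-- The two values differ by (ν' - ν, ν' + ν + 2ρ). Both dominant weights contribute nonnegatively,
and 2ρ contributes at least a positive multiple of the height of ν' - ν. -/
theorem casimirValue_injective {nu nu' : DomWt b} (h : casimirValue b nu.1 = casimirValue b nu'.1)
    (hδ : nu'.1 - nu.1 ∈ posCone b) : nu'.1 = nu.1 := by
  have h1 := congrArg Complex.re h
  simp only [casimirValue, Complex.add_re] at h1
  change ip _ _ + ip _ _ = ip _ _ + ip _ _ at h1
  obtain ⟨c, hc, hc'⟩ := exists_ip_twoRho_ge b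
  obtain ⟨n, hn, hn'⟩ := exists_ht_eq hδ
  have h2 := hc' _ hδ n hn
  have h3 := ip_nonneg_of_mem_posCone hδ nu
  have h4 := ip_nonneg_of_mem_posCone hδ nu'
  rw [ip_sub_left] at h2 h3 h4
  have h5 := ip_comm nu.1 nu'.1
  have h6 : c * n ≤ 0 := by linarith
  have h7 : (n : ℝ) ≤ 0 := by
    by_contra hh
    nlinarith [mul_pos hc (not_le.1 hh)]
  have h8 : n = 0 := by exact_mod_cast le_antisymm h7 (Nat.cast_nonneg n)
  exact sub_eq_zero.1 (hn' h8)

end Positive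

/-! ### Weight vectors and highest weight vectors -/

section HighestWeight

open LieAlgebra LieAlgebra.IsKilling Module

variable {L : Type u} [LieRing L] [LieAlgebra ℂ L] [FiniteDimensional ℂ L]
  [LieAlgebra.IsKilling ℂ L] {H : LieSubalgebra ℂ L} [H.IsCartanSubalgebra]
  (b : (LieAlgebra.IsKilling.rootSystem H).Base)
  {M : Type*} [AddCommGroup M] [Module ℂ M] [LieRingModule L M] [LieModule ℂ L M]
  {N : Type*} [AddCommGroup N] [Module ℂ N] [LieRingModule L N] [LieModule ℂ L N]

variable (M) in
/-- The weight space of weight `nu` in a `𝔤`-module. -/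
def wtSpace (nu : Dual ℂ H) : Submodule ℂ M := (LieModule.weightSpace M (nu : H → ℂ)).toSubmodule

theorem mem_wtSpace {nu : Dual ℂ H} {v : M} :
    v ∈ wtSpace M nu ↔ ∀ h : H, ⁅(h : L), v⁆ = nu h • v :=
  LieModule.mem_weightSpace _ v

theorem lie_mem_wtSpace {nu : Dual ℂ H} {v : M} (hv : v ∈ wtSpace M nu) {α : H.root} {x : L}
    (hx : x ∈ rsp α) : ⁅x, v⁆ ∈ wtSpace M (nu + rt α) := by
  rw [mem_wtSpace] at hv ⊢
  intro h
  rw [leibniz_lie, lie_of_mem_rsp hx, hv, lie_smul, smul_lie, ← add_smul]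
  congr 1
  rw [LinearMap.add_apply, add_comm]

theorem lie_mem_wtSpace_sub {nu : Dual ℂ H} {v : M} (hv : v ∈ wtSpace M nu) {α : H.root} {x : L}
    (hx : x ∈ rspNeg α) : ⁅x, v⁆ ∈ wtSpace M (nu - rt α) := by
  rw [sub_eq_add_neg, ← rt_negRt]
  exact lie_mem_wtSpace hv hx

theorem map_mem_wtSpace (f : M →ₗ⁅ℂ, L⁆ N) {nu : Dual ℂ H} {v : M} (hv : v ∈ wtSpace M nu) :
    f v ∈ wtSpace N nu := by
  rw [mem_wtSpace] at hv ⊢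
  intro h
  rw [← LieModuleHom.map_lie, hv, map_smul]

theorem mem_of_mem_iSup_wtSpace {nu : Dual ℂ H} {v : M} (hv : v ∈ wtSpace M nu) (h0 : v ≠ 0)
    {S : Set (Dual ℂ H)} (hS : v ∈ ⨆ ω ∈ S, wtSpace M ω) : nu ∈ S := by
  by_contra hn
  have hind := LieModule.iSupIndep_genWeightSpace ℂ H M
  have h1 := hind (nu : H → ℂ)
  rw [← LieSubmodule.disjoint_toSubmodule] at h1
  refine h0 (Submodule.disjoint_def.1 h1 v (LieModule.weightSpace_le_genWeightSpace M _ hv) ?_)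
  refine (iSup₂_le fun ω hω => ?_ : (⨆ ω ∈ S, wtSpace M ω) ≤ _) hS
  have hne : (ω : H → ℂ) ≠ nu := fun h => hn (by rwa [← DFunLike.coe_injective h])
  refine le_trans (LieModule.weightSpace_le_genWeightSpace M (ω : H → ℂ)) ?_
  exact (LieSubmodule.toSubmodule_le_toSubmodule _ _).2
    (le_iSup₂_of_le (f := fun (χ : H → ℂ) (_ : χ ≠ nu) => LieModule.genWeightSpace M χ) _ hne le_rfl)

theorem finite_wtSpace_ne_bot [FiniteDimensional ℂ M] :
    {nu : Dual ℂ H | wtSpace M nu ≠ ⊥}.Finite := by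
  refine Set.Finite.of_finite_image
    ((LieModule.finite_genWeightSpace_ne_bot ℂ H M).subset ?_) DFunLike.coe_injective.injOn
  rintro _ ⟨nu, hnu, rfl⟩ h
  refine hnu (le_bot_iff.1 ?_)
  have := LieModule.weightSpace_le_genWeightSpace M (nu : H → ℂ)
  rw [h] at this
  exact this

/-- `v` is a highest weight vector of weight `nu`. -/
structure IsHW (nu : Dual ℂ H) (v : M) : Prop where
  ne_zero : v ≠ 0
  mem_wtSpace : v ∈ wtSpace M nu
  lie_eq_zero : ∀ α : H.root, b.IsPos α → ∀ x ∈ rsp α, ⁅x, v⁆ = 0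

variable {b}

theorem IsHW.map {nu : Dual ℂ H} {v : M} (hv : IsHW b nu v) (f : M →ₗ⁅ℂ, L⁆ N) (h0 : f v ≠ 0) :
    IsHW b nu (f v) where
  ne_zero := h0
  mem_wtSpace := map_mem_wtSpace f hv.mem_wtSpace
  lie_eq_zero α hα x hx := by rw [← LieModuleHom.map_lie, hv.lie_eq_zero α hα x hx, map_zero]

theorem IsHW.of_map {nu : Dual ℂ H} {v : M} (f : M →ₗ⁅ℂ, L⁆ N) (hf : Function.Injective f)
    (hv : IsHW b nu (f v)) : IsHW b nu v where
  ne_zero h := hv.ne_zero (by rw [h, map_zero])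
  mem_wtSpace := GradedAdjoint.mem_wtSpace.2 fun h => hf (by
    rw [LieModuleHom.map_lie, GradedAdjoint.mem_wtSpace.1 hv.mem_wtSpace, map_smul])
  lie_eq_zero α hα x hx := hf (by
    rw [LieModuleHom.map_lie, hv.lie_eq_zero α hα x hx, map_zero])

theorem IsHW.lie_nPlus {nu : Dual ℂ H} {v : M} (hv : IsHW b nu v) {x : L} (hx : x ∈ nPlus b) :
    ⁅x, v⁆ = 0 := by
  have h : nPlus b ≤ LinearMap.ker ((LieModule.toEnd ℂ L M : L →ₗ[ℂ] Module.End ℂ M).flip v) :=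
    iSup_le fun α x hx => hv.lie_eq_zero α.1 α.2 x hx
  exact h hx

theorem IsHW.exists_nat [FiniteDimensional ℂ M] {nu : Dual ℂ H} {v : M} (hv : IsHW b nu v)
    {α : H.root} (hα : b.IsPos α) : ∃ n : ℕ, nu (crt α) = n := by
  obtain ⟨e, he, f, hf, ht⟩ := exists_isSl2Triple α
  have hp : ht.HasPrimitiveVectorWith v (nu (crt α)) :=
    ⟨hv.ne_zero, GradedAdjoint.mem_wtSpace.1 hv.mem_wtSpace _, hv.lie_eq_zero α hα e he⟩
  exact hp.exists_nat

/-- The weight of a highest weight vector in a finite-dimensional module, as an element of `P⁺`. -/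
def IsHW.domWt [FiniteDimensional ℂ M] {nu : Dual ℂ H} {v : M} (hv : IsHW b nu v) : DomWt b :=
  ⟨nu, fun _ hi => hv.exists_nat (RootPairing.Base.isPos_of_mem_support hi)⟩

theorem exists_smul_eq_of_mem_rspNeg {α : H.root} {e : L} (he : e ∈ rspNeg α) (h0 : e ≠ 0) {x : L}
    (hx : x ∈ rspNeg α) : ∃ t : ℂ, x = t • e :=
  exists_smul_eq_of_mem_rsp (α := negRt α) he h0 hx

theorem IsHW.pow_toEnd_eq_zero [FiniteDimensional ℂ M] {nu : Dual ℂ H} {v : M} (hv : IsHW b nu v)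
    {α : H.root} (hα : b.IsPos α) {x : L} (hx : x ∈ rspNeg α) {n : ℕ} (hn : nu (crt α) = n) :
    (LieModule.toEnd ℂ L M x ^ (n + 1)) v = 0 := by
  obtain ⟨e, he, f, hf, ht⟩ := exists_isSl2Triple α
  have hp : ht.HasPrimitiveVectorWith v (nu (crt α)) :=
    ⟨hv.ne_zero, GradedAdjoint.mem_wtSpace.1 hv.mem_wtSpace _, hv.lie_eq_zero α hα e he⟩
  obtain ⟨t, rfl⟩ := exists_smul_eq_of_mem_rspNeg hf ht.f_ne_zero hx
  have := hp.pow_toEnd_f_eq_zero_of_eq_nat hn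
  rw [map_smul, smul_pow, LinearMap.smul_apply, this, smul_zero]

/-- Raising a weight vector in an `𝔫⁺`-stable subspace to a highest weight vector. -/
theorem exists_isHW_of_mem [FiniteDimensional ℂ M] (Z : Submodule ℂ M)
    (hZ : ∀ α : H.root, b.IsPos α → ∀ x ∈ rsp α, ∀ z ∈ Z, ⁅x, z⁆ ∈ Z)
    {chi : Dual ℂ H} {v : M} (hv : v ∈ wtSpace M chi) (h0 : v ≠ 0) (hvZ : v ∈ Z) :
    ∃ δ ∈ posCone b, ∃ w ∈ Z, IsHW b (chi + δ) w := by
  let S : Set (Dual ℂ H) := {nu | nu - chi ∈ posCone b ∧ ∃ w ∈ Z, w ≠ 0 ∧ w ∈ wtSpace M nu}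
  have hfin : S.Finite := by
    refine (finite_wtSpace_ne_bot (M := M)).subset ?_
    rintro nu ⟨-, w, -, hw0, hw⟩ h
    rw [h, Submodule.mem_bot] at hw
    exact hw0 hw
  have hne : S.Nonempty := ⟨chi, by rw [sub_self]; exact zero_mem _, v, hvZ, h0, hv⟩
  -- Among the finitely many weights of Z in χ + Q⁺, one of maximal height works: a nonzero image
  -- under a positive root vector would be higher. Heights are compared by real parts because χ may
  -- have a complex height.
  obtain ⟨nu, ⟨hnu, w, hwZ, hw0, hw⟩, hmax⟩ := hfin.exists_maximalFor (fun nu => (ht b nu).re) S hne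
  refine ⟨nu - chi, hnu, w, hwZ, ?_⟩
  rw [add_sub_cancel]
  refine ⟨hw0, hw, fun α hα x hx => ?_⟩
  by_contra hxw
  have hmem : nu + rt α ∈ S := by
    refine ⟨?_, ⁅x, w⁆, hZ α hα x hx w hwZ, hxw, lie_mem_wtSpace hw hx⟩
    rw [add_sub_right_comm]
    exact add_mem hnu (rt_mem_posCone hα)
  obtain ⟨n, hn, hn'⟩ := exists_ht_eq (rt_mem_posCone hα)
  have hn0 : n ≠ 0 := fun h => rt_ne_zero α (hn' h)
  have h2 : (ht b (nu + rt α)).re = (ht b nu).re + n := by simp [hn]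
  have h3 : (ht b (nu + rt α)).re ≤ (ht b nu).re := hmax hmem (by
    change _ ≤ (ht b (nu + rt α)).re
    rw [h2]; simp)
  rw [h2] at h3
  have : (0 : ℝ) < n := by exact_mod_cast Nat.pos_of_ne_zero hn0
  linarith

theorem exists_isHW_of_genWeightSpace_ne_bot [FiniteDimensional ℂ M] {chi : H → ℂ}
    (h : LieModule.genWeightSpace M chi ≠ ⊥) :
    ∃ chi' : Dual ℂ H, (chi' : H → ℂ) = chi ∧ ∃ δ ∈ posCone b, ∃ w : M, IsHW b (chi' + δ) w := by
  let X : LieModule.Weight ℂ H M := ⟨chi, h⟩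
  obtain ⟨m, hm0, hm⟩ := LieModule.exists_forall_lie_eq_smul ℂ H M X
  have hm' : m ∈ wtSpace M (X.toLinear : Dual ℂ H) := mem_wtSpace.2 hm
  obtain ⟨δ, hδ, w, -, hw⟩ := exists_isHW_of_mem (b := b) ⊤ (fun _ _ _ _ _ _ => trivial) hm' hm0 trivial
  exact ⟨X.toLinear, rfl, δ, hδ, w, hw⟩

theorem exists_isHW (b : (LieAlgebra.IsKilling.rootSystem H).Base) [FiniteDimensional ℂ M]
    [Nontrivial M] : ∃ (nu : Dual ℂ H) (w : M), IsHW b nu w := by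
  obtain ⟨chi, hchi⟩ := LieModule.exists_nontrivial_weightSpace_of_isNilpotent (k := ℂ) H M
  obtain ⟨m, hm0⟩ := exists_ne (0 : LieModule.weightSpace M chi)
  obtain ⟨δ, hδ, w, -, hw⟩ := exists_isHW_of_mem (b := b) (M := M) (chi := chi) ⊤
    (fun _ _ _ _ _ _ => trivial) m.2 (by simpa using hm0) trivial
  exact ⟨_, w, hw⟩

/-- A positive root pairs positively with some simple root, so the difference is a root. Its height
is one less than that of α and is not zero, hence it is positive. -/
theorem exists_support_sub_isPos {α : H.root} (hα : b.IsPos α) (hs : α ∉ b.support) :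
    ∃ i ∈ b.support, ∃ β : H.root, b.IsPos β ∧ rt α = rt β + rt i ∧
      ∃ n : ℕ, 0 < n ∧ rt α (crt i) = n := by
  obtain ⟨j, hj, hj'⟩ := hα.exists_mem_support_pos_pairingIn
  rw [(rootSystem H).zero_lt_pairingIn_iff'] at hj'
  have hij : α ≠ j := by rintro rfl; exact hs hj
  obtain ⟨k, hk⟩ := (rootSystem H).root_sub_root_mem_of_pairingIn_pos hj' hij
  have hne := b.height_ne_zero k
  have hk1 := b.height_sub hk
  rw [RootPairing.Base.height_one_of_mem_support hj] at hk1
  have hkpos : b.IsPos k := by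
    rw [RootPairing.Base.isPos_iff] at hα
    rw [RootPairing.Base.isPos_iff']; lia
  refine ⟨j, hj, k, hkpos, by rw [rt, rt, rt, hk]; abel, ?_⟩
  obtain ⟨n, hn⟩ := Int.eq_ofNat_of_zero_le hj'.le
  refine ⟨n, by omega, ?_⟩
  have := (rootSystem H).algebraMap_pairingIn ℤ α j
  rw [hn] at this
  exact this.symm

/-- `𝔫⁺` is generated by the simple root vectors: a non-simple positive root vector is a bracket. -/
theorem exists_eq_lie_of_isPos {α β i : H.root} (hβ : rt α = rt β + rt i) {n : ℕ} (hn0 : 0 < n)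
    (hn : rt α (crt i) = n) {y : L} (hy : y ∈ rsp α) :
    ∃ e ∈ rsp i, ∃ z ∈ rsp β, y = ⁅e, z⁆ := by
  obtain ⟨e, he, f, hf, ht⟩ := exists_isSl2Triple i
  rcases eq_or_ne y 0 with rfl | hy0
  · exact ⟨0, zero_mem _, 0, zero_mem _, by simp⟩
  have hnil : ∃ k, (LieModule.toEnd ℂ L L e ^ k) y = 0 := by
    obtain ⟨k, hk⟩ := isNilpotent_toEnd_of_mem_rsp (M := L) he
    exact ⟨k, by rw [hk]; rfl⟩
  -- Climb the α_i-string to its last nonzero vector z = e^t y, of h-weight n + 2t. Coming back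
  -- down, f^t z spans 𝔤_α and f^{t+1} z lies in 𝔤_β, with e f^{t+1} z = (t+1)(n+t) f^t z. The
  -- scalar is nonzero because n > 0.
  obtain ⟨t, hz0, hz1⟩ := Nat.exists_not_and_succ_of_not_zero_of_exists
    (p := fun k => (LieModule.toEnd ℂ L L e ^ k) y = 0) (by simpa using hy0) hnil
  set z := (LieModule.toEnd ℂ L L e ^ t) y with hz
  have hhz := ht.lie_h_pow_toEnd_e (μ := rt α (crt i)) (lie_of_mem_rsp hy (crt i)) t
  have hp : ht.HasPrimitiveVectorWith z (((n + 2 * t : ℕ) : ℂ)) :=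
    ⟨hz0, by rw [hz, hhz, hn]; push_cast; rfl, by rw [hz, IsSl2Triple.lie_e_pow_toEnd_e]; exact hz1⟩
  have hw0 := hp.pow_toEnd_f_ne_zero_of_eq_nat rfl (i := t) (by omega)
  have hstep := hp.lie_e_pow_succ_toEnd_f t
  have hzm : z ∈ wtSpace L (rt α + t • rt i) := by
    rw [hz]
    clear_value z
    clear hstep hw0 hp hz hz0 hz1
    induction t with
    | zero => simpa [mem_wtSpace] using fun h hh => lie_of_mem_rsp hy ⟨h, hh⟩
    | succ t ih =>
      rw [pow_succ', Module.End.mul_apply, succ_nsmul, ← add_assoc]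
      exact lie_mem_wtSpace (ih (ht.lie_h_pow_toEnd_e (μ := rt α (crt i)) (lie_of_mem_rsp hy (crt i)) t)) he
  have hfm : ∀ k : ℕ, (LieModule.toEnd ℂ L L f ^ k) z ∈ wtSpace L (rt α + t • rt i - k • rt i) := by
    intro k
    induction k with
    | zero => simpa using hzm
    | succ k ih =>
      rw [pow_succ', Module.End.mul_apply, succ_nsmul, ← sub_sub]
      exact lie_mem_wtSpace_sub ih hf
  have hsp : ∀ (γ : H.root) (w : L), w ∈ wtSpace L (rt γ) → w ∈ rsp γ := fun γ w hw =>
    LieModule.weightSpace_le_genWeightSpace L _ hw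
  have h1 : (LieModule.toEnd ℂ L L f ^ t) z ∈ rsp α := hsp _ _ (by simpa using hfm t)
  have h2 : (LieModule.toEnd ℂ L L f ^ (t + 1)) z ∈ rsp β := hsp _ _ (by
    have := hfm (t + 1)
    rw [succ_nsmul, ← sub_sub, add_sub_cancel_right, hβ, add_sub_cancel_right] at this
    exact this)
  obtain ⟨c, hc⟩ := exists_smul_eq_of_mem_rsp h1 hw0 hy
  set d : ℂ := ((t : ℂ) + 1) * (((n + 2 * t : ℕ) : ℂ) - t) with hd
  have hd0 : d ≠ 0 := by
    have : d = (((t + 1) * (n + t) : ℕ) : ℂ) := by rw [hd]; push_cast; ring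
    rw [this, Nat.cast_ne_zero]
    positivity
  refine ⟨(c * d⁻¹) • e, Submodule.smul_mem _ _ he, _, h2, ?_⟩
  rw [smul_lie, hstep, smul_smul, mul_assoc, inv_mul_cancel₀ hd0, mul_one, ← hc]

/-- Induction on height: a non-simple positive root vector is a bracket of a simple root vector with
a root vector of smaller height. It is needed because V(μ) is defined with simple root vectors only.
-/
theorem IsHW.of_support {nu : Dual ℂ H} {v : M} (h0 : v ≠ 0) (hv : v ∈ wtSpace M nu)
    (h : ∀ i ∈ b.support, ∀ x ∈ rsp i, ⁅x, v⁆ = 0) : IsHW b nu v := by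
  refine ⟨h0, hv, fun α hα => ?_⟩
  obtain ⟨n, hn, -⟩ := exists_ht_eq (rt_mem_posCone hα)
  induction n using Nat.strong_induction_on generalizing α with
  | _ n ih =>
    intro x hx
    by_cases hs : α ∈ b.support
    · exact h α hs x hx
    obtain ⟨i, hi, β, hβ, hαβ, m, hm0, hm⟩ := exists_support_sub_isPos hα hs
    obtain ⟨e, he, z, hz, rfl⟩ := exists_eq_lie_of_isPos hαβ hm0 hm hx
    obtain ⟨k, hk, -⟩ := exists_ht_eq (rt_mem_posCone hβ)
    have hlt : k < n := by
      rw [hαβ, map_add, hk, ht_rt_of_support hi] at hn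
      have : k + 1 = n := by exact_mod_cast hn
      omega
    rw [lie_lie, ih k hlt β hβ hk z hz, h i hi e he, lie_zero, lie_zero, sub_zero]

end HighestWeight

/-! ### The Casimir operator -/

section Casimir

open LieAlgebra LieAlgebra.IsKilling Module

variable {L : Type u} [LieRing L] [LieAlgebra ℂ L] [FiniteDimensional ℂ L]
  [LieAlgebra.IsKilling ℂ L] {H : LieSubalgebra ℂ L} [H.IsCartanSubalgebra]

theorem exists_killingForm_eq_one (α : H.root) :
    ∃ p : L × L, p.1 ∈ rsp α ∧ p.2 ∈ rspNeg α ∧ killingForm ℂ L p.1 p.2 = 1 := by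
  obtain ⟨e, he, f, hf, ht⟩ := exists_isSl2Triple α
  have h : killingForm ℂ L e f ≠ 0 := by
    intro h
    have := lie_mem_of_rsp_rspNeg he hf
    rw [h, zero_smul, ht.lie_e_f] at this
    exact ht.h_ne_zero this
  exact ⟨((killingForm ℂ L e f)⁻¹ • e, f), Submodule.smul_mem _ _ he, hf, by simp [h]⟩

/-- Root vectors `e_α ∈ 𝔤_α`, `f_α ∈ 𝔤_{-α}` with `κ(e_α, f_α) = 1`. -/
def rootPair (α : H.root) : L × L := (exists_killingForm_eq_one α).choose

theorem rootPair_fst (α : H.root) : (rootPair α).1 ∈ rsp α :=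
  (exists_killingForm_eq_one α).choose_spec.1

theorem rootPair_snd (α : H.root) : (rootPair α).2 ∈ rspNeg α :=
  (exists_killingForm_eq_one α).choose_spec.2.1

theorem killingForm_rootPair (α : H.root) : killingForm ℂ L (rootPair α).1 (rootPair α).2 = 1 :=
  (exists_killingForm_eq_one α).choose_spec.2.2

theorem killingForm_cartan_rsp (h : H) {α : H.root} {x : L} (hx : x ∈ rsp α) :
    killingForm ℂ L h x = 0 := by
  refine killingForm_apply_eq_zero_of_mem_rootSpace_of_add_ne_zero ℂ L H (α := 0) (β := α.1) ?_ hx ?_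
  · exact LieAlgebra.toLieSubmodule_le_rootSpace_zero ℂ L H h.2
  · rw [zero_add]
    exact LieSubalgebra.isNonZero_coe_root α

theorem killingForm_rsp_rspNeg {α β : H.root} (h : α ≠ β) {x y : L} (hx : x ∈ rsp α)
    (hy : y ∈ rspNeg β) : killingForm ℂ L x y = 0 := by
  refine killingForm_apply_eq_zero_of_mem_rootSpace_of_add_ne_zero ℂ L H (α := α.1)
    (β := (-(β.1 : H → ℂ))) hx hy ?_
  intro h'
  refine h (rt_injective (DFunLike.coe_injective ?_))
  exact add_neg_eq_zero.1 h'

variable (H) in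
/-- The index set of a basis of `𝔤` adapted to the root space decomposition. -/
abbrev CasimirIndex : Type _ := Fin (finrank ℂ H) ⊕ H.root

/-- A basis of `𝔤` adapted to the root space decomposition. -/
def casimirFst : CasimirIndex H → L
  | .inl j => (finBasis ℂ H j : H)
  | .inr α => (rootPair α).1

/-- The dual basis. -/
def casimirSnd : CasimirIndex H → L
  | .inl j => (dualElt ((finBasis ℂ H).coord j) : H)
  | .inr α => (rootPair α).2

/-- Expansion in dual bases. By the orthogonality of 𝔥 and the root spaces, only the Cartan terms
survive for z ∈ 𝔥, and only the term of β for z ∈ 𝔤_β. -/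
theorem sum_killingForm_smul_casimirFst (z : L) :
    ∑ i, killingForm ℂ L z (casimirSnd (H := H) i) • casimirFst i = z := by
  let F : L →ₗ[ℂ] L := ∑ i : CasimirIndex H,
    ((killingForm ℂ L).flip (casimirSnd i)).smulRight (casimirFst i)
  have hF : ∀ z, F z = ∑ i, killingForm ℂ L z (casimirSnd (H := H) i) • casimirFst i := by
    intro z
    simp [F, LinearMap.sum_apply]
  have htop : LinearMap.eqLocus F LinearMap.id = ⊤ := by
    refine eq_top_of_cartan_of_rsp (H := H) _ (fun h => ?_) (fun β z hz => ?_)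
    · rw [LinearMap.mem_eqLocus, hF, Fintype.sum_sum_type]
      have h1 : ∀ α : H.root, killingForm ℂ L (h : L) (casimirSnd (H := H) (.inr α)) = 0 :=
        fun α => killingForm_cartan_rsp h (α := negRt α) (rootPair_snd α)
      have h2 : ∀ j, killingForm ℂ L (h : L) (casimirSnd (H := H) (.inl j)) =
          (finBasis ℂ H).repr h j := fun j => by
        rw [LieModule.traceForm_comm]
        exact killingForm_dualElt _ _
      simp only [h1, h2, zero_smul, Finset.sum_const_zero, add_zero]
      have := congrArg (Subtype.val : H → L) ((finBasis ℂ H).sum_repr h)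
      rw [AddSubmonoidClass.coe_finsetSum] at this
      exact this
    · rw [LinearMap.mem_eqLocus, hF, Fintype.sum_sum_type]
      have h1 : ∀ j, killingForm ℂ L z (casimirSnd (H := H) (.inl j)) = 0 := fun j => by
        rw [LieModule.traceForm_comm]
        exact killingForm_cartan_rsp _ hz
      have h2 : ∀ α : H.root, α ≠ β → killingForm ℂ L z (casimirSnd (H := H) (.inr α)) = 0 :=
        fun α hα => killingForm_rsp_rspNeg hα.symm hz (rootPair_snd α)
      simp only [h1, zero_smul, Finset.sum_const_zero, zero_add]
      rw [Finset.sum_eq_single β (fun α _ hα => by rw [h2 α hα, zero_smul]) (by simp)]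
      have h0 : (rootPair β).1 ≠ 0 := fun h => by
        have := killingForm_rootPair β
        rw [h, map_zero, LinearMap.zero_apply] at this
        exact zero_ne_one this
      obtain ⟨t, rfl⟩ := exists_smul_eq_of_mem_rsp (rootPair_fst β) h0 hz
      change killingForm ℂ L (t • (rootPair β).1) (rootPair β).2 • (rootPair β).1 = _
      rw [map_smul, LinearMap.smul_apply, killingForm_rootPair]
      simp
  have h := (LinearMap.mem_eqLocus (f := F) (g := LinearMap.id)).1 (htop ▸ Submodule.mem_top : z ∈ _)
  rw [hF] at h
  exact h

theorem sum_killingForm_smul_casimirSnd (z : L) :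
    ∑ i, killingForm ℂ L z (casimirFst (H := H) i) • casimirSnd i = z := by
  rw [← sub_eq_zero, ← Submodule.mem_bot (R := ℂ), ← LieAlgebra.IsKilling.ker_killingForm_eq_bot ℂ L,
    LinearMap.mem_ker]
  ext w
  have := congrArg (killingForm ℂ L z) (sum_killingForm_smul_casimirFst (H := H) w)
  rw [map_sub, LinearMap.sub_apply, ← this]
  simp only [map_sum, LinearMap.sum_apply, map_smul, LinearMap.smul_apply, smul_eq_mul,
    LinearMap.zero_apply, sub_eq_zero]
  refine Finset.sum_congr rfl fun i _ => ?_
  rw [LieModule.traceForm_comm ℂ L L w, mul_comm]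

variable {M : Type*} [AddCommGroup M] [Module ℂ M] [LieRingModule L M] [LieModule ℂ L M]
  {N : Type*} [AddCommGroup N] [Module ℂ N] [LieRingModule L N] [LieModule ℂ L N]

variable (H M) in
/-- The Casimir operator. -/
def casimir : Module.End ℂ M := ∑ i : CasimirIndex H,
  LieModule.toEnd ℂ L M (casimirFst i) * LieModule.toEnd ℂ L M (casimirSnd i)

theorem casimir_apply (v : M) : casimir H M v = ∑ i, ⁅casimirFst (H := H) i, ⁅casimirSnd i, v⁆⁆ := by
  simp [casimir, LinearMap.sum_apply]

theorem casimir_map (f : M →ₗ⁅ℂ, L⁆ N) (v : M) : casimir H N (f v) = f (casimir H M v) := by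
  simp [casimir_apply]

/-- By invariance of the Killing form, the matrices of ad z in the two dual bases are negative
transposes of each other, so the commutator terms cancel in pairs. -/
theorem casimir_lie (z : L) (v : M) : casimir H M ⁅z, v⁆ = ⁅z, casimir H M v⁆ := by
  have key : ∑ i, (⁅⁅z, casimirFst (H := H) i⁆, ⁅casimirSnd i, v⁆⁆ +
      ⁅casimirFst (H := H) i, ⁅⁅z, casimirSnd i⁆, v⁆⁆) = 0 := by
    rw [Finset.sum_add_distrib]
    have h1 : ∀ i, ⁅⁅z, casimirFst (H := H) i⁆, ⁅casimirSnd (H := H) i, v⁆⁆ =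
        ∑ j, killingForm ℂ L ⁅z, casimirFst (H := H) i⁆ (casimirSnd (H := H) j) •
          ⁅casimirFst (H := H) j, ⁅casimirSnd (H := H) i, v⁆⁆ := by
      intro i
      conv_lhs => rw [← sum_killingForm_smul_casimirFst (H := H) ⁅z, casimirFst (H := H) i⁆]
      simp only [sum_lie, smul_lie]
    have h2 : ∀ i, ⁅casimirFst (H := H) i, ⁅⁅z, casimirSnd (H := H) i⁆, v⁆⁆ =
        ∑ j, killingForm ℂ L ⁅z, casimirSnd (H := H) i⁆ (casimirFst (H := H) j) •
          ⁅casimirFst (H := H) i, ⁅casimirSnd (H := H) j, v⁆⁆ := by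
      intro i
      conv_lhs => rw [← sum_killingForm_smul_casimirSnd (H := H) ⁅z, casimirSnd (H := H) i⁆]
      simp only [sum_lie, lie_sum, smul_lie, lie_smul]
    simp only [h1, h2]
    rw [Finset.sum_comm (f := fun i j => killingForm ℂ L ⁅z, casimirFst (H := H) i⁆
      (casimirSnd (H := H) j) • ⁅casimirFst (H := H) j, ⁅casimirSnd (H := H) i, v⁆⁆),
      ← Finset.sum_add_distrib]
    refine Finset.sum_eq_zero fun i _ => ?_
    rw [← Finset.sum_add_distrib]
    refine Finset.sum_eq_zero fun j _ => ?_
    rw [← add_smul]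
    have h3 : killingForm ℂ L ⁅z, casimirFst (H := H) j⁆ (casimirSnd (H := H) i) +
        killingForm ℂ L ⁅z, casimirSnd (H := H) i⁆ (casimirFst (H := H) j) = 0 := by
      rw [← lie_skew z (casimirFst (H := H) j), map_neg, LinearMap.neg_apply,
        LieModule.traceForm_apply_lie_apply, LieModule.traceForm_comm ℂ L L (casimirFst (H := H) j)]
      simp
    rw [h3, zero_smul]
  rw [casimir_apply, casimir_apply, lie_sum, ← sub_eq_zero, ← neg_eq_zero, neg_sub,
    ← Finset.sum_sub_distrib, ← key]
  refine Finset.sum_congr rfl fun i _ => ?_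
  rw [leibniz_lie z (casimirFst i), leibniz_lie z (casimirSnd i), lie_add]
  abel

variable {b : (LieAlgebra.IsKilling.rootSystem H).Base}

theorem form_self_eq_sum (nu : Dual ℂ H) :
    form nu nu = ∑ j, nu (dualElt ((finBasis ℂ H).coord j)) * nu (finBasis ℂ H j) := by
  rw [form_eq]
  conv_lhs => rw [← (finBasis ℂ H).sum_repr (dualElt nu)]
  rw [map_sum]
  refine Finset.sum_congr rfl fun j _ => ?_
  rw [map_smul, smul_eq_mul]
  congr 1
  change (finBasis ℂ H).coord j (dualElt nu) = _
  rw [← form_eq, form_comm, form_eq]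

/-- The Cartan terms give (ν, ν). The remaining sum runs over all roots: for α positive, e_α f_α v =
[e_α, f_α] v = (α, ν) v, while for α negative f_α is a positive root vector and kills v. The total
is (ν, 2ρ). -/
theorem IsHW.casimir_eq {nu : Dual ℂ H} {v : M} (hv : IsHW b nu v) :
    casimir H M v = casimirValue b nu • v := by
  classical
  have hw := GradedAdjoint.mem_wtSpace.1 hv.mem_wtSpace
  rw [casimir_apply, Fintype.sum_sum_type, casimirValue, add_smul]
  congr 1
  · rw [form_self_eq_sum, Finset.sum_smul]
    refine Finset.sum_congr rfl fun j _ => ?_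
    change ⁅((finBasis ℂ H j : H) : L), ⁅((dualElt ((finBasis ℂ H).coord j) : H) : L), v⁆⁆ = _
    rw [hw, lie_smul, hw, smul_smul]
  · rw [form_eq', twoRho, LinearMap.sum_apply, Finset.sum_smul, Finset.sum_filter]
    refine Finset.sum_congr rfl fun α _ => ?_
    change ⁅(rootPair α).1, ⁅(rootPair α).2, v⁆⁆ = _
    split_ifs with h
    · rw [leibniz_lie, hv.lie_eq_zero α h _ (rootPair_fst α), lie_zero, add_zero,
        lie_mem_of_rsp_rspNeg (rootPair_fst α) (rootPair_snd α), killingForm_rootPair, one_smul, hw,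
        ← form_eq, form_comm, form_eq, ← form_eq, form_eq']
    · rw [hv.lie_eq_zero (negRt α) (isPos_negRt_iff.2 h) _ (rootPair_snd α), lie_zero]

end Casimir

/-! ### Modules generated by highest weight vectors -/

section Generated

open LieAlgebra LieAlgebra.IsKilling Module

variable {L : Type u} [LieRing L] [LieAlgebra ℂ L] [FiniteDimensional ℂ L]
  [LieAlgebra.IsKilling ℂ L] {H : LieSubalgebra ℂ L} [H.IsCartanSubalgebra]
  (b : (LieAlgebra.IsKilling.rootSystem H).Base)
  {M : Type*} [AddCommGroup M] [Module ℂ M] [LieRingModule L M] [LieModule ℂ L M]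
  {N : Type*} [AddCommGroup N] [Module ℂ N] [LieRingModule L N] [LieModule ℂ L N]

/-- `IsWord b v k δ w`: the vector `w` is of the form `y_1 ⋯ y_k v` with `y_i ∈ 𝔤_{-β_i}`,
`β_i ∈ R⁺` and `δ = ∑ β_i`. -/
inductive IsWord (v : M) : ℕ → Dual ℂ H → M → Prop
  | nil : IsWord v 0 0 v
  | cons {k : ℕ} {δ : Dual ℂ H} {w : M} (α : H.root) (hα : b.IsPos α) (y : L) (hy : y ∈ rspNeg α)
      (hw : IsWord v k δ w) : IsWord v (k + 1) (δ + rt α) ⁅y, w⁆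

/-- The span of all words. -/
def wordSpan (v : M) : Submodule ℂ M := Submodule.span ℂ {w | ∃ k δ, IsWord b v k δ w}

variable {b}

theorem IsWord.mem_wtSpace {mu : Dual ℂ H} {v : M} (hv : v ∈ wtSpace M mu) {k : ℕ}
    {δ : Dual ℂ H} {w : M} (hw : IsWord b v k δ w) : w ∈ wtSpace M (mu - δ) := by
  induction hw with
  | nil => simpa using hv
  | cons α hα y hy _ ih =>
    rw [← sub_sub]
    exact lie_mem_wtSpace_sub ih hy

theorem IsWord.mem_posCone {v : M} {k : ℕ} {δ : Dual ℂ H} {w : M} (hw : IsWord b v k δ w) :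
    δ ∈ posCone b ∧ ∃ n : ℕ, ht b δ = n ∧ k ≤ n := by
  induction hw with
  | nil => exact ⟨zero_mem _, 0, by simp, le_rfl⟩
  | cons α hα y hy _ ih =>
    obtain ⟨h1, n, hn, hkn⟩ := ih
    obtain ⟨m, hm, hm'⟩ := exists_ht_eq (rt_mem_posCone hα)
    have : m ≠ 0 := fun h => rt_ne_zero α (hm' h)
    exact ⟨add_mem h1 (rt_mem_posCone hα), n + m, by simp [hn, hm], by omega⟩

/-- A substitute for the triangular decomposition of U(𝔤). From x y w = [x, y] w + y x w, induction
on the word works provided x ranges over all of 𝔤 at once, so that [x, y] is covered too. -/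
theorem IsHW.lie_mem_wordSpan {mu : Dual ℂ H} {v : M} (hv : IsHW b mu v) (x : L) {w : M}
    (hw : w ∈ wordSpan b v) : ⁅x, w⁆ ∈ wordSpan b v := by
  have hneg : ∀ α : H.root, b.IsPos α → ∀ y ∈ rspNeg α, ∀ w ∈ wordSpan b v, ⁅y, w⁆ ∈ wordSpan b v := by
    intro α hα y hy w hw
    induction hw using Submodule.span_induction with
    | mem w hw => obtain ⟨k, δ, hw⟩ := hw; exact Submodule.subset_span ⟨_, _, hw.cons α hα y hy⟩
    | zero => simp
    | add a c _ _ ha hc => rw [lie_add]; exact add_mem ha hc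
    | smul t a _ ha => rw [lie_smul]; exact Submodule.smul_mem _ _ ha
  have key : ∀ k δ w, IsWord b v k δ w → ∀ x : L, ⁅x, w⁆ ∈ wordSpan b v := by
    intro k δ w hw
    induction hw with
    | nil =>
      intro x
      have : (wordSpan b v).comap ((LieModule.toEnd ℂ L M : L →ₗ[ℂ] Module.End ℂ M).flip v) = ⊤ := by
        refine eq_top_of_cartan_of_rsp (H := H) _ (fun h => ?_) (fun α x hx => ?_)
        · change ⁅(h : L), v⁆ ∈ wordSpan b v
          rw [GradedAdjoint.mem_wtSpace.1 hv.mem_wtSpace]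
          exact Submodule.smul_mem _ _ (Submodule.subset_span ⟨0, 0, .nil⟩)
        · change ⁅x, v⁆ ∈ wordSpan b v
          rcases isPos_or_isPos_negRt b α with h | h
          · rw [hv.lie_eq_zero α h x hx]; exact zero_mem _
          · exact hneg _ h x (by rwa [rspNeg_negRt]) _ (Submodule.subset_span ⟨0, 0, .nil⟩)
      exact (this ▸ Submodule.mem_top : x ∈ (wordSpan b v).comap _)
    | cons α hα y hy _ ih =>
      intro x
      rw [leibniz_lie]
      exact add_mem (ih _) (hneg α hα y hy _ (ih x))
  induction hw using Submodule.span_induction with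
  | mem w hw => obtain ⟨k, δ, hw⟩ := hw; exact key k δ w hw x
  | zero => simp
  | add a c _ _ ha hc => rw [lie_add]; exact add_mem ha hc
  | smul t a _ ha => rw [lie_smul]; exact Submodule.smul_mem _ _ ha

theorem IsHW.lieSpan_le_wordSpan {mu : Dual ℂ H} {v : M} (hv : IsHW b mu v) :
    (LieSubmodule.lieSpan ℂ L {v}).toSubmodule ≤ wordSpan b v := by
  let W : LieSubmodule ℂ L M := { wordSpan b v with lie_mem := fun {x w} hw => hv.lie_mem_wordSpan x hw }
  have h : LieSubmodule.lieSpan ℂ L {v} ≤ W :=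
    LieSubmodule.lieSpan_le.2 (Set.singleton_subset_iff.2 (Submodule.subset_span ⟨0, 0, .nil⟩))
  exact h

theorem exists_sub_mem_posCone_of_mem_wordSpan {mu : Dual ℂ H} {v : M} (hv : v ∈ wtSpace M mu)
    {nu : Dual ℂ H} {w : M} (hw : w ∈ wtSpace M nu) (h0 : w ≠ 0) (hwv : w ∈ wordSpan b v) :
    mu - nu ∈ posCone b := by
  have h1 : w ∈ ⨆ ω ∈ {ω : Dual ℂ H | mu - ω ∈ posCone b}, wtSpace M ω := by
    refine (Submodule.span_le.2 ?_ : wordSpan b v ≤ _) hwv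
    rintro w ⟨k, δ, hw⟩
    exact Submodule.mem_iSup_of_mem (mu - δ) (Submodule.mem_iSup_of_mem
      (by simpa using hw.mem_posCone.1) (hw.mem_wtSpace hv))
  exact mem_of_mem_iSup_wtSpace hw h0 h1

/-- A module generated by a highest weight vector has only one highest weight. -/
theorem IsHW.eq_of_mem_lieSpan [FiniteDimensional ℂ M] {mu nu : Dual ℂ H} {v w : M}
    (hv : IsHW b mu v) (hw : IsHW b nu w) (h : w ∈ LieSubmodule.lieSpan ℂ L {v}) : nu = mu := by
  have h1 := exists_sub_mem_posCone_of_mem_wordSpan hv.mem_wtSpace hw.mem_wtSpace hw.ne_zero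
    (hv.lieSpan_le_wordSpan h)
  -- An eigenspace of the Casimir operator is a submodule, so the one containing v contains w. The
  -- highest weights ν ≤ μ then have equal Casimir values, hence agree.
  let W : LieSubmodule ℂ L M :=
    { LinearMap.eqLocus (casimir H M) (casimirValue b mu • LinearMap.id) with
      lie_mem := fun {x w} hw => by
        change casimir H M ⁅x, w⁆ = casimirValue b mu • ⁅x, w⁆
        have hw' : casimir H M w = casimirValue b mu • w := hw
        rw [casimir_lie, hw', lie_smul] }
  have hW : LieSubmodule.lieSpan ℂ L {v} ≤ W :=
    LieSubmodule.lieSpan_le.2 (Set.singleton_subset_iff.2 hv.casimir_eq)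
  have h2 : casimir H M w = casimirValue b mu • w := hW h
  rw [hw.casimir_eq] at h2
  have h3 := smul_left_injective ℂ hw.ne_zero h2
  exact (casimirValue_injective (nu := hw.domWt) (nu' := hv.domWt) h3 h1).symm

/-- Highest weights of a module generated by an `𝔫⁺`-stable space spanned by weight vectors. -/
theorem IsHW.mem_of_lieSpan_eq_top (n : ℕ) {M : Type*} [AddCommGroup M] [Module ℂ M]
    [LieRingModule L M] [LieModule ℂ L M] [FiniteDimensional ℂ M] (hn : finrank ℂ M ≤ n)
    (S : Set (Dual ℂ H)) (Z : Submodule ℂ M)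
    (hZ : ∀ α : H.root, b.IsPos α → ∀ x ∈ rsp α, ∀ z ∈ Z, ⁅x, z⁆ ∈ Z)
    (hZS : Z ≤ Submodule.span ℂ {z | z ∈ Z ∧ ∃ ω ∈ S, z ∈ wtSpace M ω})
    (hgen : LieSubmodule.lieSpan ℂ L (Z : Set M) = ⊤) {nu : Dual ℂ H} {w : M} (hw : IsHW b nu w) :
    nu ∈ S := by
  induction n generalizing M with
  | zero =>
    have : Subsingleton M := finrank_zero_iff.1 (Nat.le_zero.1 hn)
    exact (hw.ne_zero (Subsingleton.elim _ _)).elim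
  | succ n ih =>
    obtain ⟨z, ⟨hzZ, ω, hω, hz⟩, hz0⟩ : ∃ z ∈ {z | z ∈ Z ∧ ∃ ω ∈ S, z ∈ wtSpace M ω}, z ≠ 0 := by
      by_contra! hcon
      have h1 : Z ≤ ⊥ := hZS.trans (Submodule.span_le.2 fun z hz => hcon z hz)
      rw [le_bot_iff] at h1
      have h2 : LieSubmodule.lieSpan ℂ L (Z : Set M) ≤ ⊥ := by
        rw [LieSubmodule.lieSpan_le, h1]
        simp
      rw [hgen, top_le_iff] at h2
      have : w ∈ (⊤ : LieSubmodule ℂ L M) := trivial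
      rw [← h2, LieSubmodule.mem_bot] at this
      exact hw.ne_zero this
    -- Raising inside the 𝔫⁺-stable space Z stays in Z, so the weight reached is again one of S.
    obtain ⟨δ, hδ, z', hz'Z, hz'⟩ := exists_isHW_of_mem Z hZ hz hz0 hzZ
    have hmem : ω + δ ∈ S := by
      refine mem_of_mem_iSup_wtSpace hz'.mem_wtSpace hz'.ne_zero ?_
      refine (hZS.trans (Submodule.span_le.2 ?_)) hz'Z
      rintro z ⟨-, ω, hω, hz⟩
      exact Submodule.mem_iSup_of_mem ω (Submodule.mem_iSup_of_mem hω hz)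
    set K := LieSubmodule.lieSpan ℂ L {z'} with hK
    -- Either w lies in the submodule generated by z', which has a single highest weight, or it
    -- survives in the quotient, which has smaller dimension and inherits all hypotheses on Z.
    by_cases hwK : w ∈ K
    · rwa [hz'.eq_of_mem_lieSpan hw hwK]
    let q := LieSubmodule.Quotient.mk' K
    have hq : Function.Surjective q := LieSubmodule.Quotient.surjective_mk' K
    have hqw : q w ≠ 0 := fun h => hwK ((LieSubmodule.Quotient.mk_eq_zero K).1 h)
    refine ih (M := M ⧸ K) ?_ (Z.map (q : M →ₗ[ℂ] M ⧸ K)) ?_ ?_ ?_ (hw.map q hqw)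
    · have h1 := Submodule.finrank_quotient_add_finrank K.toSubmodule
      have h2 : 0 < finrank ℂ K.toSubmodule := by
        rw [Module.finrank_pos_iff_exists_ne_zero]
        exact ⟨⟨z', LieSubmodule.subset_lieSpan rfl⟩, fun h => hz'.ne_zero (congrArg Subtype.val h)⟩
      change finrank ℂ (M ⧸ K.toSubmodule) ≤ n
      omega
    · rintro α hα x hx _ ⟨z, hz, rfl⟩
      exact ⟨⁅x, z⁆, hZ α hα x hx z hz, q.map_lie x z⟩
    · rintro _ ⟨z, hz, rfl⟩
      have h1 := Submodule.mem_map_of_mem (f := (q : M →ₗ[ℂ] M ⧸ K)) (hZS hz)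
      rw [Submodule.map_span] at h1
      refine Submodule.span_mono ?_ h1
      rintro _ ⟨z, ⟨hzZ, ω, hω, hz⟩, rfl⟩
      exact ⟨Submodule.mem_map_of_mem hzZ, ω, hω, map_mem_wtSpace q hz⟩
    · rw [eq_top_iff]
      intro m _
      obtain ⟨m, rfl⟩ := hq m
      have h1 : LieSubmodule.lieSpan ℂ L (Z : Set M) ≤
          (LieSubmodule.lieSpan ℂ L ((Z.map (q : M →ₗ[ℂ] M ⧸ K) : Submodule ℂ _) : Set (M ⧸ K))).comap q := by
        rw [LieSubmodule.lieSpan_le]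
        exact fun z hz => LieSubmodule.subset_lieSpan (Submodule.mem_map_of_mem hz)
      rw [hgen] at h1
      exact h1 trivial

end Generated

/-! ### Lifting highest weight vectors along surjections -/

section Lifting

open LieAlgebra LieAlgebra.IsKilling Module

/-- A preimage may be replaced by its component in the matching summand. It is applied to
generalized Casimir eigenspaces and then to generalized weight spaces. -/
theorem exists_mem_of_iSup_eq_top {ι M N : Type*} [AddCommGroup M] [Module ℂ M] [AddCommGroup N]
    [Module ℂ N] (f : M →ₗ[ℂ] N) (A : ι → Submodule ℂ M) (B : ι → Submodule ℂ N) (hA : ⨆ i, A i = ⊤)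
    (hB : iSupIndep B) (hf : ∀ i, ∀ m ∈ A i, f m ∈ B i) {j : ι} {m : M} (hm : f m ∈ B j) :
    ∃ m' ∈ A j, f m' = f m := by
  have h1 : m ∈ A j ⊔ ⨆ (i) (_ : i ≠ j), A i := by
    refine (hA ▸ iSup_le fun i => ?_ : ⊤ ≤ A j ⊔ ⨆ (i) (_ : i ≠ j), A i) trivial
    by_cases h : i = j
    · subst h; exact le_sup_left
    · exact le_sup_of_le_right (le_iSup₂_of_le i h le_rfl)
  obtain ⟨a, ha, c, hc, rfl⟩ := Submodule.mem_sup.1 h1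
  refine ⟨a, ha, ?_⟩
  have h2 : f c ∈ B j := by
    have := sub_mem hm (hf j a ha)
    rwa [map_add, add_sub_cancel_left] at this
  have h3 : f c ∈ ⨆ (i) (_ : i ≠ j), B i := by
    refine (iSup₂_le fun i hi => ?_ : (⨆ (i) (_ : i ≠ j), A i) ≤ (⨆ (i) (_ : i ≠ j), B i).comap f) hc
    intro x hx
    exact Submodule.mem_iSup_of_mem i (Submodule.mem_iSup_of_mem hi (hf i x hx))
  rw [map_add, Submodule.disjoint_def.1 (hB j) _ h2 h3, add_zero]

section Sl2

variable {L M : Type*} [LieRing L] [LieAlgebra ℂ L] [AddCommGroup M] [Module ℂ M]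
  [LieRingModule L M] [LieModule ℂ L M] {h e f : L}

open Polynomial

/-- The usual 𝔰𝔩₂ formula with the operator h in place of an eigenvalue, since m is not yet known to
be an eigenvector of h. -/
theorem lie_e_pow_succ_toEnd_f_of_lie_e_eq_zero (t : IsSl2Triple h e f) {m : M} (he : ⁅e, m⁆ = 0)
    (n : ℕ) : ⁅e, (LieModule.toEnd ℂ L M f ^ (n + 1)) m⁆ =
      ((n : ℂ) + 1) • (LieModule.toEnd ℂ L M f ^ n) (⁅h, m⁆ - (n : ℂ) • m) := by
  have hh : ∀ n : ℕ, ⁅h, (LieModule.toEnd ℂ L M f ^ n) m⁆ =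
      (LieModule.toEnd ℂ L M f ^ n) (⁅h, m⁆ - (2 * n : ℂ) • m) := by
    intro n
    induction n with
    | zero => simp
    | succ n ih =>
      rw [pow_succ', Module.End.mul_apply, LieModule.toEnd_apply_apply, leibniz_lie,
        t.lie_lie_smul_f ℂ, ih, Module.End.mul_apply, LieModule.toEnd_apply_apply, neg_lie, smul_lie]
      simp only [map_sub, map_smul, lie_sub, lie_smul]
      push_cast
      module
  induction n with
  | zero => simp [leibniz_lie e, t.lie_e_f, he]
  | succ n ih =>
    rw [pow_succ', Module.End.mul_apply, LieModule.toEnd_apply_apply, leibniz_lie, t.lie_e_f, ih, hh,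
      pow_succ', Module.End.mul_apply, LieModule.toEnd_apply_apply]
    simp only [map_sub, map_smul, lie_sub, lie_smul, Module.End.mul_apply, LieModule.toEnd_apply_apply]
    push_cast
    module

theorem pow_toEnd_e_pow_toEnd_f (t : IsSl2Triple h e f) {m : M} (he : ⁅e, m⁆ = 0) (n : ℕ) :
    (LieModule.toEnd ℂ L M e ^ n) ((LieModule.toEnd ℂ L M f ^ n) m) =
      (n.factorial : ℂ) • aeval (LieModule.toEnd ℂ L M h)
        (∏ j ∈ Finset.range n, (X - C (j : ℂ))) m := by
  induction n generalizing m with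
  | zero => simp
  | succ n ih =>
    rw [pow_succ, Module.End.mul_apply, LieModule.toEnd_apply_apply,
      lie_e_pow_succ_toEnd_f_of_lie_e_eq_zero t he, map_smul, ih, Finset.prod_range_succ, map_mul,
      Module.End.mul_apply, smul_smul, Nat.factorial_succ]
    · congr 1
      · push_cast; ring
      · congr 1
        simp [Nat.cast_smul_eq_nsmul]
    · rw [lie_sub, lie_smul, he, leibniz_lie, he, lie_zero, add_zero, ← lie_skew,
        t.lie_h_e_smul ℂ, neg_lie, smul_lie, he]
      simp

/-- For N large, f^N = 0, so e^N f^N m = N! ∏_{j<N} (h - j) m vanishes. This polynomial in h has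
simple roots, so on a vector that is also killed by a power of h - k, already h - k acts by zero. -/
theorem lie_h_eq_of_mem_maxGenEigenspace (t : IsSl2Triple h e f)
    (hf : IsNilpotent (LieModule.toEnd ℂ L M f)) {m : M} (he : ⁅e, m⁆ = 0) {k : ℕ}
    (hm : m ∈ (LieModule.toEnd ℂ L M h).maxGenEigenspace (k : ℂ)) : ⁅h, m⁆ = (k : ℂ) • m := by
  set T := LieModule.toEnd ℂ L M h
  obtain ⟨n, hn⟩ := hf
  have h1 : aeval T (∏ j ∈ Finset.range (n + k + 1), (X - C (j : ℂ))) m = 0 := by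
    have h2 := pow_toEnd_e_pow_toEnd_f t he (n + k + 1)
    rw [pow_eq_zero_of_le (by omega) hn, LinearMap.zero_apply, map_zero] at h2
    exact (smul_eq_zero.1 h2.symm).resolve_left (by exact_mod_cast Nat.factorial_ne_zero _)
  rw [← Finset.mul_prod_erase _ _ (Finset.mem_range.2 (by omega : k < n + k + 1)), mul_comm, map_mul,
    Module.End.mul_apply] at h1
  have hT : aeval T (X - C (k : ℂ)) = T - (k : ℂ) • 1 := by
    rw [map_sub, aeval_X, aeval_C, Algebra.algebraMap_eq_smul_one]
  set w := aeval T (X - C (k : ℂ)) m with hw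
  obtain ⟨N, hN⟩ := (Module.End.mem_maxGenEigenspace _ _ _).1 hm
  have h3 : aeval T ((X - C (k : ℂ)) ^ N) w = 0 := by
    rw [hw, ← Module.End.mul_apply, ← map_mul, ← pow_succ, pow_succ', map_mul, Module.End.mul_apply,
      map_pow, hT, hN, map_zero]
  have hcop : IsCoprime (∏ j ∈ (Finset.range (n + k + 1)).erase k, (X - C (j : ℂ)))
      ((X - C (k : ℂ)) ^ N) := by
    refine IsCoprime.pow_right (IsCoprime.prod_left fun j hj => ?_)
    refine Polynomial.isCoprime_X_sub_C_of_isUnit_sub ?_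
    rw [isUnit_iff_ne_zero, sub_ne_zero]
    exact_mod_cast (Finset.mem_erase.1 hj).1
  obtain ⟨p, q, hpq⟩ := hcop
  have h4 : w = 0 := by
    have := congrArg (fun r => aeval T r w) hpq
    simp only [map_add, map_mul, LinearMap.add_apply, Module.End.mul_apply, h1, h3, map_zero,
      add_zero, map_one, Module.End.one_apply] at this
    exact this.symm
  rw [hw, hT] at h4
  rw [LinearMap.sub_apply, sub_eq_zero] at h4
  exact h4

end Sl2

variable {L : Type u} [LieRing L] [LieAlgebra ℂ L] [FiniteDimensional ℂ L]
  [LieAlgebra.IsKilling ℂ L] {H : LieSubalgebra ℂ L} [H.IsCartanSubalgebra]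
  {b : (LieAlgebra.IsKilling.rootSystem H).Base}
  {M : Type*} [AddCommGroup M] [Module ℂ M] [LieRingModule L M] [LieModule ℂ L M]
  {N : Type*} [AddCommGroup N] [Module ℂ N] [LieRingModule L N] [LieModule ℂ L N]

variable (H M) in
/-- The generalized eigenspaces of the Casimir operator are submodules. -/
def casimirBlock (c : ℂ) : LieSubmodule ℂ L M where
  __ := (casimir H M).maxGenEigenspace c
  lie_mem := fun {x m} hm => by
    have hm' := (Module.End.mem_maxGenEigenspace (casimir H M) c m).1 hm
    obtain ⟨k, hk⟩ := hm'
    refine (Module.End.mem_maxGenEigenspace (casimir H M) c ⁅x, m⁆).2 ⟨k, ?_⟩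
    have key : ∀ (k : ℕ) (m : M), (((casimir H M) - c • 1) ^ k) ⁅x, m⁆ =
        ⁅x, (((casimir H M) - c • 1) ^ k) m⁆ := by
      intro k
      induction k with
      | zero => simp
      | succ k ih =>
        intro m
        rw [pow_succ, Module.End.mul_apply, Module.End.mul_apply, ← ih]
        congr 1
        simp [casimir_lie]
    rw [key, hk, lie_zero]

theorem IsHW.casimirValue_eq {nu : Dual ℂ H} {c : ℂ} {w : M} (hw : IsHW b nu w)
    (h : w ∈ casimirBlock H M c) : casimirValue b nu = c := by
  by_contra hne
  refine hw.ne_zero (Submodule.disjoint_def.1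
    (Module.End.disjoint_genEigenspace (casimir H M) hne ⊤ ⊤) w ?_ h)
  refine (Module.End.mem_maxGenEigenspace _ _ _).2 ⟨1, ?_⟩
  rw [pow_one, LinearMap.sub_apply, hw.casimir_eq]
  simp

/-- Highest weight vectors lift along surjections of finite-dimensional modules. -/
theorem IsHW.exists_lift [FiniteDimensional ℂ M] [FiniteDimensional ℂ N] (f : M →ₗ⁅ℂ, L⁆ N)
    {nu : Dual ℂ H} {m : M} (hn : IsHW b nu (f m)) : ∃ m', IsHW b nu m' ∧ f m' = f m := by
  set c := casimirValue b nu with hc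
  have hmapC : ∀ c' : ℂ, ∀ m ∈ (casimir H M).maxGenEigenspace c',
      f m ∈ (casimir H N).maxGenEigenspace c' := by
    intro c' m hm
    obtain ⟨k, hk⟩ := (Module.End.mem_maxGenEigenspace _ _ _).1 hm
    refine (Module.End.mem_maxGenEigenspace _ _ _).2 ⟨k, ?_⟩
    have key : ∀ (k : ℕ) (m : M), (((casimir H N) - c' • 1) ^ k) (f m) =
        f ((((casimir H M) - c' • 1) ^ k) m) := by
      intro k
      induction k with
      | zero => simp
      | succ k ih =>
        intro m
        rw [pow_succ, Module.End.mul_apply, pow_succ, Module.End.mul_apply, ← ih]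
        congr 1
        simp [casimir_map]
    rw [key, hk, map_zero]
  -- The image is a Casimir eigenvector, so the preimage can be taken in one Casimir block of M,
  -- which is a 𝔤-submodule.
  obtain ⟨m1, hm1, hm1'⟩ := exists_mem_of_iSup_eq_top (f : M →ₗ[ℂ] N)
    (fun c' => (casimir H M).maxGenEigenspace c')
    (fun c' => (casimir H N).maxGenEigenspace c')
    (Module.End.iSup_maxGenEigenspace_eq_top _) (Module.End.independent_maxGenEigenspace _) hmapC
    (j := c) (m := m) (by
      refine (Module.End.mem_maxGenEigenspace _ _ _).2 ⟨1, ?_⟩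
      have := hn.casimir_eq
      rw [pow_one, LinearMap.sub_apply]
      change casimir H N (f m) - c • f m = 0
      rw [this, sub_self])
  let g : casimirBlock H M c →ₗ⁅ℂ, L⁆ N := f.comp (casimirBlock H M c).incl
  let gH : casimirBlock H M c →ₗ⁅ℂ, H⁆ N :=
    { (g : casimirBlock H M c →ₗ[ℂ] N) with map_lie' := fun {x m} => g.map_lie (x : L) m }
  have hg1 : g ⟨m1, hm1⟩ = f m := hm1'
  -- Inside the block the preimage is moved to the generalized weight space of ν. It remains to see
  -- that this vector is killed by 𝔫⁺ and is a genuine weight vector.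
  obtain ⟨m2, hm2, hm2'⟩ := exists_mem_of_iSup_eq_top (g : casimirBlock H M c →ₗ[ℂ] N)
    (fun chi : H → ℂ => (LieModule.genWeightSpace (casimirBlock H M c) chi).toSubmodule)
    (fun chi : H → ℂ => (LieModule.genWeightSpace N chi).toSubmodule)
    (LieSubmodule.iSup_toSubmodule_eq_top.mpr (LieModule.iSup_genWeightSpace_eq_top ℂ H _))
    (LieSubmodule.iSupIndep_toSubmodule.mpr (LieModule.iSupIndep_genWeightSpace ℂ H N))
    (fun chi m hm => LieModule.map_genWeightSpace_le gH ⟨m, hm, rfl⟩)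
    (j := (nu : H → ℂ)) (m := ⟨m1, hm1⟩) (by
      change g ⟨m1, hm1⟩ ∈ _
      rw [hg1]
      exact LieModule.weightSpace_le_genWeightSpace N _ hn.mem_wtSpace)
  have hg2 : g m2 = f m := hm2'.trans hg1
  -- Otherwise the block would contain a highest weight vector of weight ν + α + δ with δ ∈ Q⁺. It
  -- has the Casimir value of ν, which forces α + δ = 0.
  have hkill : ∀ α : H.root, b.IsPos α → ∀ x ∈ rsp α, ⁅x, m2⁆ = 0 := by
    intro α hα x hx
    by_contra hne
    have h1 := LieAlgebra.lie_mem_genWeightSpace_of_mem_genWeightSpace hx hm2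
    obtain ⟨chi, hchi, δ, hδ, w, hw⟩ := exists_isHW_of_genWeightSpace_ne_bot (b := b)
      (chi := (α.1 : H → ℂ) + nu) (fun h => by
        rw [h, LieSubmodule.mem_bot] at h1
        exact hne h1)
    have hchi' : chi = nu + rt α := DFunLike.coe_injective (by
      rw [hchi, add_comm]; rfl)
    have hw' : IsHW b (chi + δ) (w : M) := hw.map (casimirBlock H M c).incl (fun h =>
      hw.ne_zero (Subtype.ext h))
    have h2 := hw'.casimirValue_eq w.2
    have h3 := casimirValue_injective (nu := hn.domWt) (nu' := hw.domWt) h2.symm (by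
      change chi + δ - nu ∈ _
      rw [hchi', add_assoc, add_sub_cancel_left]
      exact add_mem (rt_mem_posCone hα) hδ)
    change chi + δ = nu at h3
    rw [hchi', add_assoc, add_eq_left] at h3
    exact ne_zero_of_rt_add hα hδ h3
  -- The simple coroots span 𝔥, and each acts on this vector by a scalar by the 𝔰𝔩₂ argument, since
  -- the vector is killed by e and ν(h_i) is a natural number.
  have hwt : m2 ∈ wtSpace (casimirBlock H M c) nu := by
    rw [GradedAdjoint.mem_wtSpace]
    have htop : LinearMap.eqLocus
        (((LieModule.toEnd ℂ L (casimirBlock H M c) :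
          L →ₗ[ℂ] Module.End ℂ (casimirBlock H M c)).flip m2) ∘ₗ H.toSubmodule.subtype)
        (LinearMap.toSpanSingleton ℂ _ m2 ∘ₗ nu) = ⊤ := by
      rw [eq_top_iff, ← RootPairing.IsRootSystem.span_coroot_eq_top (P := rootSystem H),
        ← RootPairing.corootSpan, ← b.span_coroot_support, Submodule.span_le]
      rintro _ ⟨i, hi, rfl⟩
      have hip : b.IsPos i := RootPairing.Base.isPos_of_mem_support hi
      obtain ⟨e, he, f, hf, ht⟩ := exists_isSl2Triple i
      obtain ⟨k, hk⟩ := hn.exists_nat hip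
      have h1 := lie_h_eq_of_mem_maxGenEigenspace ht (M := casimirBlock H M c)
        (isNilpotent_toEnd_of_mem_rsp (α := negRt i) hf) (hkill i hip e he) (k := k) (by
          have := LieModule.genWeightSpace_le_genWeightSpaceOf _ (crt i) _ hm2
          rw [hk] at this
          exact this)
      rw [← hk] at h1
      exact h1
    intro h
    have : h ∈ LinearMap.eqLocus
        (((LieModule.toEnd ℂ L (casimirBlock H M c) :
          L →ₗ[ℂ] Module.End ℂ (casimirBlock H M c)).flip m2) ∘ₗ H.toSubmodule.subtype)
        (LinearMap.toSpanSingleton ℂ _ m2 ∘ₗ nu) := htop ▸ trivial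
    exact this
  have hm0 : m2 ≠ 0 := by
    rintro rfl
    exact hn.ne_zero (by rw [← hg2, map_zero])
  have hHW : IsHW b nu m2 := ⟨hm0, hwt, hkill⟩
  exact ⟨m2, hHW.map (casimirBlock H M c).incl (fun h => hm0 (Subtype.ext h)), hg2⟩

end Lifting

/-! ### Enveloping algebras and presentations -/

section Enveloping

variable {A M N : Type u} [LieRing A] [LieAlgebra ℂ A] [AddCommGroup M] [Module ℂ M]
  [LieRingModule A M] [LieModule ℂ A M] [AddCommGroup N] [Module ℂ N]
  [LieRingModule A N] [LieModule ℂ A N]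

theorem uea_induction {C : UniversalEnvelopingAlgebra ℂ A → Prop}
    (algebraMap : ∀ t, C (algebraMap ℂ _ t)) (ι : ∀ x, C (UniversalEnvelopingAlgebra.ι ℂ x))
    (add : ∀ u v, C u → C v → C (u + v)) (mul : ∀ u v, C u → C v → C (u * v))
    (u : UniversalEnvelopingAlgebra ℂ A) : C u := by
  let S : Subalgebra ℂ (UniversalEnvelopingAlgebra ℂ A) :=
    { carrier := {u | C u}
      mul_mem' := fun {u v} hu hv => mul u v hu hv
      add_mem' := fun {u v} hu hv => add u v hu hv
      algebraMap_mem' := algebraMap }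
  let f : A →ₗ⁅ℂ⁆ S :=
    { toFun := fun a => ⟨UniversalEnvelopingAlgebra.ι ℂ a, ι a⟩
      map_add' := fun a c => Subtype.ext (map_add _ a c)
      map_smul' := fun t a => Subtype.ext (map_smul _ t a)
      map_lie' := fun {a c} => Subtype.ext (by
        simp [LieHom.map_lie, LieRing.of_associative_ring_bracket]) }
  have h : S.val.comp (UniversalEnvelopingAlgebra.lift ℂ f) = AlgHom.id ℂ _ := by
    apply UniversalEnvelopingAlgebra.hom_ext
    ext a
    simp [f]
  have h2 := (UniversalEnvelopingAlgebra.lift ℂ f u).2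
  have h3 : (UniversalEnvelopingAlgebra.lift ℂ f u : UniversalEnvelopingAlgebra ℂ A) = u :=
    DFunLike.congr_fun h u
  rw [h3] at h2
  exact h2

theorem ueaAct_ι (x : A) (m : M) : ueaAct A M (UniversalEnvelopingAlgebra.ι ℂ x) m = ⁅x, m⁆ := by
  rw [ueaAct, UniversalEnvelopingAlgebra.lift_ι_apply]
  rfl

theorem ueaAct_ι_pow (x : A) (n : ℕ) (m : M) :
    ueaAct A M (UniversalEnvelopingAlgebra.ι ℂ x ^ n) m = (LieModule.toEnd ℂ A M x ^ n) m := by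
  rw [map_pow, ueaAct, UniversalEnvelopingAlgebra.lift_ι_apply]

theorem ueaAct_mul (u v : UniversalEnvelopingAlgebra ℂ A) (m : M) :
    ueaAct A M (u * v) m = ueaAct A M u (ueaAct A M v m) := by
  rw [map_mul, Module.End.mul_apply]

theorem ueaAct_algebraMap (t : ℂ) (m : M) : ueaAct A M (algebraMap ℂ _ t) m = t • m := by
  rw [AlgHom.commutes]
  rfl

theorem map_ueaAct (f : M →ₗ⁅ℂ, A⁆ N) (u : UniversalEnvelopingAlgebra ℂ A) (m : M) :
    f (ueaAct A M u m) = ueaAct A N u (f m) := by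
  induction u using uea_induction generalizing m with
  | algebraMap t => simp
  | ι x => rw [ueaAct_ι, ueaAct_ι, LieModuleHom.map_lie]
  | add u v hu hv => simp [hu, hv]
  | mul u v hu hv => simp only [ueaAct_mul, hu, hv]

theorem ueaAct_mem (W : LieSubmodule ℂ A M) (u : UniversalEnvelopingAlgebra ℂ A) {m : M}
    (hm : m ∈ W) : ueaAct A M u m ∈ W := by
  induction u using uea_induction generalizing m with
  | algebraMap t => rw [ueaAct_algebraMap]; exact W.smul_mem t hm
  | ι x => rw [ueaAct_ι]; exact W.lie_mem hm
  | add u v hu hv => rw [map_add, LinearMap.add_apply]; exact add_mem (hu hm) (hv hm)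
  | mul u v hu hv => rw [ueaAct_mul]; exact hu (hv hm)

theorem ueaAct_eq_zero_of_mem_span {S : Set (UniversalEnvelopingAlgebra ℂ A)} {m : M}
    (hS : ∀ s ∈ S, ueaAct A M s m = 0) {u : UniversalEnvelopingAlgebra ℂ A}
    (hu : u ∈ Submodule.span (UniversalEnvelopingAlgebra ℂ A) S) : ueaAct A M u m = 0 := by
  induction hu using Submodule.span_induction with
  | mem s hs => exact hS s hs
  | zero => simp
  | add u v _ _ hu hv => simp [hu, hv]
  | smul c u _ hu => rw [smul_eq_mul, ueaAct_mul, hu, map_zero]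

theorem ueaAct_ofUEA (A M : Type u) [LieRing A] [LieAlgebra ℂ A] [AddCommGroup M]
    [Module ℂ M] [Module (UniversalEnvelopingAlgebra ℂ A) M]
    [IsScalarTower ℂ (UniversalEnvelopingAlgebra ℂ A) M] (u : UniversalEnvelopingAlgebra ℂ A)
    (m : M) :
    letI := lieRingModuleOfUEA A M
    letI := lieModuleOfUEA A M
    ueaAct A M u m = u • m := by
  let := lieRingModuleOfUEA A M
  let := lieModuleOfUEA A M
  change ueaAct A M u m = u • m
  induction u using uea_induction generalizing m with
  | algebraMap t => rw [ueaAct_algebraMap, algebraMap_smul]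
  | ι x => rw [ueaAct_ι]; rfl
  | add u v hu hv => rw [map_add, LinearMap.add_apply, hu, hv, add_smul]
  | mul u v hu hv => rw [ueaAct_mul, hu, hv, mul_smul]

/-- The universal property of a module given by a generator and relations. -/
theorem IsPresentedBy.exists_hom {p : M} {S : Set (UniversalEnvelopingAlgebra ℂ A)}
    (h : IsPresentedBy p S) {x : N} (hx : ∀ s ∈ S, ueaAct A N s x = 0) :
    ∃ f : M →ₗ⁅ℂ, A⁆ N, f p = x := by
  choose g hg using h.1
  -- The chosen representative of m does not matter: two of them differ by an element of the left
  -- ideal of the relations, which kills x.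
  have key : ∀ u m, ueaAct A M u p = m → ueaAct A N (g m) x = ueaAct A N u x := by
    intro u m hu
    rw [← sub_eq_zero, ← LinearMap.sub_apply, ← map_sub]
    refine ueaAct_eq_zero_of_mem_span hx ((h.2 _).1 ?_)
    rw [map_sub, LinearMap.sub_apply, hg, hu, sub_self]
  refine ⟨{ toFun := fun m => ueaAct A N (g m) x
            map_add' := fun m m' => ?_
            map_smul' := fun t m => ?_
            map_lie' := fun {a m} => ?_ }, ?_⟩
  · rw [key (g m + g m') (m + m') (by simp [hg])]
    simp
  · rw [key (t • g m) (t • m) (by simp [hg])]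
    simp
  · have := key (UniversalEnvelopingAlgebra.ι ℂ a * g m) ⁅a, m⁆ (by rw [ueaAct_mul, hg, ueaAct_ι])
    rw [ueaAct_mul, ueaAct_ι] at this
    exact this
  · change ueaAct A N (g p) x = x
    rw [key 1 p (by simp)]
    simp

theorem IsPresentedBy.lieSpan_eq_top {p : M} {S : Set (UniversalEnvelopingAlgebra ℂ A)}
    (h : IsPresentedBy p S) : LieSubmodule.lieSpan ℂ A {p} = ⊤ := by
  rw [eq_top_iff]
  intro m _
  obtain ⟨u, rfl⟩ := h.1 m
  exact ueaAct_mem _ u (LieSubmodule.subset_lieSpan rfl)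

end Enveloping

/-! ### The modules V(μ): finite dimension and highest weights -/

section Irreducible

open LieAlgebra LieAlgebra.IsKilling Module

variable {L : Type u} [LieRing L] [LieAlgebra ℂ L] [FiniteDimensional ℂ L]
  [LieAlgebra.IsKilling ℂ L] {H : LieSubalgebra ℂ L} [H.IsCartanSubalgebra]
  {b : (LieAlgebra.IsKilling.rootSystem H).Base}

theorem ueaAct_irr (mu : DomWt b) (u : UG L) (m : Irr b mu) : ueaAct L (Irr b mu) u m = u • m :=
  ueaAct_ofUEA L (Irr b mu) u m

theorem isPresentedBy_irrGen (mu : DomWt b) : IsPresentedBy (irrGen b mu) (irrRel b mu) := by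
  constructor
  · intro m
    obtain ⟨u, rfl⟩ := Submodule.mkQ_surjective (Submodule.span (UG L) (irrRel b mu)) m
    refine ⟨u, ?_⟩
    rw [ueaAct_irr]
    change Submodule.Quotient.mk (u • (1 : UG L)) = _
    rw [smul_eq_mul, mul_one]
    rfl
  · intro u
    rw [ueaAct_irr]
    change Submodule.Quotient.mk (u • (1 : UG L)) = _ ↔ _
    rw [smul_eq_mul, mul_one]
    exact Submodule.Quotient.mk_eq_zero _

theorem irrGen_relations (mu : DomWt b) {s : UG L} (hs : s ∈ irrRel b mu) :
    ueaAct L (Irr b mu) s (irrGen b mu) = 0 :=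
  ((isPresentedBy_irrGen mu).2 s).2 (Submodule.subset_span hs)

theorem irrGen_mem_wtSpace (mu : DomWt b) : irrGen b mu ∈ wtSpace (Irr b mu) mu.1 := by
  rw [mem_wtSpace]
  intro h
  have := irrGen_relations mu (Or.inl (Or.inl ⟨h, rfl⟩))
  rwa [map_sub, LinearMap.sub_apply, ueaAct_ι, ueaAct_algebraMap, sub_eq_zero] at this

theorem isHW_irrGen {mu : DomWt b} (h0 : irrGen b mu ≠ 0) : IsHW b mu.1 (irrGen b mu) := by
  refine IsHW.of_support h0 (irrGen_mem_wtSpace mu) fun i hi x hx => ?_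
  have := irrGen_relations mu (Or.inl (Or.inr ⟨i, hi, x, hx, rfl⟩))
  rwa [ueaAct_ι] at this

theorem pow_toEnd_irrGen (mu : DomWt b) {i : H.root} (hi : i ∈ b.support) {x : L}
    (hx : x ∈ rspNeg i) {n : ℕ} (hn : mu.1 (crt i) = n) :
    (LieModule.toEnd ℂ L (Irr b mu) x ^ (n + 1)) (irrGen b mu) = 0 := by
  have := irrGen_relations mu (Or.inr ⟨i, hi, x, hx, n, hn, rfl⟩)
  rwa [ueaAct_ι_pow] at this

/-- Since ad x is nilpotent, the vectors killed by a power of x form a 𝔤-submodule. It contains the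
generator by a defining relation. -/
theorem exists_pow_toEnd_irr_eq_zero (mu : DomWt b) {i : H.root} (hi : i ∈ b.support) {x : L}
    (hx : x ∈ rspNeg i) (m : Irr b mu) : ∃ n, (LieModule.toEnd ℂ L (Irr b mu) x ^ n) m = 0 := by
  have hmem : ∀ m : Irr b mu, m ∈ (LieModule.toEnd ℂ L (Irr b mu) x).maxGenEigenspace 0 ↔
      ∃ n, (LieModule.toEnd ℂ L (Irr b mu) x ^ n) m = 0 := fun m => by
    rw [Module.End.mem_maxGenEigenspace]; simp
  let W : LieSubmodule ℂ L (Irr b mu) :=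
    { (LieModule.toEnd ℂ L (Irr b mu) x).maxGenEigenspace 0 with
      lie_mem := fun {y m} hm => by
        have hy : y ∈ (LieModule.toEnd ℂ L L x).maxGenEigenspace 0 := by
          obtain ⟨k, hk⟩ := isNilpotent_toEnd_of_mem_rsp (M := L) (α := negRt i) hx
          rw [Module.End.mem_maxGenEigenspace]
          exact ⟨k, by simp [hk]⟩
        have := LieModule.lie_mem_maxGenEigenspace_toEnd hy hm
        rwa [add_zero] at this }
  obtain ⟨n, hn⟩ := mu.2 i hi
  have h1 : irrGen b mu ∈ W := (hmem _).2 ⟨n + 1, pow_toEnd_irrGen mu hi hx hn⟩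
  obtain ⟨u, rfl⟩ := (isPresentedBy_irrGen mu).1 m
  exact (hmem _).1 (ueaAct_mem W u h1)

section

variable {M : Type*} [AddCommGroup M] [Module ℂ M] [LieRingModule L M] [LieModule ℂ L M]

/-- A one-sided replacement for Weyl group symmetry. Lower w to the last nonzero f^a w, a lowest
weight vector of h-weight -(k + 2a); then e^{k+2a} f^a w ≠ 0, and its weight is ω + (k + a)α_i. -/
theorem exists_mem_wtSpace_of_neg {ω : Dual ℂ H} {w : M} (hw : w ∈ wtSpace M ω) (h0 : w ≠ 0)
    {i : H.root} {k : ℕ} (hk : ω (crt i) = -k)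
    (hnil : ∀ x ∈ rspNeg i, ∃ n, (LieModule.toEnd ℂ L M x ^ n) w = 0) :
    ∃ a : ℕ, ∃ w' ∈ wtSpace M (ω + (k + a) • rt i), w' ≠ 0 := by
  obtain ⟨e, he, f, hf, ht⟩ := exists_isSl2Triple i
  obtain ⟨a, ha0, ha1⟩ := Nat.exists_not_and_succ_of_not_zero_of_exists
    (p := fun k => (LieModule.toEnd ℂ L M f ^ k) w = 0) (by simpa using h0) (hnil f hf)
  have hfm : ∀ j : ℕ, (LieModule.toEnd ℂ L M f ^ j) w ∈ wtSpace M (ω - j • rt i) := by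
    intro j
    induction j with
    | zero => simpa using hw
    | succ j ih =>
      rw [pow_succ', Module.End.mul_apply, succ_nsmul, ← sub_sub]
      exact lie_mem_wtSpace_sub ih hf
  have hp : ht.symm.HasPrimitiveVectorWith ((LieModule.toEnd ℂ L M f ^ a) w) ((k + 2 * a : ℕ) : ℂ) := by
    refine ⟨ha0, ?_, ?_⟩
    · rw [neg_lie, mem_wtSpace.1 (hfm a), ← neg_smul]
      congr 1
      rw [LinearMap.sub_apply, LinearMap.smul_apply, rt_apply_crt_self, hk]
      push_cast
      simp
      ring
    · rw [← LieModule.toEnd_apply_apply ℂ, ← Module.End.mul_apply, ← pow_succ']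
      exact ha1
  have hem : ∀ j : ℕ, (LieModule.toEnd ℂ L M e ^ j) ((LieModule.toEnd ℂ L M f ^ a) w) ∈
      wtSpace M (ω - a • rt i + j • rt i) := by
    intro j
    induction j with
    | zero => simpa using hfm a
    | succ j ih =>
      rw [pow_succ', Module.End.mul_apply, succ_nsmul, ← add_assoc]
      exact lie_mem_wtSpace ih he
  refine ⟨a, _, ?_, hp.pow_toEnd_f_ne_zero_of_eq_nat rfl le_rfl⟩
  have h1 := hem (k + 2 * a)
  have h2 : ω - a • rt i + (k + 2 * a) • rt i = ω + (k + a) • rt i := by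
    rw [show k + 2 * a = a + (k + a) by ring, add_nsmul (rt i) a (k + a)]; abel
  rwa [h2] at h1

/-- The weights `ω` of an integrable highest weight module satisfy `(ω, ω) ≤ (μ, μ)`. -/
theorem ip_le_of_mem_wtSpace {mu : DomWt b} {v : M} (hv : v ∈ wtSpace M mu.1)
    (htop : wordSpan b v = ⊤)
    (hnil : ∀ i ∈ b.support, ∀ x ∈ rspNeg i, ∀ m : M, ∃ n, (LieModule.toEnd ℂ L M x ^ n) m = 0)
    {ω : Dual ℂ H} {w : M} (hw : w ∈ wtSpace M ω) (h0 : w ≠ 0) : ip ω ω ≤ ip mu.1 mu.1 := by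
  have hδ := exists_sub_mem_posCone_of_mem_wordSpan hv hw h0 (htop ▸ Submodule.mem_top)
  obtain ⟨n, hn, -⟩ := exists_ht_eq hδ
  induction n using Nat.strong_induction_on generalizing ω w with
  | _ n ih =>
    have hint : IsIntegral ω := by
      have := mu.isIntegral.sub (isIntegral_of_mem_posCone hδ)
      rwa [sub_sub_cancel] at this
    -- For dominant ω, the element μ - ω of Q⁺ pairs nonnegatively with both μ and ω, so (ω, ω) ≤
    -- (μ, ω) ≤ (μ, μ).
    by_cases hdom : ∀ i ∈ b.support, ∃ n : ℕ, ω (crt i) = n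
    · have h1 := ip_nonneg_of_mem_posCone hδ mu
      have h2 := ip_nonneg_of_mem_posCone hδ (⟨ω, hdom⟩ : DomWt b)
      rw [ip_sub_left] at h1 h2
      have h3 := ip_comm ω mu.1
      change 0 ≤ ip mu.1 ω - ip ω ω at h2
      linarith
    · push Not at hdom
      obtain ⟨i, hi, hneg⟩ := hdom
      obtain ⟨z, hz⟩ := hint i
      have hz0 : z < 0 := by
        by_contra hcon
        lift z to ℕ using not_lt.1 hcon
        exact hneg z (by simpa using hz)
      obtain ⟨k, hk⟩ := Int.eq_ofNat_of_zero_le (neg_nonneg.2 hz0.le)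
      have hkz : z = -(k : ℤ) := by rw [← hk, neg_neg]
      have hk0 : 0 < k := by omega
      -- Otherwise ω(h_i) = -k < 0 for some i. The weight ω + (k + a)α_i is closer to μ, and its
      -- square length is that of ω plus (k + a)a(α_i, α_i), so the bound for it implies the bound
      -- for ω.
      obtain ⟨a, w', hw', hw0'⟩ := exists_mem_wtSpace_of_neg hw h0 (i := i) (k := k)
        (by rw [hz, hkz]; simp) (fun x hx => hnil i hi x hx w)
      have hδ' := exists_sub_mem_posCone_of_mem_wordSpan hv hw' hw0' (htop ▸ Submodule.mem_top)
      obtain ⟨n', hn', -⟩ := exists_ht_eq hδ'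
      have hlt : n' < n := by
        have h1 : mu.1 - (ω + (k + a) • rt i) = (mu.1 - ω) - (k + a) • rt i := by abel
        rw [h1, map_sub, hn, map_nsmul, ht_rt_of_support hi] at hn'
        have h2 : (n : ℂ) = ((n' + (k + a) : ℕ) : ℂ) := by
          push_cast
          rw [← hn']
          simp
        have h3 : n = n' + (k + a) := by exact_mod_cast h2
        omega
      refine le_trans ?_ (ih n' hlt hw' hw0' hδ' hn')
      rw [ip_add_left, ip_add_right, ip_add_right, ip_nsmul_left, ip_nsmul_right, ip_nsmul_right,
        ip_nsmul_left, ip_comm ω (rt i), ip_rt_of_int hz, hkz]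
      have hpos := ip_rt_self_pos i
      set s := ip (rt i) (rt i)
      push_cast
      have h1 : (0 : ℝ) ≤ (k + a) * a * s := by positivity
      nlinarith

/-- If a word of weight μ - δ is nonzero, the length bound on weights and the sum of squares formula
bound (δ, α) for every root α, hence (δ, 2ρ), hence the height of δ, which is at least the length of
the word. So finitely many word lengths suffice to span. -/
theorem finiteDimensional_of_isHW {mu : DomWt b} {v : M} (hv : v ∈ wtSpace M mu.1)
    (htop : wordSpan b v = ⊤)
    (hnil : ∀ i ∈ b.support, ∀ x ∈ rspNeg i, ∀ m : M, ∃ n, (LieModule.toEnd ℂ L M x ^ n) m = 0) :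
    FiniteDimensional ℂ M := by
  classical
  set C := ip mu.1 mu.1 with hC
  have hC0 : 0 ≤ C := ip_domWt_nonneg mu mu
  obtain ⟨c, hc, hc'⟩ := exists_ip_twoRho_ge b
  -- A crude bound, chosen to avoid square roots.
  have habs : ∀ x : ℝ, x ^ 2 ≤ C → |x| ≤ C + 1 := fun x hx => by
    rw [abs_le]
    constructor <;> nlinarith [sq_nonneg (x - 1), sq_nonneg (x + 1)]
  obtain ⟨K, hK⟩ := exists_nat_gt ((Fintype.card H.root : ℝ) * (2 * (C + 1)) / c)
  have hbound : ∀ k δ w, IsWord b v k δ w → w ≠ 0 → k < K := by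
    intro k δ w hw h0
    obtain ⟨hδ, n, hn, hkn⟩ := hw.mem_posCone
    have hwt := hw.mem_wtSpace hv
    have h1 := ip_le_of_mem_wtSpace hv htop hnil hwt h0
    have hint : IsIntegral (mu.1 - δ) := mu.isIntegral.sub (isIntegral_of_mem_posCone hδ)
    have h2 : ∀ α : H.root, ip δ (rt α) ≤ 2 * (C + 1) := by
      intro α
      have h3 := habs _ ((ip_sq_le hint α).trans h1)
      have h4 := habs _ (ip_sq_le mu.isIntegral α)
      rw [ip_sub_right] at h3
      rw [ip_comm δ]
      rw [abs_le] at h3 h4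
      linarith [h3.1, h4.2]
    have h5 : ip δ (twoRho b) ≤ (Fintype.card H.root : ℝ) * (2 * (C + 1)) := by
      rw [twoRho, ip_sum_right]
      refine (Finset.sum_le_card_nsmul _ _ _ fun α _ => h2 α).trans ?_
      rw [nsmul_eq_mul]
      have : (Finset.univ.filter (fun α : H.root => b.IsPos α)).card ≤ Fintype.card H.root :=
        Finset.card_le_univ _
      gcongr
    have h6 := hc' δ hδ n hn
    rw [div_lt_iff₀ hc] at hK
    have h7 : c * n < c * K := by linarith
    have h8 : (n : ℝ) < K := lt_of_mul_lt_mul_left h7 hc.le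
    have h9 : n < K := by exact_mod_cast h8
    omega
  let act : L →ₗ[ℂ] M →ₗ[ℂ] M := (LieModule.toEnd ℂ L M : L →ₗ[ℂ] Module.End ℂ M)
  -- The result of applying 𝔤 to v exactly k times: finite-dimensional, and it contains all words of
  -- length k.
  let F : ℕ → Submodule ℂ M := fun k => Nat.rec (Submodule.span ℂ {v})
    (fun _ W => Submodule.map₂ act ⊤ W) k
  have hF : ∀ k, (F k).FG := by
    intro k
    induction k with
    | zero => exact Submodule.fg_span_singleton v
    | succ k ih => exact Submodule.FG.map₂ act (Module.Finite.fg_top) ih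
  have hword : ∀ k δ w, IsWord b v k δ w → w ∈ F k := by
    intro k δ w hw
    induction hw with
    | nil => exact Submodule.mem_span_singleton_self v
    | cons α hα y hy _ ih => exact Submodule.apply_mem_map₂ act (Submodule.mem_top (x := y)) ih
  have hsup : ⨆ k ∈ Finset.range K, F k = ⊤ := by
    rw [eq_top_iff, ← htop, wordSpan, Submodule.span_le]
    rintro w ⟨k, δ, hw⟩
    by_cases h0 : w = 0
    · rw [h0]; exact zero_mem _
    · exact Submodule.mem_iSup_of_mem k (Submodule.mem_iSup_of_mem
        (Finset.mem_range.2 (hbound k δ w hw h0)) (hword k δ w hw))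
  refine ⟨?_⟩
  rw [← hsup]
  exact Submodule.fg_biSup _ _ fun k _ => hF k

end

/-- `V(μ)` is finite-dimensional. -/
instance finiteDimensional_irr (mu : DomWt b) : FiniteDimensional ℂ (Irr b mu) := by
  by_cases h0 : irrGen b mu = 0
  · have : Subsingleton (Irr b mu) := ⟨fun x y => by
      obtain ⟨u, rfl⟩ := (isPresentedBy_irrGen mu).1 x
      obtain ⟨u', rfl⟩ := (isPresentedBy_irrGen mu).1 y
      rw [h0, map_zero, map_zero]⟩
    infer_instance
  · refine finiteDimensional_of_isHW (irrGen_mem_wtSpace mu) ?_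
      (fun i hi x hx m => exists_pow_toEnd_irr_eq_zero mu hi hx m)
    have h1 := (isHW_irrGen h0).lieSpan_le_wordSpan
    rw [(isPresentedBy_irrGen mu).lieSpan_eq_top, LieSubmodule.top_toSubmodule] at h1
    exact top_le_iff.1 h1

theorem eq_of_isHW_irr {mu : DomWt b} {nu : Dual ℂ H} {w : Irr b mu} (hw : IsHW b nu w) :
    nu = mu.1 := by
  have h0 : irrGen b mu ≠ 0 := by
    intro h0
    obtain ⟨u, hu⟩ := (isPresentedBy_irrGen mu).1 w
    rw [h0, map_zero] at hu
    exact hw.ne_zero hu.symm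
  exact (isHW_irrGen h0).eq_of_mem_lieSpan hw
    ((isPresentedBy_irrGen mu).lieSpan_eq_top ▸ LieSubmodule.mem_top w)

theorem IsHW.irrRel_eq_zero {M : Type u} [AddCommGroup M] [Module ℂ M] [LieRingModule L M]
    [LieModule ℂ L M] [FiniteDimensional ℂ M] {mu : DomWt b} {v : M} (hv : IsHW b mu.1 v)
    {s : UG L} (hs : s ∈ irrRel b mu) : ueaAct L M s v = 0 := by
  rcases hs with (⟨h, rfl⟩ | ⟨i, hi, x, hx, rfl⟩) | ⟨i, hi, x, hx, n, hn, rfl⟩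
  · rw [map_sub, LinearMap.sub_apply, ueaAct_ι, ueaAct_algebraMap,
      GradedAdjoint.mem_wtSpace.1 hv.mem_wtSpace, sub_self]
  · rw [ueaAct_ι]
    exact hv.lie_eq_zero i (RootPairing.Base.isPos_of_mem_support hi) x hx
  · rw [ueaAct_ι_pow]
    exact hv.pow_toEnd_eq_zero (RootPairing.Base.isPos_of_mem_support hi) hx hn

/-- `Hom_𝔤(V(μ), M) ≠ 0` if and only if `M` has a highest weight vector of weight `μ`. -/
theorem exists_hom_ne_zero_iff {M : Type u} [AddCommGroup M] [Module ℂ M] [LieRingModule L M]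
    [LieModule ℂ L M] [FiniteDimensional ℂ M] {mu : DomWt b} :
    (∃ f : Irr b mu →ₗ⁅ℂ, L⁆ M, f ≠ 0) ↔ ∃ v : M, IsHW b mu.1 v := by
  constructor
  · rintro ⟨f, hf⟩
    have h1 : f (irrGen b mu) ≠ 0 := by
      intro h
      apply hf
      ext m
      obtain ⟨u, rfl⟩ := (isPresentedBy_irrGen mu).1 m
      rw [map_ueaAct, h, map_zero]
      rfl
    exact ⟨_, (isHW_irrGen (fun h => h1 (by rw [h, map_zero]))).map f h1⟩
  · rintro ⟨v, hv⟩
    obtain ⟨f, hf⟩ := (isPresentedBy_irrGen mu).exists_hom (x := v) fun s hs => hv.irrRel_eq_zero hs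
    exact ⟨f, fun h => hv.ne_zero (by rw [← hf, h]; rfl)⟩

end Irreducible

/-! ### The potential (μ, ξ) + rM and the set Γ(λ, Ψ) -/

section Truncation

open LieAlgebra LieAlgebra.IsKilling Module

variable {L : Type u} [LieRing L] [LieAlgebra ℂ L] [FiniteDimensional ℂ L]
  [LieAlgebra.IsKilling ℂ L] {H : LieSubalgebra ℂ L} [H.IsCartanSubalgebra]
  {b : (LieAlgebra.IsKilling.rootSystem H).Base}

/-- `Ψ` is the set of roots at which `(·, ξ)` attains its maximum `M` over the roots, and `M` is
positive. -/
structure IsMaximizing (ξ : Dual ℂ H) (Ψ : Set H.root) (M : ℝ) : Prop where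
  pos : 0 < M
  le : ∀ β : H.root, ip (rt β) ξ ≤ M
  mem_iff : ∀ β : H.root, β ∈ Ψ ↔ ip (rt β) ξ = M

/-- The maximum is nonnegative because R = -R. If it were zero, a maximizing α and its negative
would both be in Ψ, contradicting Ψ ⊂ R⁺. If there are no roots, any positive number will do. -/
theorem exists_isMaximizing {ξ : Dual ℂ H} {Ψ : Set H.root} (hpos : ∀ α ∈ Ψ, b.IsPos α)
    (hΨ : Ψ = {α | ∀ β : H.root, (form (rt β) ξ).re ≤ (form (rt α) ξ).re}) :
    ∃ M, IsMaximizing ξ Ψ M := by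
  rcases isEmpty_or_nonempty H.root with he | hne
  · exact ⟨1, one_pos, fun β => he.elim β, fun β => he.elim β⟩
  · obtain ⟨α, hα⟩ := Finite.exists_max fun β : H.root => ip (rt β) ξ
    have hmem : ∀ β, β ∈ Ψ ↔ ip (rt β) ξ = ip (rt α) ξ := by
      intro β
      rw [hΨ]
      exact ⟨fun h => le_antisymm (hα β) (h α), fun h β' => (hα β').trans_eq h.symm⟩
    have hneg := hα (negRt α)
    rw [rt_negRt, ip_neg_left] at hneg
    refine ⟨ip (rt α) ξ, lt_of_le_of_ne (by linarith) fun h0 => ?_, hα, hmem⟩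
    have h1 : negRt α ∈ Ψ := by
      rw [hmem, rt_negRt, ip_neg_left, ← h0, neg_zero]
    exact isPos_negRt_iff.1 (hpos _ h1) (hpos _ ((hmem α).2 rfl))

theorem IsMaximizing.lt {ξ : Dual ℂ H} {Ψ : Set H.root} {M : ℝ} (h : IsMaximizing ξ Ψ M)
    {β : H.root} (hβ : β ∉ Ψ) : ip (rt β) ξ < M :=
  lt_of_le_of_ne (h.le β) fun h' => hβ ((h.mem_iff β).2 h')

/-- `ω` is of the form `λ - ∑ n_β β` with `β ∈ Ψ` and `∑ n_β = r`. -/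
def IsLowering (lam : Dual ℂ H) (Ψ : Set H.root) (ω : Dual ℂ H) (r : ℕ) : Prop :=
  ∃ n : H.root → ℕ, (∀ β, β ∉ Ψ → n β = 0) ∧ ω = lam - ∑ β, n β • rt β ∧ ∑ β, n β = r

theorem mem_gammaSet {lam : DomWt b} {Ψ : Set H.root} {γ : Lam b} :
    γ ∈ GammaSet lam Ψ ↔ IsLowering lam.1 Ψ γ.1.1 γ.2 := Iff.rfl

theorem IsLowering.sub_rt {lam : Dual ℂ H} {Ψ : Set H.root} {ω : Dual ℂ H} {r : ℕ}
    (h : IsLowering lam Ψ ω r) {β : H.root} (hβ : β ∈ Ψ) :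
    IsLowering lam Ψ (ω - rt β) (r + 1) := by
  classical
  obtain ⟨n, hn, rfl, rfl⟩ := h
  refine ⟨n + Pi.single β 1, fun β' hβ' => ?_, ?_, ?_⟩
  · have : β' ≠ β := fun h => hβ' (h ▸ hβ)
    simp [hn β' hβ', this]
  · simp [add_smul, Finset.sum_add_distrib, Pi.single_apply, ite_smul, sub_sub]
  · simp [Finset.sum_add_distrib]

theorem IsLowering.ip_eq {lam : Dual ℂ H} {ξ : Dual ℂ H} {Ψ : Set H.root} {M : ℝ}
    (hM : IsMaximizing ξ Ψ M) {ω : Dual ℂ H} {r : ℕ} (h : IsLowering lam Ψ ω r) :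
    ip ω ξ = ip lam ξ - r * M := by
  obtain ⟨n, hn, rfl, rfl⟩ := h
  rw [ip_sub_left, ip_sum_left, Nat.cast_sum, Finset.sum_mul]
  congr 1
  refine Finset.sum_congr rfl fun β _ => ?_
  rw [ip_nsmul_left]
  by_cases hβ : β ∈ Ψ
  · rw [(hM.mem_iff β).1 hβ]
  · rw [hn β hβ]; simp

/-- Dominance gives 0 ≤ (μ, ξ) = (λ, ξ) - rM, which bounds r and so all the coefficients n_β; these
determine (μ, r). -/
theorem finite_gammaSet {lam ξ : DomWt b} {Ψ : Set H.root} {M : ℝ}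
    (hM : IsMaximizing ξ.1 Ψ M) : (GammaSet lam Ψ).Finite := by
  obtain ⟨K, hK⟩ := exists_nat_gt (ip lam.1 ξ.1 / M)
  choose! n hn using fun (γ : Lam b) (hγ : γ ∈ GammaSet lam Ψ) => hγ
  have hfin : (Set.univ.pi fun _ : H.root => Set.Iic K).Finite :=
    Set.Finite.pi fun _ => Set.finite_Iic K
  refine Set.Finite.of_finite_image (f := n) (hfin.subset ?_) ?_
  · rintro _ ⟨γ, hγ, rfl⟩ β -
    have h1 := IsLowering.ip_eq hM hγ
    have h2 := ip_domWt_nonneg γ.1 ξ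
    rw [div_lt_iff₀ hM.pos] at hK
    have h3 : (γ.2 : ℝ) < K := by
      refine lt_of_mul_lt_mul_right ?_ hM.pos.le
      linarith
    have h4 : γ.2 < K := by exact_mod_cast h3
    have h5 : n γ β ≤ ∑ β, n γ β := Finset.single_le_sum (fun _ _ => Nat.zero_le _)
      (Finset.mem_univ β)
    rw [(hn γ hγ).2.2] at h5
    exact h5.trans h4.le
  · intro γ hγ γ' hγ' h
    refine Prod.ext (Subtype.ext ?_) ?_
    · rw [(hn γ hγ).2.1, (hn γ' hγ').2.1, h]
    · rw [← (hn γ hγ).2.2, ← (hn γ' hγ').2.2, h]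

/-- Along the partial order `(μ, ξ) + r M` increases, and it is constant only along chains which
subtract elements of `Ψ`. -/
theorem Prec.isLowering {lam ξ : DomWt b} {Ψ : Set H.root} {M : ℝ}
    (hM : IsMaximizing ξ.1 Ψ M) {γ γ' : Lam b} (h : Prec γ γ') :
    ip γ.1.1 ξ.1 + γ.2 * M ≤ ip γ'.1.1 ξ.1 + γ'.2 * M ∧
    (ip γ'.1.1 ξ.1 + γ'.2 * M ≤ ip γ.1.1 ξ.1 + γ.2 * M → γ ∈ GammaSet lam Ψ →
      γ' ∈ GammaSet lam Ψ) := by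
  induction h with
  | refl => exact ⟨le_rfl, fun _ h => h⟩
  | @tail γ₁ γ₂ _ hc ih =>
    obtain ⟨ih1, ih2⟩ := ih
    obtain ⟨hdeg, hstep⟩ := hc
    rw [hdeg]
    push_cast
    -- A step by α raises the potential by M - (-α, ξ), which vanishes only for -α ∈ Ψ. A step by 0
    -- raises it by M > 0, so it cannot occur when the potential stays constant.
    rcases hstep with ⟨α, hα⟩ | h0
    · have h1 : γ₂.1.1 = γ₁.1.1 - rt (negRt α) := by
        rw [rt_negRt, ← hα]; abel
      have h2 := hM.le (negRt α)
      have h3 : ip γ₂.1.1 ξ.1 = ip γ₁.1.1 ξ.1 - ip (rt (negRt α)) ξ.1 := by rw [h1, ip_sub_left]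
      refine ⟨by linarith, fun hle hγ => ?_⟩
      have h4 := ih2 (by linarith) hγ
      have h5 : negRt α ∈ Ψ := (hM.mem_iff _).2 (by linarith)
      rw [mem_gammaSet, h1, hdeg]
      exact IsLowering.sub_rt h4 h5
    · rw [sub_eq_zero] at h0
      rw [h0]
      have := hM.pos
      exact ⟨by linarith, fun hle _ => by linarith⟩

/-- The potential is monotone and takes the same value at both ends of the interval, so it is
constant along the chain, which therefore only subtracts elements of Ψ. -/
theorem intervalClosed_gammaSet {lam ξ : DomWt b} {Ψ : Set H.root} {M : ℝ}
    (hM : IsMaximizing ξ.1 Ψ M) : IntervalClosed (GammaSet lam Ψ) := by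
  intro γ hγ γ' hγ' γ'' h1 h2
  refine (h1.isLowering hM).2 ?_ hγ
  have h3 := (h2.isLowering (lam := lam) hM).1
  have h4 := IsLowering.ip_eq hM hγ
  have h5 := IsLowering.ip_eq hM hγ'
  linarith

end Truncation

/-! ### Graded modules: morphisms, quotients, generators -/

section Graded

open LieAlgebra LieAlgebra.IsKilling Module

namespace GrMod

variable {L : Type u} [LieRing L] [LieAlgebra ℂ L]

instance (M : GrMod L) : LieRingModule L M.carrier := LieRingModule.compLieHom M.carrier inG

instance (M : GrMod L) : LieModule ℂ L M.carrier := LieModule.compLieHom M.carrier inG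

theorem inG_lie {M : GrMod L} (x : L) (m : M.carrier) : ⁅(inG x : SemiAd L), m⁆ = ⁅x, m⁆ := rfl

theorem lie_inAd_lie {M : GrMod L} (x y : L) (m : M.carrier) :
    ⁅x, ⁅(inAd y : SemiAd L), m⁆⁆ = ⁅(inAd ⁅x, y⁆ : SemiAd L), m⁆ + ⁅(inAd y : SemiAd L), ⁅x, m⁆⁆ := by
  rw [← inG_lie, leibniz_lie, inG_lie]
  congr 2
  refine Prod.ext ?_ ?_
  · change ⁅x, (0 : L)⁆ = 0
    simp
  · change ⁅x, y⁆ + ⁅(0 : L), (0 : L)⁆ = ⁅x, y⁆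
    simp

theorem inAd_lie_comm {M : GrMod L} (x y : L) (m : M.carrier) :
    ⁅(inAd x : SemiAd L), ⁅(inAd y : SemiAd L), m⁆⁆ =
      ⁅(inAd y : SemiAd L), ⁅(inAd x : SemiAd L), m⁆⁆ := by
  rw [leibniz_lie, lie_inAd_inAd, zero_lie, zero_add]

theorem lie_eq_add {M : GrMod L} (a : SemiAd L) (m : M.carrier) :
    ⁅a, m⁆ = ⁅a.1, m⁆ + ⁅(inAd a.2 : SemiAd L), m⁆ := by
  rw [← inG_lie, ← add_lie, inG_add_inAd]

/-- The inclusion of a graded piece. -/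
def degIncl (M : GrMod L) (k : ℕ) : M.deg k →ₗ⁅ℂ, L⁆ M.carrier :=
  { (M.deg k).subtype with map_lie' := rfl }

theorem degIncl_injective (M : GrMod L) (k : ℕ) : Function.Injective (M.degIncl k) :=
  Subtype.val_injective

/-- A homomorphism of `𝔤 ⋉ 𝔤_ad`-modules as a homomorphism of `𝔤`-modules. -/
def resHom {M N : GrMod L} (f : M.carrier →ₗ⁅ℂ, SemiAd L⁆ N.carrier) :
    M.carrier →ₗ⁅ℂ, L⁆ N.carrier :=
  { (f : M.carrier →ₗ[ℂ] N.carrier) with map_lie' := fun {_ _} => f.map_lie _ _ }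

/-- The restriction of a morphism to a graded piece. -/
def Hom.degHom {M N : GrMod L} (f : Hom M N) (k : ℕ) : M.deg k →ₗ⁅ℂ, L⁆ N.deg k :=
  { (f.toLieHom : M.carrier →ₗ[ℂ] N.carrier).restrict (f.map_deg k) with
    map_lie' := fun {_ _} => Subtype.ext (f.toLieHom.map_lie _ _) }

theorem mem_iSup_deg (M : GrMod L) (m : M.carrier) : m ∈ ⨆ k, M.deg k := by
  rw [M.isInternal.submodule_iSup_eq_top]
  trivial

theorem deg_induction {M : GrMod L} {C : M.carrier → Prop} (mem : ∀ j, ∀ m ∈ M.deg j, C m)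
    (zero : C 0) (add : ∀ m n, C m → C n → C (m + n)) (m : M.carrier) : C m :=
  Submodule.iSup_induction _ (motive := C) (M.mem_iSup_deg m) mem zero add

theorem Hom.proj_map {M N : GrMod L} (f : Hom M N) (k : ℕ) (m : M.carrier) :
    N.proj k (f.toLieHom m) = f.toLieHom (M.proj k m) := by
  induction m using deg_induction with
  | mem j m hm =>
    rw [M.proj_of_mem k j m hm, N.proj_of_mem k j _ (f.map_deg j m hm)]
    split_ifs <;> simp
  | zero => simp
  | add m n hm hn => simp [hm, hn]

theorem proj_lie (M : GrMod L) (k : ℕ) (x : L) (m : M.carrier) :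
    M.proj k ⁅x, m⁆ = ⁅x, M.proj k m⁆ := by
  induction m using deg_induction with
  | mem j m hm =>
    rw [M.proj_of_mem k j m hm, M.proj_of_mem k j ⁅x, m⁆ (M.lie_inG_mem j x m hm)]
    split_ifs <;> simp
  | zero => simp
  | add m n hm hn => simp [hm, hn]

theorem proj_zero_inAd_lie (M : GrMod L) (y : L) (m : M.carrier) :
    M.proj 0 ⁅(inAd y : SemiAd L), m⁆ = 0 := by
  induction m using deg_induction with
  | mem j m hm => rw [M.proj_of_mem 0 _ _ (M.lie_inAd_mem j y m hm), if_neg (by omega)]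
  | zero => simp
  | add m n hm hn => simp [hm, hn]

theorem proj_succ_inAd_lie (M : GrMod L) (k : ℕ) (y : L) (m : M.carrier) :
    M.proj (k + 1) ⁅(inAd y : SemiAd L), m⁆ = ⁅(inAd y : SemiAd L), M.proj k m⁆ := by
  induction m using deg_induction with
  | mem j m hm =>
    rw [M.proj_of_mem (k + 1) _ _ (M.lie_inAd_mem j y m hm), M.proj_of_mem k j m hm]
    by_cases h : k = j <;> simp [h]
  | zero => simp
  | add m n hm hn => simp [hm, hn]

/-- The submodule generated by homogeneous elements is graded. -/
def spanSub (M : GrMod L) (S : Set M.carrier) (hS : ∀ s ∈ S, ∃ k, s ∈ M.deg k) : M.GrSub where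
  toLie := LieSubmodule.lieSpan ℂ (SemiAd L) S
  homogeneous := by
    -- The elements all of whose homogeneous components lie in the span form a submodule. It
    -- contains S because each element of S is its own only nonzero component, or zero.
    let W : LieSubmodule ℂ (SemiAd L) M.carrier :=
      { (⨅ k, (LieSubmodule.lieSpan ℂ (SemiAd L) S).toSubmodule.comap (M.proj k) :
          Submodule ℂ M.carrier) with
        lie_mem := fun {a m} hm => by
          have hm' := (Submodule.mem_iInf _).1 hm
          refine (Submodule.mem_iInf _).2 fun k => ?_
          change M.proj k ⁅a, m⁆ ∈ LieSubmodule.lieSpan ℂ (SemiAd L) S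
          rw [lie_eq_add, map_add, proj_lie]
          refine add_mem (LieSubmodule.lie_mem _ (x := inG a.1) (hm' k)) ?_
          rcases k with _ | k
          · rw [proj_zero_inAd_lie]; exact zero_mem _
          · rw [proj_succ_inAd_lie]; exact LieSubmodule.lie_mem _ (hm' k) }
    have h : LieSubmodule.lieSpan ℂ (SemiAd L) S ≤ W := by
      refine LieSubmodule.lieSpan_le.2 fun s hs => (Submodule.mem_iInf _).2 fun k => ?_
      obtain ⟨j, hj⟩ := hS s hs
      change M.proj k s ∈ LieSubmodule.lieSpan ℂ (SemiAd L) S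
      rw [M.proj_of_mem k j s hj]
      split_ifs
      · exact LieSubmodule.subset_lieSpan hs
      · exact zero_mem _
    exact fun k m hm => (Submodule.mem_iInf _).1 (h hm) k

/-- The kernel of a morphism. -/
def Hom.ker {M N : GrMod L} (f : Hom M N) : M.GrSub where
  toLie := f.toLieHom.ker
  homogeneous k m hm := by
    rw [LieModuleHom.mem_ker] at hm ⊢
    rw [← f.proj_map, hm, map_zero]

/-- The image of a morphism. -/
def Hom.range {M N : GrMod L} (f : Hom M N) : N.GrSub where
  toLie := f.toLieHom.range
  homogeneous k m hm := by
    rw [LieModuleHom.mem_range] at hm ⊢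
    obtain ⟨m, rfl⟩ := hm
    exact ⟨_, (f.proj_map k m).symm⟩

instance (M N : GrMod L) : Zero (Hom M N) := ⟨⟨0, fun _ _ _ => Submodule.zero_mem _⟩⟩

/-- The projection to a quotient. -/
def quotMk (M : GrMod L) (N : M.GrSub) : Hom M (M.quot N) where
  toLieHom := LieSubmodule.Quotient.mk' N.toLie
  map_deg _ v hv := ⟨v, hv, rfl⟩

theorem quotMk_surjective (M : GrMod L) (N : M.GrSub) : Function.Surjective (M.quotMk N).toLieHom :=
  LieSubmodule.Quotient.surjective_mk' N.toLie

theorem quotMk_eq_zero (M : GrMod L) (N : M.GrSub) {m : M.carrier} :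
    (M.quotMk N).toLieHom m = 0 ↔ m ∈ N.toLie :=
  LieSubmodule.Quotient.mk_eq_zero N.toLie

theorem exists_of_mem_deg_quot (M : GrMod L) (N : M.GrSub) {k : ℕ} {x : (M.quot N).carrier}
    (hx : x ∈ (M.quot N).deg k) : ∃ m ∈ M.deg k, (M.quotMk N).toLieHom m = x := hx

/-- The morphism induced on a quotient. -/
def quotLift {M X : GrMod L} (N : M.GrSub) (f : Hom M X) (h : N.toLie ≤ f.toLieHom.ker) :
    Hom (M.quot N) X where
  toLieHom :=
    { N.toLie.toSubmodule.liftQ (f.toLieHom : M.carrier →ₗ[ℂ] X.carrier) h with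
      map_lie' := fun {a m} => by
        obtain ⟨m, rfl⟩ := M.quotMk_surjective N m
        rw [← LieModuleHom.map_lie]
        exact f.toLieHom.map_lie a m }
  map_deg k := by
    rintro _ ⟨m, hm, rfl⟩
    exact f.map_deg k m hm

end GrMod

section Enveloping

variable {L : Type u} [LieRing L] [LieAlgebra ℂ L]

open GrMod

theorem ueaAct_mem_deg {M : GrMod L} {r j : ℕ} {c : UT L} (hc : c ∈ uDeg j) {p : M.carrier}
    (hp : p ∈ M.deg r) : ueaAct (SemiAd L) M.carrier c p ∈ M.deg (j + r) := by
  induction hc using Submodule.span_induction with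
  | mem c hc =>
    obtain ⟨l, rfl, rfl⟩ := hc
    induction l with
    | nil => simpa using hp
    | cons a l ih =>
      simp only [List.map_cons, List.prod_cons, ueaAct_mul, List.sum_cons]
      rcases a with x | y
      · rw [gen, ueaAct_ι, genDeg, zero_add]
        exact M.lie_inG_mem _ _ _ ih
      · rw [gen, ueaAct_ι, genDeg, add_comm 1, add_right_comm]
        exact M.lie_inAd_mem _ _ _ ih
  | zero => simp
  | add c d _ _ hc hd => rw [map_add, LinearMap.add_apply]; exact add_mem hc hd
  | smul t c _ hc => rw [map_smul, LinearMap.smul_apply]; exact Submodule.smul_mem _ t hc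

/-- The homogeneous components of the elements of a module generated by a homogeneous element. -/
theorem proj_ueaAct_mem {M : GrMod L} {r k : ℕ} {p : M.carrier} (hp : p ∈ M.deg r)
    (B : Submodule ℂ M.carrier)
    (hB : ∀ j c, j + r = k → c ∈ uDeg j → ueaAct (SemiAd L) M.carrier c p ∈ B) (u : UT L) :
    M.proj k (ueaAct (SemiAd L) M.carrier u p) ∈ B := by
  have hu : u ∈ ⨆ k, (uDeg k : Submodule ℂ (UT L)) := by rw [iSup_uDeg]; trivial
  induction hu using Submodule.iSup_induction' with
  | mem j c hc =>
    rw [M.proj_of_mem k (j + r) _ (ueaAct_mem_deg hc hp)]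
    split_ifs with h
    · exact hB j c h.symm hc
    · exact zero_mem _
  | zero => simp
  | add u v _ _ hu hv => rw [map_add, LinearMap.add_apply, map_add]; exact add_mem hu hv

theorem mem_of_mem_deg {M : GrMod L} {r k : ℕ} {p : M.carrier} (hp : p ∈ M.deg r)
    (hgen : ∀ m, ∃ u, ueaAct (SemiAd L) M.carrier u p = m) (B : Submodule ℂ M.carrier)
    (hB : ∀ j c, j + r = k → c ∈ uDeg j → ueaAct (SemiAd L) M.carrier c p ∈ B)
    {m : M.carrier} (hm : m ∈ M.deg k) : m ∈ B := by
  obtain ⟨u, hu⟩ := hgen m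
  have := proj_ueaAct_mem hp B hB u
  rwa [hu, M.proj_of_mem k k m hm, if_pos rfl] at this

/-- A module map which preserves the degree of a homogeneous generator is graded. -/
def homOfGen {M N : GrMod L} {r : ℕ} {p : M.carrier} (hp : p ∈ M.deg r)
    (hgen : ∀ m, ∃ u, ueaAct (SemiAd L) M.carrier u p = m)
    (f : M.carrier →ₗ⁅ℂ, SemiAd L⁆ N.carrier) (hf : f p ∈ N.deg r) : Hom M N where
  toLieHom := f
  map_deg k m hm := by
    refine mem_of_mem_deg hp hgen ((N.deg k).comap (f : M.carrier →ₗ[ℂ] N.carrier)) ?_ hm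
    rintro j c rfl hc
    change f (ueaAct (SemiAd L) M.carrier c p) ∈ N.deg (j + r)
    rw [map_ueaAct]
    exact ueaAct_mem_deg hc hf

theorem uIncl_ι (x : L) : uIncl L (UniversalEnvelopingAlgebra.ι ℂ x) = gen (.inl x) :=
  UniversalEnvelopingAlgebra.lift_ι_apply ..

theorem exists_uIncl_eq {c : UT L} (hc : c ∈ uDeg 0) : ∃ a, uIncl L a = c := by
  induction hc using Submodule.span_induction with
  | mem c hc =>
    obtain ⟨l, hl, rfl⟩ := hc
    induction l with
    | nil => exact ⟨1, by simp⟩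
    | cons a l ih =>
      rw [List.map_cons, List.sum_cons, Nat.add_eq_zero_iff] at hl
      obtain ⟨a', ha'⟩ := ih hl.2
      rcases a with x | y
      · exact ⟨UniversalEnvelopingAlgebra.ι ℂ x * a', by
          rw [map_mul, ha', uIncl_ι, List.map_cons, List.prod_cons]⟩
      · exact absurd hl.1 one_ne_zero
  | zero => exact ⟨0, map_zero _⟩
  | add c d _ _ hc hd =>
    obtain ⟨a, rfl⟩ := hc
    obtain ⟨a', rfl⟩ := hd
    exact ⟨a + a', map_add _ _ _⟩
  | smul t c _ hc =>
    obtain ⟨a, rfl⟩ := hc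
    exact ⟨t • a, map_smul _ _ _⟩

theorem ueaAct_uIncl {M : GrMod L} (a : UG L) (m : M.carrier) :
    ueaAct (SemiAd L) M.carrier (uIncl L a) m = ueaAct L M.carrier a m := by
  induction a using uea_induction generalizing m with
  | algebraMap t => rw [AlgHom.commutes, ueaAct_algebraMap, ueaAct_algebraMap]
  | ι x => rw [uIncl_ι, gen, ueaAct_ι, ueaAct_ι]; rfl
  | add u v hu hv => rw [map_add, map_add, map_add, LinearMap.add_apply, LinearMap.add_apply, hu, hv]
  | mul u v hu hv => rw [map_mul, ueaAct_mul, ueaAct_mul, hu, hv]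

/-- Only the degree 0 part of U(𝔤 ⋉ 𝔤_ad) contributes in the degree of the generator, and its
monomials involve no element of 𝔤_ad. -/
theorem exists_ueaAct_uIncl_eq {M : GrMod L} {r : ℕ} {p : M.carrier} (hp : p ∈ M.deg r)
    (hgen : ∀ m, ∃ u, ueaAct (SemiAd L) M.carrier u p = m) {m : M.carrier} (hm : m ∈ M.deg r) :
    ∃ a, ueaAct (SemiAd L) M.carrier (uIncl L a) p = m := by
  have := mem_of_mem_deg hp hgen (LinearMap.range
    ((ueaAct (SemiAd L) M.carrier).toLinearMap.flip p ∘ₗ (uIncl L).toLinearMap)) ?_ hm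
  · obtain ⟨a, ha⟩ := this
    exact ⟨a, ha⟩
  · intro j c hj hc
    obtain rfl : j = 0 := by omega
    obtain ⟨a, rfl⟩ := exists_uIncl_eq hc
    exact ⟨a, rfl⟩

/-- The action of `𝔤_ad` as a bilinear map. -/
def adAct (M : GrMod L) : L →ₗ[ℂ] M.carrier →ₗ[ℂ] M.carrier :=
  (LieModule.toEnd ℂ (SemiAd L) M.carrier : SemiAd L →ₗ[ℂ] Module.End ℂ M.carrier) ∘ₗ inAd

theorem adAct_apply (M : GrMod L) (y : L) (m : M.carrier) :
    adAct M y m = ⁅(inAd y : SemiAd L), m⁆ := rfl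

/-- The span of the elements `y₁ ⋯ y_k w` with `y_i ∈ Y_ad` and `w ∈ W`. -/
def adPow {M : GrMod L} (Y : Submodule ℂ L) (W : Submodule ℂ M.carrier) : ℕ → Submodule ℂ M.carrier
  | 0 => W
  | k + 1 => Submodule.map₂ (adAct M) Y (adPow Y W k)

theorem inAd_lie_mem_adPow {M : GrMod L} {Y : Submodule ℂ L} {W : Submodule ℂ M.carrier} {k : ℕ}
    {y : L} (hy : y ∈ Y) {m : M.carrier} (hm : m ∈ adPow Y W k) :
    ⁅(inAd y : SemiAd L), m⁆ ∈ adPow Y W (k + 1) :=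
  Submodule.apply_mem_map₂ (adAct M) hy hm

theorem adPow_fg [FiniteDimensional ℂ L] {M : GrMod L} (Y : Submodule ℂ L)
    {W : Submodule ℂ M.carrier} (hW : W.FG) (k : ℕ) : (adPow Y W k).FG := by
  induction k with
  | zero => exact hW
  | succ k ih => exact Submodule.FG.map₂ _ (IsNoetherian.noetherian Y) ih

theorem adPow_le_deg {M : GrMod L} (Y : Submodule ℂ L) {W : Submodule ℂ M.carrier} {r : ℕ}
    (hW : W ≤ M.deg r) (k : ℕ) : adPow Y W k ≤ M.deg (r + k) := by
  induction k with
  | zero => exact hW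
  | succ k ih => exact Submodule.map₂_le.2 fun y _ m hm => M.lie_inAd_mem _ y m (ih hm)

theorem lie_mem_adPow_top {M : GrMod L} {W : Submodule ℂ M.carrier}
    (hW : ∀ (x : L), ∀ w ∈ W, ⁅x, w⁆ ∈ W) (k : ℕ) (x : L) :
    ∀ w ∈ adPow ⊤ W k, ⁅x, w⁆ ∈ adPow ⊤ W k := by
  induction k with
  | zero => exact hW x
  | succ k ih =>
    have h : adPow ⊤ W (k + 1) ≤ (adPow ⊤ W (k + 1)).comap (LieModule.toEnd ℂ L M.carrier x) := by
      refine Submodule.map₂_le.2 fun y _ m hm => ?_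
      change ⁅x, ⁅(inAd y : SemiAd L), m⁆⁆ ∈ adPow ⊤ W (k + 1)
      rw [lie_inAd_lie]
      exact add_mem (inAd_lie_mem_adPow Submodule.mem_top hm) (inAd_lie_mem_adPow Submodule.mem_top (ih m hm))
    exact h

/-- A family of `𝔤`-stable subspaces shifted by `𝔤_ad` contains the graded pieces of `U p`. -/
theorem ueaAct_mem_of_lie_mem {M : GrMod L} {p : M.carrier} (G : ℕ → Submodule ℂ M.carrier)
    (hp : p ∈ G 0) (h0 : ∀ k, ∀ (x : L), ∀ m ∈ G k, ⁅x, m⁆ ∈ G k)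
    (h1 : ∀ k, ∀ (y : L), ∀ m ∈ G k, ⁅(inAd y : SemiAd L), m⁆ ∈ G (k + 1)) {j : ℕ} {c : UT L}
    (hc : c ∈ uDeg j) : ueaAct (SemiAd L) M.carrier c p ∈ G j := by
  induction hc using Submodule.span_induction with
  | mem c hc =>
    obtain ⟨l, rfl, rfl⟩ := hc
    induction l with
    | nil => simpa using hp
    | cons a l ih =>
      simp only [List.map_cons, List.prod_cons, ueaAct_mul, List.sum_cons]
      rcases a with x | y
      · rw [gen, ueaAct_ι, genDeg, zero_add]
        exact h0 _ _ _ ih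
      · rw [gen, ueaAct_ι, genDeg, add_comm 1]
        exact h1 _ _ _ ih
  | zero => simp
  | add c d _ _ hc hd => rw [map_add, LinearMap.add_apply]; exact add_mem hc hd
  | smul t c _ hc => rw [map_smul, LinearMap.smul_apply]; exact Submodule.smul_mem _ t hc

/-- The homogeneous pieces of a module generated by a finite-dimensional `𝔤`-submodule of one of
its pieces are finite-dimensional. -/
theorem inG2_of_gen [FiniteDimensional ℂ L] {M : GrMod L} {r : ℕ} {p : M.carrier}
    (hp : p ∈ M.deg r) (hgen : ∀ m, ∃ u, ueaAct (SemiAd L) M.carrier u p = m)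
    (W : Submodule ℂ M.carrier) (hpW : p ∈ W) (hW : W.FG)
    (hWL : ∀ (x : L), ∀ w ∈ W, ⁅x, w⁆ ∈ W) : InG2 M := by
  intro k
  have h : M.deg k ≤ adPow ⊤ W (k - r) := by
    intro m hm
    refine mem_of_mem_deg hp hgen _ ?_ hm
    rintro j c rfl hc
    rw [Nat.add_sub_cancel]
    exact ueaAct_mem_of_lie_mem (adPow ⊤ W) hpW (lie_mem_adPow_top hWL)
      (fun k y m hm => inAd_lie_mem_adPow Submodule.mem_top hm) hc
  have : FiniteDimensional ℂ (adPow (M := M) ⊤ W (k - r)) :=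
    Module.Finite.of_fg (adPow_fg ⊤ hW _)
  exact Submodule.finiteDimensional_of_le h

/-- Adding the relations `T p = 0` to the defining relations. -/
theorem IsPresentedBy.quotient {A M : Type u} [LieRing A] [LieAlgebra ℂ A] [AddCommGroup M]
    [Module ℂ M] [LieRingModule A M] [LieModule ℂ A M] {p : M}
    {S T : Set (UniversalEnvelopingAlgebra ℂ A)} (h : IsPresentedBy p S) {N : LieSubmodule ℂ A M}
    (hN : N = LieSubmodule.lieSpan ℂ A {m | ∃ s ∈ T, m = ueaAct A M s p}) :
    IsPresentedBy (LieSubmodule.Quotient.mk' N p) (S ∪ T) := by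
  refine ⟨fun m => ?_, fun u => ?_⟩
  · obtain ⟨m, rfl⟩ := LieSubmodule.Quotient.surjective_mk' N m
    obtain ⟨u, rfl⟩ := h.1 m
    exact ⟨u, (map_ueaAct _ u p).symm⟩
  · rw [← map_ueaAct, LieSubmodule.Quotient.mk_eq_zero]
    constructor
    · intro hu
      -- The vectors v p, with v in the left ideal of all the relations, form a submodule containing
      -- N. Hence u p = v p for such a v, and u - v lies in the ideal of S.
      let W : LieSubmodule ℂ A M :=
        { ((Submodule.span (UniversalEnvelopingAlgebra ℂ A) (S ∪ T)).restrictScalars ℂ).map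
            ((ueaAct A M).toLinearMap.flip p) with
          lie_mem := fun {a m} hm => by
            obtain ⟨v, hv, rfl⟩ := hm
            refine ⟨UniversalEnvelopingAlgebra.ι ℂ a * v, Submodule.smul_mem (Submodule.span _ (S ∪ T)) _ hv, ?_⟩
            change ueaAct A M (UniversalEnvelopingAlgebra.ι ℂ a * v) p = _
            rw [ueaAct_mul, ueaAct_ι]
            rfl }
      have hle : N ≤ W := by
        rw [hN, LieSubmodule.lieSpan_le]
        rintro _ ⟨s, hs, rfl⟩
        exact ⟨s, Submodule.subset_span (Or.inr hs), rfl⟩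
      obtain ⟨v, hv, hvu⟩ := hle hu
      have h1 : ueaAct A M (u - v) p = 0 := by
        rw [map_sub, LinearMap.sub_apply, sub_eq_zero]
        exact hvu.symm
      have h2 := Submodule.span_mono (Set.subset_union_left (t := T)) ((h.2 _).1 h1)
      have h3 := Submodule.add_mem _ h2 hv
      rwa [sub_add_cancel] at h3
    · intro hu
      rw [← LieSubmodule.Quotient.mk_eq_zero, map_ueaAct]
      refine ueaAct_eq_zero_of_mem_span ?_ hu
      intro s hs
      rw [← map_ueaAct]
      rcases hs with hs | hs
      · rw [(h.2 s).2 (Submodule.subset_span hs), map_zero]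
      · rw [LieSubmodule.Quotient.mk_eq_zero, hN]
        exact LieSubmodule.subset_lieSpan ⟨s, hs, rfl⟩

end Enveloping

end Graded

open LieAlgebra LieAlgebra.IsKilling Module

/-! ### The category 𝒢₂[Γ] and the truncation functor -/

section TruncatedCategory

open GrMod

variable {L : Type u} [LieRing L] [LieAlgebra ℂ L] [FiniteDimensional ℂ L]
  [LieAlgebra.IsKilling ℂ L] {H : LieSubalgebra ℂ L} [H.IsCartanSubalgebra]
  {b : (LieAlgebra.IsKilling.rootSystem H).Base} {Γ : Set (Lam b)}

theorem IsHW.coe {M : GrMod L} {k : ℕ} {nu : Dual ℂ H} {m : M.deg k} (h : IsHW b nu m) :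
    IsHW b nu (m : M.carrier) :=
  h.map (M.degIncl k) fun h0 => h.ne_zero (Subtype.ext h0)

theorem IsHW.of_coe {M : GrMod L} {k : ℕ} {nu : Dual ℂ H} {m : M.deg k}
    (h : IsHW b nu (m : M.carrier)) : IsHW b nu m :=
  IsHW.of_map (M.degIncl k) (M.degIncl_injective k) h

theorem mult_ne_zero_iff {M : GrMod L} (hM : InG2 M) (γ : Lam b) :
    mult M γ ≠ 0 ↔ ∃ m ∈ M.deg γ.2, IsHW b γ.1.1 m := by
  have := hM γ.2
  rw [mult, ← pos_iff_ne_zero, rank_pos_iff_exists_ne_zero, exists_hom_ne_zero_iff]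
  exact ⟨fun ⟨m, hm⟩ => ⟨m, m.2, hm.coe⟩, fun ⟨m, hm, h⟩ => ⟨⟨m, hm⟩, IsHW.of_coe h⟩⟩

theorem inG2Gamma_iff {M : GrMod L} : inG2Gamma Γ M ↔
    InG2 M ∧ ∀ γ : Lam b, ∀ m ∈ M.deg γ.2, IsHW b γ.1.1 m → γ ∈ Γ := by
  refine and_congr_right fun hM => forall_congr' fun γ => ?_
  rw [mult_ne_zero_iff hM]
  exact ⟨fun h m hm hm' => h ⟨m, hm, hm'⟩, fun h ⟨m, hm, hm'⟩ => h m hm hm'⟩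

theorem inG2Gamma.exists_mem {M : GrMod L} (hM : inG2Gamma Γ M) {k : ℕ} {nu : Dual ℂ H}
    {m : M.carrier} (hm : m ∈ M.deg k) (h : IsHW b nu m) :
    ∃ nu' : DomWt b, nu'.1 = nu ∧ (nu', k) ∈ Γ := by
  have := hM.1 k
  have h' : IsHW b nu (⟨m, hm⟩ : M.deg k) := IsHW.of_coe h
  exact ⟨h'.domWt, rfl, (inG2Gamma_iff.1 hM).2 (h'.domWt, k) m hm h⟩

theorem inG2Gamma.deg_eq_bot {M : GrMod L} (hM : inG2Gamma Γ M) {k : ℕ}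
    (hk : ∀ γ ∈ Γ, γ.2 ≠ k) : M.deg k = ⊥ := by
  have := hM.1 k
  by_contra hne
  have : Nontrivial (M.deg k) := Submodule.nontrivial_iff_ne_bot.2 hne
  obtain ⟨nu, w, hw⟩ := exists_isHW b (M := M.deg k)
  obtain ⟨nu', -, h⟩ := hM.exists_mem w.2 hw.coe
  exact hk _ h rfl

theorem inG2Gamma.finiteDimensional {M : GrMod L} (hM : inG2Gamma Γ M) (hΓ : Γ.Finite) :
    FiniteDimensional ℂ M.carrier := by
  have h : ⨆ k ∈ (hΓ.image Prod.snd).toFinset, M.deg k = ⊤ := by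
    rw [eq_top_iff, ← M.isInternal.submodule_iSup_eq_top]
    refine iSup_le fun k => ?_
    by_cases hk : ∃ γ ∈ Γ, γ.2 = k
    · exact le_iSup₂_of_le k (by simpa using hk) le_rfl
    · push Not at hk
      rw [hM.deg_eq_bot hk]
      exact bot_le
  refine ⟨?_⟩
  rw [← h]
  refine Submodule.fg_biSup _ _ fun k _ => ?_
  have := hM.1 k
  exact Module.Finite.iff_fg.1 this

theorem inG2Gamma.of_injective {M N : GrMod L} (hN : inG2Gamma Γ N) (f : Hom M N)
    (hf : Function.Injective f.toLieHom) : inG2Gamma Γ M := by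
  rw [inG2Gamma_iff]
  constructor
  · intro k
    have := hN.1 k
    refine FiniteDimensional.of_injective (f.degHom k : M.deg k →ₗ[ℂ] N.deg k) fun x y h => ?_
    exact Subtype.ext (hf (congrArg Subtype.val h))
  · intro γ m hm h
    refine (inG2Gamma_iff.1 hN).2 γ _ (f.map_deg _ m hm) (h.map (resHom f.toLieHom) fun h0 => ?_)
    exact h.ne_zero (hf (h0.trans (map_zero _).symm))

theorem InG2.quot {M : GrMod L} (hM : InG2 M) (N : M.GrSub) : InG2 (M.quot N) := fun k => by
  have := hM k
  exact (inferInstance : FiniteDimensional ℂ ((M.deg k).map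
    (LieSubmodule.Quotient.mk' N.toLie : M.carrier →ₗ[ℂ] M.carrier ⧸ N.toLie)))

theorem exists_isHW_lift {M N : GrMod L} (hM : InG2 M) (hN : InG2 N) (f : Hom M N) {k : ℕ}
    {nu : Dual ℂ H} {m : M.carrier} (hm : m ∈ M.deg k) (h : IsHW b nu (f.toLieHom m)) :
    ∃ m' ∈ M.deg k, IsHW b nu m' ∧ f.toLieHom m' = f.toLieHom m := by
  have := hM k
  have := hN k
  have h' : IsHW b nu (f.degHom k ⟨m, hm⟩) := IsHW.of_coe h
  obtain ⟨m', h1, h2⟩ := h'.exists_lift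
  exact ⟨m', m'.2, h1.coe, congrArg Subtype.val h2⟩

/-- A highest weight vector of the quotient lifts to one of M of the same weight and degree, so
quotients acquire no new highest weights. -/
theorem inG2Gamma.quot {M : GrMod L} (hM : inG2Gamma Γ M) (N : M.GrSub) :
    inG2Gamma Γ (M.quot N) := by
  rw [inG2Gamma_iff]
  refine ⟨InG2.quot hM.1 N, fun γ x hx h => ?_⟩
  obtain ⟨m, hm, rfl⟩ := M.exists_of_mem_deg_quot N hx
  obtain ⟨m', hm', h', -⟩ := exists_isHW_lift hM.1 (InG2.quot hM.1 N) (M.quotMk N) hm h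
  exact (inG2Gamma_iff.1 hM).2 γ m' hm' h'

theorem truncKer_le {M : GrMod L} {N : M.GrSub} (hN : inG2Gamma Γ (M.quot N)) :
    (truncKer M Γ).toLie ≤ N.toLie :=
  iInf_le (fun N : {N : M.GrSub // inG2Gamma Γ (M.quot N)} => N.1.toLie) ⟨N, hN⟩

/-- The quotient by the kernel embeds in X, so it is one of the quotients over which the
intersection is taken. This is the universal property of the truncation. -/
theorem truncKer_le_ker {M X : GrMod L} (hX : inG2Gamma Γ X) (f : Hom M X) :
    (truncKer M Γ).toLie ≤ f.toLieHom.ker := by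
  refine truncKer_le (N := f.ker) (hX.of_injective (quotLift f.ker f le_rfl) ?_)
  rw [injective_iff_map_eq_zero]
  intro x hx
  obtain ⟨m, rfl⟩ := M.quotMk_surjective f.ker x
  change f.toLieHom m = 0 at hx
  exact (M.quotMk_eq_zero f.ker).2 hx

/-- A highest weight vector of the quotient by the intersection stays nonzero, hence a highest
weight vector, in one of the quotients that lie in 𝒢₂[Γ]. -/
theorem inG2Gamma_trunc {M : GrMod L} (hM : InG2 M) (Γ : Set (Lam b)) :
    inG2Gamma Γ (trunc M Γ) := by
  rw [inG2Gamma_iff]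
  refine ⟨hM.quot _, fun γ x hx h => ?_⟩
  obtain ⟨m, hm, rfl⟩ := M.exists_of_mem_deg_quot _ hx
  have h0 : m ∉ (truncKer M Γ).toLie := fun h0 => h.ne_zero ((M.quotMk_eq_zero _).2 h0)
  change m ∉ ⨅ N : {N : M.GrSub // inG2Gamma Γ (M.quot N)}, N.1.toLie at h0
  rw [LieSubmodule.mem_iInf] at h0
  push Not at h0
  obtain ⟨⟨N, hN⟩, hmN⟩ := h0
  have hle : (truncKer M Γ).toLie ≤ (M.quotMk N).toLieHom.ker := fun m hm =>
    (M.quotMk_eq_zero N).2 (truncKer_le hN hm)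
  refine (inG2Gamma_iff.1 hN).2 γ _ ((M.quotMk N).map_deg _ m hm)
    (h.map (resHom (quotLift (truncKer M Γ) (M.quotMk N) hle).toLieHom) fun h0 => ?_)
  exact hmN ((M.quotMk_eq_zero N).1 h0)

/-- A morphism of `𝒢₂[Γ]` as a morphism of graded modules. -/
def grHom {X Y : G2Gamma Γ} (f : X ⟶ Y) : Hom X.obj Y.obj := f.hom

theorem grHom_comp {X Y Z : G2Gamma Γ} (f : X ⟶ Y) (g : Y ⟶ Z) (x : X.obj.carrier) :
    (grHom (f ≫ g)).toLieHom x = (grHom g).toLieHom ((grHom f).toLieHom x) := rfl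

theorem grHom_ext {X Y : G2Gamma Γ} {f g : X ⟶ Y}
    (h : ∀ x, (grHom f).toLieHom x = (grHom g).toLieHom x) : f = g :=
  InducedCategory.Hom.ext (GrMod.Hom.ext (LieModuleHom.ext h))

/-- The cokernel is again in 𝒢₂[Γ], and the projection onto it agrees with zero after composition
with the epimorphism. -/
theorem surjective_of_epi {X Y : G2Gamma Γ} (f : X ⟶ Y) [Epi f] :
    Function.Surjective (grHom f).toLieHom := by
  let C : G2Gamma Γ := ⟨Y.obj.quot (grHom f).range, inG2Gamma.quot Y.property _⟩
  let q : Y ⟶ C := ObjectProperty.homMk (Y.obj.quotMk (grHom f).range)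
  let z : Y ⟶ C := ObjectProperty.homMk (0 : Hom Y.obj (Y.obj.quot (grHom f).range))
  have h : q = z := by
    rw [← cancel_epi f]
    refine grHom_ext fun x => ?_
    rw [grHom_comp, grHom_comp]
    exact (Y.obj.quotMk_eq_zero _).2 ((LieModuleHom.mem_range _ _).2 ⟨x, rfl⟩)
  intro y
  have h1 : (grHom q).toLieHom y = (grHom z).toLieHom y := by rw [h]
  exact (LieModuleHom.mem_range _ _).1 ((Y.obj.quotMk_eq_zero (grHom f).range).1 h1)

theorem epi_of_surjective {X Y : G2Gamma Γ} (f : X ⟶ Y)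
    (hf : Function.Surjective (grHom f).toLieHom) : Epi f := by
  refine ⟨fun {Z} g h hgh => grHom_ext fun y => ?_⟩
  obtain ⟨x, rfl⟩ := hf y
  rw [← grHom_comp, hgh, grHom_comp]

end TruncatedCategory

/-! ### The induced modules P(μ, r) -/

section Induced

open GrMod

variable {L : Type u} [LieRing L] [LieAlgebra ℂ L] [FiniteDimensional ℂ L]
  [LieAlgebra.IsKilling ℂ L] {H : LieSubalgebra ℂ L} [H.IsCartanSubalgebra]
  {b : (LieAlgebra.IsKilling.rootSystem H).Base}

theorem Ind.mk_uIncl {V : Type u} [AddCommGroup V] [Module ℂ V] [Module (UG L) V] (c : UT L)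
    (a : UG L) (v : V) :
    (Ind.mk ((c * uIncl L a) ⊗ₜ[ℂ] v) : Ind (L := L) V) = Ind.mk (c ⊗ₜ[ℂ] (a • v)) :=
  (Submodule.Quotient.eq _).2 (Submodule.subset_span ⟨c, a, v, rfl⟩)

/-- The quotient map onto `P(μ, r)`. -/
def pMk (γ : Lam b) : UT L ⊗[ℂ] Irr b γ.1 →ₗ[ℂ] (P γ).carrier :=
  (Ind.mk (L := L) (V := Irr b γ.1)).restrictScalars ℂ

theorem pMk_surjective (γ : Lam b) : Function.Surjective (pMk γ) :=
  Ind.mk_surjective (L := L) (V := Irr b γ.1)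

theorem pMk_eq_zero (γ : Lam b) {w : UT L ⊗[ℂ] Irr b γ.1} :
    pMk γ w = 0 ↔ w ∈ Submodule.span (UT L) (balRel (L := L) (Irr b γ.1)) :=
  Submodule.Quotient.mk_eq_zero _

theorem pMk_uIncl (γ : Lam b) (c : UT L) (a : UG L) (v : Irr b γ.1) :
    pMk γ ((c * uIncl L a) ⊗ₜ[ℂ] v) = pMk γ (c ⊗ₜ[ℂ] ueaAct L (Irr b γ.1) a v) := by
  rw [ueaAct_irr]
  exact Ind.mk_uIncl c a v

theorem ueaAct_pMk (γ : Lam b) (u c : UT L) (v : Irr b γ.1) :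
    ueaAct (SemiAd L) (P γ).carrier u (pMk γ (c ⊗ₜ[ℂ] v)) = pMk γ ((u * c) ⊗ₜ[ℂ] v) := by
  refine (ueaAct_ofUEA (SemiAd L) (Ind (L := L) (Irr b γ.1)) u _).trans ?_
  exact ((Ind.mk (L := L) (V := Irr b γ.1)).map_smul u (c ⊗ₜ[ℂ] v)).symm

theorem ueaAct_pGen (γ : Lam b) (u : UT L) :
    ueaAct (SemiAd L) (P γ).carrier u (pGen γ) = pMk γ (u ⊗ₜ[ℂ] irrGen b γ.1) := by
  have := ueaAct_pMk γ u 1 (irrGen b γ.1)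
  rwa [mul_one] at this

theorem pGen_mem_deg (γ : Lam b) : pGen γ ∈ (P γ).deg γ.2 := by
  change pGen γ ∈ indDeg (L := L) (Irr b γ.1) γ.2 γ.2
  exact Submodule.subset_span ⟨0, 1, irrGen b γ.1, zero_add _, Submodule.subset_span ⟨[], rfl, rfl⟩, rfl⟩

theorem exists_ueaAct_pGen (γ : Lam b) (m : (P γ).carrier) :
    ∃ u, ueaAct (SemiAd L) (P γ).carrier u (pGen γ) = m := by
  obtain ⟨w, rfl⟩ := pMk_surjective γ m
  induction w using TensorProduct.induction_on with
  | zero => exact ⟨0, by simp⟩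
  | add x y hx hy =>
    obtain ⟨u, hu⟩ := hx
    obtain ⟨v, hv⟩ := hy
    exact ⟨u + v, by rw [map_add, LinearMap.add_apply, hu, hv, map_add]⟩
  | tmul c v =>
    obtain ⟨a, rfl⟩ := (isPresentedBy_irrGen γ.1).1 v
    exact ⟨c * uIncl L a, by rw [ueaAct_pGen, pMk_uIncl]⟩

theorem ueaAct_uIncl_pGen (γ : Lam b) {a : UG L} (ha : ueaAct L (Irr b γ.1) a (irrGen b γ.1) = 0) :
    ueaAct (SemiAd L) (P γ).carrier (uIncl L a) (pGen γ) = 0 := by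
  rw [ueaAct_pGen, ← one_mul (uIncl L a), pMk_uIncl, ha, TensorProduct.tmul_zero, map_zero]

theorem nPlus_irrGen (mu : DomWt b) {x : L} (hx : x ∈ nPlus b) : ⁅x, irrGen b mu⁆ = 0 := by
  by_cases h0 : irrGen b mu = 0
  · rw [h0, lie_zero]
  · exact (isHW_irrGen h0).lie_nPlus hx

theorem uIncl_mem_span_hwRel (mu : DomWt b) {a : UG L} (ha : a ∈ Submodule.span (UG L) (irrRel b mu)) :
    uIncl L a ∈ Submodule.span (UT L) (hwRel mu) := by
  induction ha using Submodule.span_induction with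
  | mem a ha =>
    refine Submodule.subset_span ?_
    rcases ha with (⟨h, rfl⟩ | ⟨i, hi, x, hx, rfl⟩) | ⟨i, hi, x, hx, n, hn, rfl⟩
    · refine Or.inl (Or.inr ⟨h, ?_⟩)
      rw [map_sub, uIncl_ι, AlgHom.commutes, gen]
    · exact Or.inl (Or.inl ⟨x, Submodule.mem_iSup_of_mem
        (⟨i, RootPairing.Base.isPos_of_mem_support hi⟩ : {α : H.root // b.IsPos α}) hx, uIncl_ι x⟩)
    · exact Or.inr ⟨i, hi, x, hx, n, hn, by rw [map_pow, uIncl_ι, gen]⟩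
  | zero => simp
  | add a a' _ _ ha ha' => rw [map_add]; exact add_mem ha ha'
  | smul c a _ ha => rw [smul_eq_mul, map_mul]; exact Submodule.smul_mem _ _ ha

/-- To see that there are no further relations, v_μ ↦ 1 defines a 𝔤-map from V(μ) to the quotient of
U(𝔤 ⋉ 𝔤_ad) by the left ideal of the relations. It induces a map on P(μ, r) that sends u p to the
class of u. -/
theorem isPresentedBy_pGen (γ : Lam b) : IsPresentedBy (pGen γ) (hwRel γ.1) := by
  refine ⟨exists_ueaAct_pGen γ, fun u => ⟨fun hu => ?_, fun hu => ?_⟩⟩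
  · let Q := UT L ⧸ Submodule.span (UT L) (hwRel γ.1)
    let φ : Irr b γ.1 →ₗ[ℂ] Q :=
      ((Submodule.span (UG L) (irrRel b γ.1)).restrictScalars ℂ).liftQ
        (((Submodule.span (UT L) (hwRel γ.1)).mkQ.restrictScalars ℂ) ∘ₗ (uIncl L).toLinearMap)
        (fun a ha => (Submodule.Quotient.mk_eq_zero _).2 (uIncl_mem_span_hwRel γ.1 ha))
    have hφ : ∀ (a : UG L) (v : Irr b γ.1), φ (a • v) = uIncl L a • φ v := by
      intro a v
      obtain ⟨a', rfl⟩ := Submodule.mkQ_surjective (Submodule.span (UG L) (irrRel b γ.1)) v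
      change Submodule.Quotient.mk (uIncl L (a * a')) = uIncl L a • Submodule.Quotient.mk (uIncl L a')
      rw [map_mul]
      rfl
    let F : UT L ⊗[ℂ] Irr b γ.1 →ₗ[UT L] Q :=
      TensorProduct.AlgebraTensorModule.lift (LinearMap.toSpanSingleton (UT L) (Irr b γ.1 →ₗ[ℂ] Q) φ)
    have hF : ∀ (c : UT L) (v : Irr b γ.1), F (c ⊗ₜ[ℂ] v) = c • φ v := fun c v => rfl
    have hker : Submodule.span (UT L) (balRel (L := L) (Irr b γ.1)) ≤ LinearMap.ker F := by
      rw [Submodule.span_le]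
      rintro _ ⟨c, a, v, rfl⟩
      rw [SetLike.mem_coe, LinearMap.mem_ker, map_sub, hF, hF, hφ, mul_smul, sub_self]
    rw [ueaAct_pGen, pMk_eq_zero] at hu
    have h1 := hker hu
    rw [LinearMap.mem_ker, hF] at h1
    have h2 : φ (irrGen b γ.1) = Submodule.Quotient.mk 1 := by
      change Submodule.Quotient.mk (uIncl L 1) = _
      rw [map_one]
    rw [h2, ← Submodule.Quotient.mk_smul, smul_eq_mul, mul_one] at h1
    exact (Submodule.Quotient.mk_eq_zero _).1 h1
  · refine ueaAct_eq_zero_of_mem_span ?_ hu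
    rintro s ((⟨x, hx, rfl⟩ | ⟨h, rfl⟩) | ⟨i, hi, x, hx, n, hn, rfl⟩)
    · have := ueaAct_uIncl_pGen γ (a := UniversalEnvelopingAlgebra.ι ℂ x)
        (by rw [ueaAct_ι, nPlus_irrGen γ.1 hx])
      rwa [uIncl_ι] at this
    · have := ueaAct_uIncl_pGen γ (irrGen_relations γ.1 (Or.inl (Or.inl ⟨h, rfl⟩)))
      rwa [map_sub, uIncl_ι, AlgHom.commutes] at this
    · have := ueaAct_uIncl_pGen γ (irrGen_relations γ.1 (Or.inr ⟨i, hi, x, hx, n, hn, rfl⟩))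
      rwa [map_pow, uIncl_ι] at this

/-- The generator lies in 1 ⊗ V(μ), which is 𝔤-stable and finite-dimensional, and each degree is
reached by applying 𝔤_ad to it a fixed number of times. -/
theorem inG2_P (γ : Lam b) : InG2 (P γ) := by
  let j : Irr b γ.1 →ₗ[ℂ] (P γ).carrier := pMk γ ∘ₗ TensorProduct.mk ℂ (UT L) (Irr b γ.1) 1
  refine inG2_of_gen (pGen_mem_deg γ) (exists_ueaAct_pGen γ) (LinearMap.range j)
    ⟨irrGen b γ.1, rfl⟩ ?_ ?_
  · rw [LinearMap.range_eq_map]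
    exact Submodule.FG.map _ Module.Finite.fg_top
  · rintro x _ ⟨v, rfl⟩
    refine ⟨⁅x, v⁆, ?_⟩
    have h1 := ueaAct_pMk γ (gen (.inl x)) 1 v
    have h2 := pMk_uIncl γ 1 (UniversalEnvelopingAlgebra.ι ℂ x) v
    rw [mul_one, gen, ueaAct_ι] at h1
    rw [one_mul, uIncl_ι, ueaAct_ι, gen] at h2
    exact (h1.trans h2).symm

/-- A highest weight vector satisfies the defining relations of `P(μ, r)`. -/
theorem IsHW.hwRel_eq_zero {M : GrMod L} (hM : InG2 M) {k : ℕ} {mu : DomWt b} {m : M.carrier}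
    (hm : m ∈ M.deg k) (h : IsHW b mu.1 m) {s : UT L} (hs : s ∈ hwRel mu) :
    ueaAct (SemiAd L) M.carrier s m = 0 := by
  have := hM k
  rcases hs with (⟨x, hx, rfl⟩ | ⟨y, rfl⟩) | ⟨i, hi, x, hx, n, hn, rfl⟩
  · rw [ueaAct_ι]
    exact h.lie_nPlus hx
  · rw [map_sub, LinearMap.sub_apply, ueaAct_ι, ueaAct_algebraMap, sub_eq_zero]
    exact GradedAdjoint.mem_wtSpace.1 h.mem_wtSpace y
  · have h' : IsHW b mu.1 (⟨m, hm⟩ : M.deg k) := IsHW.of_coe h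
    have h1 := h'.pow_toEnd_eq_zero (RootPairing.Base.isPos_of_mem_support hi) hx hn
    have h2 : ueaAct L M.carrier (UniversalEnvelopingAlgebra.ι ℂ x ^ (n + 1)) m = 0 := by
      have h3 := map_ueaAct (M.degIncl k) (UniversalEnvelopingAlgebra.ι ℂ x ^ (n + 1)) ⟨m, hm⟩
      rw [ueaAct_ι_pow, h1, map_zero] at h3
      exact h3.symm
    rw [← ueaAct_uIncl, map_pow, uIncl_ι] at h2
    exact h2

theorem isHW_of_hwRel {M : GrMod L} {mu : DomWt b} {m : M.carrier} (h0 : m ≠ 0)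
    (h : ∀ s ∈ hwRel mu, ueaAct (SemiAd L) M.carrier s m = 0) : IsHW b mu.1 m where
  ne_zero := h0
  mem_wtSpace := by
    rw [GradedAdjoint.mem_wtSpace]
    intro y
    have := h _ (Or.inl (Or.inr ⟨y, rfl⟩))
    rwa [map_sub, LinearMap.sub_apply, ueaAct_ι, ueaAct_algebraMap, sub_eq_zero] at this
  lie_eq_zero α hα x hx := by
    have := h _ (Or.inl (Or.inl ⟨x, Submodule.mem_iSup_of_mem
      (⟨α, hα⟩ : {α : H.root // b.IsPos α}) hx, rfl⟩))
    rwa [ueaAct_ι] at this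

theorem exists_hom_pGen {M : GrMod L} (γ : Lam b) {m : M.carrier} (hm : m ∈ M.deg γ.2)
    (h : ∀ s ∈ hwRel γ.1, ueaAct (SemiAd L) M.carrier s m = 0) :
    ∃ f : Hom (P γ) M, f.toLieHom (pGen γ) = m := by
  obtain ⟨f, hf⟩ := (isPresentedBy_pGen γ).exists_hom h
  exact ⟨homOfGen (pGen_mem_deg γ) (exists_ueaAct_pGen γ) f (hf ▸ hm), hf⟩

end Induced

open LieAlgebra LieAlgebra.IsKilling Module

/-! ### The defining relations of P(μ, r)^Γ -/

section Relations

open GrMod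

variable {L : Type u} [LieRing L] [LieAlgebra ℂ L] [FiniteDimensional ℂ L]
  [LieAlgebra.IsKilling ℂ L] {H : LieSubalgebra ℂ L} [H.IsCartanSubalgebra]
  {b : (LieAlgebra.IsKilling.rootSystem H).Base} {X : GrMod L}

theorem inAd_lie_mem_wtSpace {ω ε : Dual ℂ H} {m : X.carrier} (hm : m ∈ wtSpace X.carrier ω) {y : L}
    (hy : ∀ h : H, ⁅(h : L), y⁆ = ε h • y) :
    ⁅(inAd y : SemiAd L), m⁆ ∈ wtSpace X.carrier (ω + ε) := by
  rw [mem_wtSpace] at hm ⊢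
  intro h
  rw [lie_inAd_lie, hm, hy, map_smul, smul_lie, lie_smul, ← add_smul, add_comm (ε h)]
  rfl

/-- In a module in `𝒢₂[Γ(λ, Ψ)]`, an element `p` of weight `μ` and degree `r`, `(μ, r) ∈ Γ(λ, Ψ)`,
is killed by the elements of `𝔤_ad` whose weight pairs with `ξ` to more than the minimum. -/
theorem inAd_lie_eq_zero_of_lt {lam ξ : DomWt b} {Ψ : Set H.root} {C : ℝ}
    (hC : IsMaximizing ξ.1 Ψ C) (hX : inG2Gamma (GammaSet lam Ψ) X) {γ : Lam b}
    (hγ : γ ∈ GammaSet lam Ψ) {p : X.carrier} (hp : p ∈ X.deg γ.2)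
    (hwt : p ∈ wtSpace X.carrier γ.1.1) {ε : Dual ℂ H} {y : L}
    (hy : ∀ h : H, ⁅(h : L), y⁆ = ε h • y) (hε : -C < ip ε ξ.1) :
    ⁅(inAd y : SemiAd L), p⁆ = 0 := by
  by_contra h0
  have hd := X.lie_inAd_mem _ y p hp
  have hw := inAd_lie_mem_wtSpace hwt hy
  have := hX.1 (γ.2 + 1)
  let w : X.deg (γ.2 + 1) := ⟨_, hd⟩
  have hw' : w ∈ wtSpace (X.deg (γ.2 + 1)) (γ.1.1 + ε) :=
    mem_wtSpace.2 fun h => Subtype.ext (mem_wtSpace.1 hw h)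
  -- A highest weight vector of weight μ + ε + δ in degree r + 1 must give an element of Γ. Its
  -- potential exceeds that of (μ, r) by (ε, ξ) + (δ, ξ) + C > 0, whereas the potential is constant
  -- on Γ.
  obtain ⟨δ, hδ, v, -, hv⟩ := exists_isHW_of_mem (b := b) ⊤ (fun _ _ _ _ _ _ => Submodule.mem_top)
    hw' (fun h => h0 (congrArg Subtype.val h)) Submodule.mem_top
  obtain ⟨nu, hnu, hmem⟩ := hX.exists_mem v.2 hv.coe
  have h1 := IsLowering.ip_eq hC hmem
  have h2 := IsLowering.ip_eq hC hγ
  have h3 := ip_nonneg_of_mem_posCone hδ ξ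
  change ip nu.1 ξ.1 = _ - ((γ.2 + 1 : ℕ) : ℝ) * C at h1
  rw [hnu, ip_add_left, ip_add_left] at h1
  push_cast at h1
  linarith

/-- The weights involved are the positive roots, 0, and -α for α ∉ Ψ. They pair with ξ to a value
that is respectively ≥ 0, equal to 0, and > -C. -/
theorem adRel_eq_zero {lam ξ : DomWt b} {Ψ : Set H.root} {C : ℝ}
    (hC : IsMaximizing ξ.1 Ψ C) (hX : inG2Gamma (GammaSet lam Ψ) X) {γ : Lam b}
    (hγ : γ ∈ GammaSet lam Ψ) {p : X.carrier} (hp : p ∈ X.deg γ.2)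
    (hwt : p ∈ wtSpace X.carrier γ.1.1) {s : UT L} (hs : s ∈ adRel b Ψ) :
    ueaAct (SemiAd L) X.carrier s p = 0 := by
  have hC0 := hC.pos
  rcases hs with (⟨x, hx, rfl⟩ | ⟨h, rfl⟩) | ⟨α, hα, hαΨ, x, hx, rfl⟩
  · rw [ueaAct_ι]
    have h1 : nPlus b ≤ LinearMap.ker ((adAct X).flip p) := by
      refine iSup_le fun α x hx => ?_
      refine inAd_lie_eq_zero_of_lt hC hX hγ hp hwt (fun h => lie_of_mem_rsp hx h) ?_
      have := ip_nonneg_of_mem_posCone (rt_mem_posCone α.2) ξ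
      linarith
    exact h1 hx
  · rw [ueaAct_ι]
    refine inAd_lie_eq_zero_of_lt hC hX hγ hp hwt (ε := 0) (fun h' => ?_) ?_
    · have : ⁅h', h⁆ = 0 := trivial_lie_zero H H h' h
      rw [LinearMap.zero_apply, zero_smul, ← LieSubalgebra.coe_bracket, this]
      rfl
    · rw [ip_zero_left]
      linarith
  · rw [ueaAct_ι]
    refine inAd_lie_eq_zero_of_lt hC hX hγ hp hwt (ε := rt (negRt α))
      (fun h => lie_of_mem_rsp (α := negRt α) hx h) ?_
    have := hC.lt hαΨ
    rw [rt_negRt, ip_neg_left]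
    linarith

theorem inAd_lie_eq_zero_of_mem_adPow {Y : Submodule ℂ L} {W : Submodule ℂ X.carrier} {x : L}
    (h : ∀ w ∈ W, ⁅(inAd x : SemiAd L), w⁆ = 0) (k : ℕ) :
    ∀ z ∈ adPow Y W k, ⁅(inAd x : SemiAd L), z⁆ = 0 := by
  induction k with
  | zero => exact h
  | succ k ih =>
    have hle : adPow Y W (k + 1) ≤ LinearMap.ker (adAct X x) := by
      refine Submodule.map₂_le.2 fun y _ m hm => ?_
      rw [LinearMap.mem_ker, adAct_apply, adAct_apply, inAd_lie_comm, ih m hm, lie_zero]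
    exact hle

/-- The sum of the root spaces `𝔤_{-β}`, `β ∈ Ψ`. -/
def lowering (Ψ : Set H.root) : Submodule ℂ L := ⨆ β ∈ Ψ, rspNeg β

theorem rspNeg_le_lowering {Ψ : Set H.root} {β : H.root} (hβ : β ∈ Ψ) : rspNeg β ≤ lowering Ψ :=
  le_iSup₂_of_le β hβ le_rfl

section Generated

variable {Ψ : Set H.root} {r : ℕ} {mu : Dual ℂ H} {p : X.carrier}

/-- Elements of 𝔤_ad commute, so whatever kills p kills every product applied to p. By the relations
only the (𝔤_{-β})_ad with β ∈ Ψ are left, and they map Z_k to Z_{k+1} by construction. -/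
theorem inAd_lie_mem_adPow_lowering (had : ∀ s ∈ adRel b Ψ, ueaAct (SemiAd L) X.carrier s p = 0)
    {k : ℕ} {z : X.carrier} (hz : z ∈ adPow (lowering Ψ) (Submodule.span ℂ {p}) k) (x : L) :
    ⁅(inAd x : SemiAd L), z⁆ ∈ adPow (lowering Ψ) (Submodule.span ℂ {p}) (k + 1) := by
  have hbad : ∀ x : L, ⁅(inAd x : SemiAd L), p⁆ = 0 → ⁅(inAd x : SemiAd L), z⁆ ∈
      adPow (lowering Ψ) (Submodule.span ℂ {p}) (k + 1) := by
    intro x hx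
    rw [inAd_lie_eq_zero_of_mem_adPow (fun w hw => ?_) k z hz]
    · exact zero_mem _
    · obtain ⟨t, rfl⟩ := Submodule.mem_span_singleton.1 hw
      rw [lie_smul, hx, smul_zero]
  have htop := eq_top_of_cartan_of_rsp (H := H)
    ((adPow (lowering Ψ) (Submodule.span ℂ {p}) (k + 1)).comap ((adAct X).flip z)) ?_ ?_
  · exact (htop ▸ Submodule.mem_top : x ∈ _)
  · intro h
    refine hbad h ?_
    have := had _ (Or.inl (Or.inr ⟨h, rfl⟩))
    rwa [ueaAct_ι] at this
  · intro α x hx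
    rcases isPos_or_isPos_negRt b α with hα | hα
    · refine hbad x ?_
      have := had _ (Or.inl (Or.inl ⟨x, Submodule.mem_iSup_of_mem
        (⟨α, hα⟩ : {α : H.root // b.IsPos α}) hx, rfl⟩))
      rwa [ueaAct_ι] at this
    · have hx' : x ∈ rspNeg (negRt α) := by rwa [rspNeg_negRt]
      by_cases hΨ : negRt α ∈ Ψ
      · exact inAd_lie_mem_adPow (rspNeg_le_lowering hΨ hx') hz
      · refine hbad x ?_
        have := had _ (Or.inr ⟨negRt α, hα, hΨ, x, hx', rfl⟩)
        rwa [ueaAct_ι] at this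

/-- Moving x past (y)_ad creates ([x, y])_ad, which maps Z_k to Z_{k+1} whatever [x, y] is. With x ∈
𝔫⁺ this makes Z_k an 𝔫⁺-stable space. -/
theorem lie_mem_adPow_lowering (had : ∀ s ∈ adRel b Ψ, ueaAct (SemiAd L) X.carrier s p = 0) {x : L}
    (hx : ⁅x, p⁆ = 0) (k : ℕ) : ∀ z ∈ adPow (lowering Ψ) (Submodule.span ℂ {p}) k,
      ⁅x, z⁆ ∈ adPow (lowering Ψ) (Submodule.span ℂ {p}) k := by
  induction k with
  | zero =>
    intro z hz
    obtain ⟨t, rfl⟩ := Submodule.mem_span_singleton.1 hz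
    rw [lie_smul, hx, smul_zero]
    exact zero_mem _
  | succ k ih =>
    have hle : adPow (lowering Ψ) (Submodule.span ℂ {p}) (k + 1) ≤
        (adPow (lowering Ψ) (Submodule.span ℂ {p}) (k + 1)).comap
          (LieModule.toEnd ℂ L X.carrier x) := by
      refine Submodule.map₂_le.2 fun y _ m hm => ?_
      change ⁅x, ⁅(inAd y : SemiAd L), m⁆⁆ ∈ adPow (lowering Ψ) (Submodule.span ℂ {p}) (k + 1)
      rw [lie_inAd_lie]
      exact add_mem (inAd_lie_mem_adPow_lowering had hm _)
        (inAd_lie_mem_adPow_lowering had (ih m hm) _)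
    exact hle

theorem adPow_lowering_le_span {lam : Dual ℂ H} (hmu : IsLowering lam Ψ mu r)
    (hwt : p ∈ wtSpace X.carrier mu) (k : ℕ) :
    adPow (lowering Ψ) (Submodule.span ℂ {p}) k ≤ Submodule.span ℂ
      {z | z ∈ adPow (lowering Ψ) (Submodule.span ℂ {p}) k ∧
        ∃ ω ∈ {ω | IsLowering lam Ψ ω (r + k)}, z ∈ wtSpace X.carrier ω} := by
  induction k with
  | zero =>
    refine Submodule.span_le.2 ?_
    rintro _ rfl
    exact Submodule.subset_span ⟨Submodule.mem_span_singleton_self _, mu, hmu, hwt⟩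
  | succ k ih =>
    refine Submodule.map₂_le.2 fun y hy m hm => ?_
    set T := Submodule.span ℂ {z | z ∈ adPow (lowering Ψ) (Submodule.span ℂ {p}) (k + 1) ∧
        ∃ ω ∈ {ω | IsLowering lam Ψ ω (r + (k + 1))}, z ∈ wtSpace X.carrier ω} with hT
    have h1 : lowering Ψ ≤ T.comap ((adAct X).flip m) := by
      refine iSup₂_le fun β hβ y hy => ?_
      have h2 : adPow (lowering Ψ) (Submodule.span ℂ {p}) k ≤ T.comap (adAct X y) := by
        refine ih.trans (Submodule.span_le.2 ?_)
        rintro z ⟨hz, ω, hω, hzω⟩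
        refine Submodule.subset_span ⟨inAd_lie_mem_adPow (rspNeg_le_lowering hβ hy) hz, ω - rt β,
          IsLowering.sub_rt hω hβ, ?_⟩
        rw [sub_eq_add_neg, ← rt_negRt]
        exact inAd_lie_mem_wtSpace hzω fun h => lie_of_mem_rsp (α := negRt β) hy h
      exact h2 hm
    exact h1 hy

/-- Let G_k be the 𝔤-submodule generated by Z_k. The identity (y)_ad x m = x (y)_ad m - ([x, y])_ad
m shows that the vectors sent into G_{k+1} by all of 𝔤_ad form a 𝔤-submodule. It contains Z_k, so
𝔤_ad maps G_k into G_{k+1}. -/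
theorem deg_le_lieSpan_adPow (hp : p ∈ X.deg r)
    (hgen : ∀ m, ∃ u, ueaAct (SemiAd L) X.carrier u p = m)
    (had : ∀ s ∈ adRel b Ψ, ueaAct (SemiAd L) X.carrier s p = 0) (k : ℕ) :
    X.deg (r + k) ≤ (LieSubmodule.lieSpan ℂ L
      (adPow (lowering Ψ) (Submodule.span ℂ {p}) k : Set X.carrier)).toSubmodule := by
  intro m hm
  refine mem_of_mem_deg hp hgen _ ?_ hm
  intro j c hj hc
  obtain rfl : j = k := by omega
  refine ueaAct_mem_of_lie_mem (fun k => (LieSubmodule.lieSpan ℂ L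
      (adPow (lowering Ψ) (Submodule.span ℂ {p}) k : Set X.carrier)).toSubmodule) ?_ ?_ ?_ hc
  · exact LieSubmodule.subset_lieSpan (Submodule.mem_span_singleton_self p)
  · exact fun k x m hm => LieSubmodule.lie_mem _ hm
  · intro k y m hm
    let G := LieSubmodule.lieSpan ℂ L
      (adPow (lowering Ψ) (Submodule.span ℂ {p}) (k + 1) : Set X.carrier)
    let T : LieSubmodule ℂ L X.carrier :=
      { (⨅ y, G.toSubmodule.comap (adAct X y) : Submodule ℂ X.carrier) with
        lie_mem := fun {x m} hm => by
          have hm' := (Submodule.mem_iInf _).1 hm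
          refine (Submodule.mem_iInf _).2 fun y => ?_
          change ⁅(inAd y : SemiAd L), ⁅x, m⁆⁆ ∈ G
          have h1 := lie_inAd_lie (M := X) x y m
          rw [← sub_eq_iff_eq_add'] at h1
          rw [← h1]
          exact sub_mem (LieSubmodule.lie_mem _ (hm' y)) (hm' ⁅x, y⁆) }
    have h : LieSubmodule.lieSpan ℂ L
        (adPow (lowering Ψ) (Submodule.span ℂ {p}) k : Set X.carrier) ≤ T :=
      LieSubmodule.lieSpan_le.2 fun z hz => (Submodule.mem_iInf _).2 fun y =>
        LieSubmodule.subset_lieSpan (inAd_lie_mem_adPow_lowering had hz y)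
    exact (Submodule.mem_iInf _).1 (h hm) y

theorem deg_eq_bot_of_lt (hp : p ∈ X.deg r)
    (hgen : ∀ m, ∃ u, ueaAct (SemiAd L) X.carrier u p = m) {k : ℕ} (hk : k < r) :
    X.deg k = ⊥ := by
  rw [eq_bot_iff]
  intro m hm
  exact mem_of_mem_deg hp hgen _ (fun j c hj _ => by omega) hm

/-- A module generated by an element `p` which satisfies the relations is in `𝒢₂[Γ(λ, Ψ)]`. -/
theorem inG2Gamma_of_relations (hX : InG2 X) {lam : DomWt b} {γ : Lam b}
    (hγ : γ ∈ GammaSet lam Ψ) (hp : p ∈ X.deg γ.2)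
    (hgen : ∀ m, ∃ u, ueaAct (SemiAd L) X.carrier u p = m)
    (hhw : ∀ s ∈ hwRel γ.1, ueaAct (SemiAd L) X.carrier s p = 0)
    (had : ∀ s ∈ adRel b Ψ, ueaAct (SemiAd L) X.carrier s p = 0) :
    inG2Gamma (GammaSet lam Ψ) X := by
  rw [inG2Gamma_iff]
  refine ⟨hX, ?_⟩
  rintro ⟨nu, s⟩ m hm hHW
  change m ∈ X.deg s at hm
  have hp0 : p ≠ 0 := by
    rintro rfl
    obtain ⟨u, hu⟩ := hgen m
    exact hHW.ne_zero (by rw [← hu, map_zero])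
  have hpHW := isHW_of_hwRel hp0 hhw
  have hs : γ.2 ≤ s := by
    by_contra hlt
    rw [deg_eq_bot_of_lt hp hgen (not_le.1 hlt)] at hm
    exact hHW.ne_zero hm
  obtain ⟨k, rfl⟩ := Nat.exists_eq_add_of_le hs
  set Z := adPow (lowering Ψ) (Submodule.span ℂ {p}) k with hZdef
  have hZdeg : Z ≤ X.deg (γ.2 + k) :=
    adPow_le_deg _ (Submodule.span_le.2 (Set.singleton_subset_iff.2 hp)) k
  have := hX (γ.2 + k)
  let Z' : Submodule ℂ (X.deg (γ.2 + k)) := Z.comap (X.deg (γ.2 + k)).subtype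
  -- The remaining goals are that Z_k, viewed in its finite-dimensional graded piece, is 𝔫⁺-stable,
  -- is spanned by vectors of the allowed weights, and generates the piece over 𝔤.
  refine IsHW.mem_of_lieSpan_eq_top _ le_rfl {ω | IsLowering lam.1 Ψ ω (γ.2 + k)} Z' ?_ ?_ ?_
    (IsHW.of_coe (m := ⟨m, hm⟩) hHW)
  · intro α hα x hx z hz
    exact lie_mem_adPow_lowering had (hpHW.lie_eq_zero α hα x hx) k _ hz
  · intro z hz
    have h1 := adPow_lowering_le_span hγ hpHW.mem_wtSpace k hz
    have h2 : (z : X.carrier) ∈ (Submodule.span ℂ {z | z ∈ Z' ∧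
        ∃ ω ∈ {ω | IsLowering lam.1 Ψ ω (γ.2 + k)}, z ∈ wtSpace (X.deg (γ.2 + k)) ω}).map
          (X.deg (γ.2 + k)).subtype := by
      refine Submodule.span_le.2 ?_ h1
      rintro w ⟨hw, ω, hω, hwω⟩
      exact ⟨⟨w, hZdeg hw⟩, Submodule.subset_span ⟨hw, ω, hω,
        mem_wtSpace.2 fun h => Subtype.ext (mem_wtSpace.1 hwω h)⟩, rfl⟩
    obtain ⟨w, hw, hwz⟩ := h2
    rwa [← Subtype.ext hwz]
  · rw [eq_top_iff]
    intro w _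
    have h1 := deg_le_lieSpan_adPow hp hgen had k w.2
    have h2 : LieSubmodule.lieSpan ℂ L (Z : Set X.carrier) ≤
        (LieSubmodule.lieSpan ℂ L (Z' : Set (X.deg (γ.2 + k)))).map (X.degIncl (γ.2 + k)) := by
      refine LieSubmodule.lieSpan_le.2 fun z hz => ?_
      exact (LieSubmodule.mem_map _).2 ⟨⟨z, hZdeg hz⟩, LieSubmodule.subset_lieSpan hz, rfl⟩
    obtain ⟨w', hw', hww⟩ := (LieSubmodule.mem_map _).1 (h2 h1)
    rwa [← X.degIncl_injective _ hww]

end Generated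

/-- The kernel of `P(μ, r) → P(μ, r)^Γ` is generated by the elements `s p`, where `s p = 0` is one of
the relations involving `𝔤_ad`. -/
theorem truncKer_P {lam ξ : DomWt b} {Ψ : Set H.root} {C : ℝ} (hC : IsMaximizing ξ.1 Ψ C)
    {γ : Lam b} (hγ : γ ∈ GammaSet lam Ψ) :
    (truncKer (P γ) (GammaSet lam Ψ)).toLie = LieSubmodule.lieSpan ℂ (SemiAd L)
      {m | ∃ s ∈ adRel b Ψ, m = ueaAct (SemiAd L) (P γ).carrier s (pGen γ)} := by
  apply le_antisymm
  · let K : (P γ).GrSub := spanSub (P γ)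
      {m | ∃ s ∈ adRel b Ψ, m = ueaAct (SemiAd L) (P γ).carrier s (pGen γ)} (by
        rintro _ ⟨s, hs, rfl⟩
        refine ⟨γ.2 + 1, ?_⟩
        rcases hs with (⟨x, hx, rfl⟩ | ⟨h, rfl⟩) | ⟨α, hα, hαΨ, x, hx, rfl⟩ <;>
        · rw [ueaAct_ι]
          exact (P γ).lie_inAd_mem _ _ _ (pGen_mem_deg γ))
    -- The quotient by the relations already lies in 𝒢₂[Γ], so the smallest submodule with this
    -- property is contained in K.
    refine truncKer_le (N := K) ?_
    refine inG2Gamma_of_relations (p := ((P γ).quotMk K).toLieHom (pGen γ))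
      ((inG2_P γ).quot K) hγ (((P γ).quotMk K).map_deg _ _ (pGen_mem_deg γ)) ?_ ?_ ?_
    · intro m
      obtain ⟨m, rfl⟩ := (P γ).quotMk_surjective K m
      obtain ⟨u, rfl⟩ := exists_ueaAct_pGen γ m
      exact ⟨u, (map_ueaAct _ _ _).symm⟩
    · intro s hs
      rw [← map_ueaAct, ((isPresentedBy_pGen γ).2 s).2 (Submodule.subset_span hs), map_zero]
    · intro s hs
      rw [← map_ueaAct, quotMk_eq_zero]
      exact LieSubmodule.subset_lieSpan ⟨s, hs, rfl⟩
  · refine LieSubmodule.lieSpan_le.2 ?_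
    rintro _ ⟨s, hs, rfl⟩
    -- Conversely, the relations hold in P(μ, r)^Γ because of its membership in 𝒢₂[Γ], so each s p
    -- is in the kernel.
    have hX := inG2Gamma_trunc (inG2_P γ) (GammaSet lam Ψ)
    let q := (P γ).quotMk (truncKer (P γ) (GammaSet lam Ψ))
    have hwt : pGen γ ∈ wtSpace (P γ).carrier γ.1.1 := by
      rw [mem_wtSpace]
      intro h
      have := ((isPresentedBy_pGen γ).2 _).2 (Submodule.subset_span (Or.inl (Or.inr ⟨h, rfl⟩)))
      rwa [map_sub, LinearMap.sub_apply, ueaAct_ι, ueaAct_algebraMap, sub_eq_zero] at this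
    have h1 := adRel_eq_zero hC hX hγ (q.map_deg _ _ (pGen_mem_deg γ))
      (map_mem_wtSpace (resHom q.toLieHom) hwt) hs
    refine ((P γ).quotMk_eq_zero _).1 ?_
    rw [map_ueaAct]
    exact h1

theorem isPresentedBy_pGenTrunc {lam ξ : DomWt b} {Ψ : Set H.root} {C : ℝ}
    (hC : IsMaximizing ξ.1 Ψ C) {γ : Lam b} (hγ : γ ∈ GammaSet lam Ψ) :
    IsPresentedBy (pGenTrunc γ (GammaSet lam Ψ)) (hwRel γ.1 ∪ adRel b Ψ) :=
  (isPresentedBy_pGen γ).quotient (truncKer_P hC hγ)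

end Relations

/-! ### Projectivity and the projective cover -/

section ProjectiveCover

open GrMod

variable {L : Type u} [LieRing L] [LieAlgebra ℂ L] [FiniteDimensional ℂ L]
  [LieAlgebra.IsKilling ℂ L] {H : LieSubalgebra ℂ L} [H.IsCartanSubalgebra]
  {b : (LieAlgebra.IsKilling.rootSystem H).Base} {Γ : Set (Lam b)}

theorem mem_deg_evIrr (γ : Lam b) (v : Irr b γ.1) : v ∈ (evIrr γ).deg γ.2 := by
  change v ∈ (if γ.2 = γ.2 then ⊤ else ⊥ : Submodule ℂ (Irr b γ.1))
  rw [if_pos rfl]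
  trivial

theorem inG2Gamma_evIrr {γ : Lam b} (hγ : γ ∈ Γ) : inG2Gamma Γ (evIrr γ) := by
  rw [inG2Gamma_iff]
  constructor
  · intro k
    exact (inferInstance : FiniteDimensional ℂ ((if k = γ.2 then ⊤ else ⊥ : Submodule ℂ (Irr b γ.1))))
  · rintro ⟨nu, s⟩ m hm h
    change m ∈ (if s = γ.2 then ⊤ else ⊥ : Submodule ℂ (Irr b γ.1)) at hm
    have hs : s = γ.2 := by
      by_contra hne
      rw [if_neg hne] at hm
      exact h.ne_zero hm
    have h' : IsHW (M := Irr b γ.1) b nu.1 m := ⟨h.ne_zero, h.mem_wtSpace, h.lie_eq_zero⟩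
    have hnu : nu = γ.1 := Subtype.ext (eq_of_isHW_irr h')
    rw [hnu, hs]
    exact hγ

theorem ueaAct_uIncl_evIrr (γ : Lam b) (a : UG L) (v : Irr b γ.1) :
    ueaAct (SemiAd L) (evIrr γ).carrier (uIncl L a) v = ueaAct L (Irr b γ.1) a v :=
  ueaAct_uIncl (M := evIrr γ) a v

theorem hwRel_irrGen (γ : Lam b) {s : UT L} (hs : s ∈ hwRel γ.1) :
    ueaAct (SemiAd L) (evIrr γ).carrier s (irrGen b γ.1) = 0 := by
  rcases hs with (⟨x, hx, rfl⟩ | ⟨h, rfl⟩) | ⟨i, hi, x, hx, n, hn, rfl⟩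
  · have := ueaAct_uIncl_evIrr γ (UniversalEnvelopingAlgebra.ι ℂ x) (irrGen b γ.1)
    rw [ueaAct_ι, nPlus_irrGen γ.1 hx, uIncl_ι] at this
    exact this
  · have := (ueaAct_uIncl_evIrr γ _ (irrGen b γ.1)).trans
      (irrGen_relations γ.1 (Or.inl (Or.inl ⟨h, rfl⟩)))
    rw [map_sub, uIncl_ι, AlgHom.commutes] at this
    exact this
  · have := (ueaAct_uIncl_evIrr γ _ (irrGen b γ.1)).trans
      (irrGen_relations γ.1 (Or.inr ⟨i, hi, x, hx, n, hn, rfl⟩))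
    rw [map_pow, uIncl_ι] at this
    exact this

theorem pGenTrunc_mem_deg (γ : Lam b) (Γ : Set (Lam b)) :
    pGenTrunc γ Γ ∈ (trunc (P γ) Γ).deg γ.2 :=
  ((P γ).quotMk (truncKer (P γ) Γ)).map_deg _ _ (pGen_mem_deg γ)

theorem exists_ueaAct_pGenTrunc (γ : Lam b) (Γ : Set (Lam b)) (m : (trunc (P γ) Γ).carrier) :
    ∃ u, ueaAct (SemiAd L) (trunc (P γ) Γ).carrier u (pGenTrunc γ Γ) = m := by
  obtain ⟨m, rfl⟩ := (P γ).quotMk_surjective (truncKer (P γ) Γ) m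
  obtain ⟨u, rfl⟩ := exists_ueaAct_pGen γ m
  exact ⟨u, (map_ueaAct ((P γ).quotMk (truncKer (P γ) Γ)).toLieHom _ _).symm⟩

theorem hwRel_pGenTrunc (γ : Lam b) (Γ : Set (Lam b)) {s : UT L}
    (hs : s ∈ Submodule.span (UT L) (hwRel γ.1)) :
    ueaAct (SemiAd L) (trunc (P γ) Γ).carrier s (pGenTrunc γ Γ) = 0 := by
  refine (map_ueaAct ((P γ).quotMk (truncKer (P γ) Γ)).toLieHom _ _).symm.trans ?_
  rw [((isPresentedBy_pGen γ).2 s).2 hs]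
  exact map_zero _

/-- The morphism `P(μ, r)^Γ → X` given by the image of the generator. -/
theorem exists_hom_pGenTrunc {γ : Lam b} {X : GrMod L} (hX : inG2Gamma Γ X) {x : X.carrier}
    (hx : x ∈ X.deg γ.2) (h : ∀ s ∈ hwRel γ.1, ueaAct (SemiAd L) X.carrier s x = 0) :
    ∃ f : Hom (trunc (P γ) Γ) X, f.toLieHom (pGenTrunc γ Γ) = x := by
  obtain ⟨f, hf⟩ := exists_hom_pGen γ hx h
  exact ⟨quotLift _ f (truncKer_le_ker hX f), hf⟩

theorem hom_trunc_ext {γ : Lam b} {X : GrMod L} {f g : Hom (trunc (P γ) Γ) X}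
    (h : f.toLieHom (pGenTrunc γ Γ) = g.toLieHom (pGenTrunc γ Γ)) (m : (trunc (P γ) Γ).carrier) :
    f.toLieHom m = g.toLieHom m := by
  obtain ⟨u, rfl⟩ := exists_ueaAct_pGenTrunc γ Γ m
  rw [map_ueaAct, map_ueaAct, h]

/-- A map out of P(μ, r)^Γ within 𝒢₂[Γ] is the choice of a vector of degree r satisfying the highest
weight relations. Such a vector is zero or a highest weight vector, and in either case it lifts
along an epimorphism. -/
theorem projective_trunc_P (γ : Lam b) (hP : inG2Gamma Γ (trunc (P γ) Γ)) :
    Projective (⟨trunc (P γ) Γ, hP⟩ : G2Gamma Γ) := by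
  refine ⟨fun {E Y} f e he => ?_⟩
  set y := (grHom f).toLieHom (pGenTrunc γ Γ) with hy
  have hydeg : y ∈ Y.obj.deg γ.2 := (grHom f).map_deg _ _ (pGenTrunc_mem_deg γ Γ)
  have hlift : ∃ x ∈ E.obj.deg γ.2, (∀ s ∈ hwRel γ.1, ueaAct (SemiAd L) E.obj.carrier s x = 0) ∧
      (grHom e).toLieHom x = y := by
    by_cases h0 : y = 0
    · exact ⟨0, zero_mem _, fun _ _ => map_zero _, by rw [map_zero, h0]⟩
    · have hyHW : IsHW b γ.1.1 y := by
        refine isHW_of_hwRel h0 fun s hs => ?_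
        rw [hy, ← map_ueaAct]
        exact (congrArg _ (hwRel_pGenTrunc γ Γ (Submodule.subset_span hs))).trans (map_zero _)
      obtain ⟨x, hx⟩ := surjective_of_epi e y
      have hx' : (grHom e).toLieHom (E.obj.proj γ.2 x) = y := by
        rw [← Hom.proj_map, hx, proj_of_mem _ _ _ _ hydeg, if_pos rfl]
      obtain ⟨x', hx'deg, hx'HW, hx'e⟩ := exists_isHW_lift E.property.1 Y.property.1 (grHom e)
        (E.obj.proj_mem γ.2 x) (hx'.symm ▸ hyHW)
      exact ⟨x', hx'deg, fun s hs => hx'HW.hwRel_eq_zero E.property.1 hx'deg hs, hx'e.trans hx'⟩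
  obtain ⟨x, hxdeg, hxrel, hxe⟩ := hlift
  obtain ⟨g, hg⟩ := exists_hom_pGenTrunc E.property hxdeg hxrel
  let g' : (⟨trunc (P γ) Γ, hP⟩ : G2Gamma Γ) ⟶ E := ObjectProperty.homMk g
  refine ⟨g', grHom_ext fun m => hom_trunc_ext ?_ m⟩
  rw [grHom_comp]
  exact (congrArg (grHom e).toLieHom hg).trans hxe

/-- The map is essential because it is injective in degree r: both sides are generated there over
U(𝔤), and every relation of v_μ already holds for p. -/
theorem exists_isProjectiveCover {γ : Lam b} (hP : inG2Gamma Γ (trunc (P γ) Γ))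
    (hV : inG2Gamma Γ (evIrr γ)) :
    ∃ π : (⟨trunc (P γ) Γ, hP⟩ : G2Gamma Γ) ⟶ (⟨evIrr γ, hV⟩ : G2Gamma Γ), IsProjectiveCover π := by
  obtain ⟨f, hf⟩ := exists_hom_pGenTrunc hV (mem_deg_evIrr γ (irrGen b γ.1))
    (fun s hs => hwRel_irrGen γ hs)
  have hfa : ∀ a : UG L, f.toLieHom (ueaAct (SemiAd L) (trunc (P γ) Γ).carrier (uIncl L a)
      (pGenTrunc γ Γ)) = ueaAct L (Irr b γ.1) a (irrGen b γ.1) := by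
    intro a
    rw [map_ueaAct, hf, ueaAct_uIncl_evIrr]
  let π : (⟨trunc (P γ) Γ, hP⟩ : G2Gamma Γ) ⟶ (⟨evIrr γ, hV⟩ : G2Gamma Γ) := ObjectProperty.homMk f
  refine ⟨π, projective_trunc_P γ hP, epi_of_surjective π fun v => ?_, fun Q g hg => ?_⟩
  · obtain ⟨a, ha⟩ := (isPresentedBy_irrGen γ.1).1 v
    exact ⟨_, (hfa a).trans ha⟩
  · obtain ⟨q, hq⟩ := surjective_of_epi (g ≫ π) (irrGen b γ.1)
    have hq' : (grHom (g ≫ π)).toLieHom (Q.obj.proj γ.2 q) = irrGen b γ.1 := by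
      rw [← Hom.proj_map, hq]
      exact (proj_of_mem _ _ _ _ (mem_deg_evIrr γ (irrGen b γ.1))).trans (if_pos rfl)
    set q' := Q.obj.proj γ.2 q with hq'def
    have hdeg : (grHom g).toLieHom q' ∈ (trunc (P γ) Γ).deg γ.2 :=
      (grHom g).map_deg _ _ (Q.obj.proj_mem _ q)
    -- The image of q' is a p with a ∈ U(𝔤), and it maps to v_μ. Hence a - 1 annihilates v_μ, so it
    -- lies in the left ideal of the relations of V(μ) and annihilates p. The image of q' is
    -- therefore p itself, which generates.
    obtain ⟨a, ha⟩ := exists_ueaAct_uIncl_eq (pGenTrunc_mem_deg γ Γ) (exists_ueaAct_pGenTrunc γ Γ) hdeg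
    have h1 : ueaAct L (Irr b γ.1) (a - 1) (irrGen b γ.1) = 0 := by
      rw [map_sub, map_one, LinearMap.sub_apply, ← hfa a, ha, Module.End.one_apply]
      exact sub_eq_zero.2 hq'
    have h2 := hwRel_pGenTrunc γ Γ
      (uIncl_mem_span_hwRel γ.1 (((isPresentedBy_irrGen γ.1).2 _).1 h1))
    rw [map_sub, map_sub, map_one, map_one, LinearMap.sub_apply, ha, Module.End.one_apply,
      sub_eq_zero] at h2
    refine epi_of_surjective g fun m => ?_
    obtain ⟨u, rfl⟩ := exists_ueaAct_pGenTrunc γ Γ m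
    exact ⟨ueaAct (SemiAd L) Q.obj.carrier u q', (map_ueaAct (grHom g).toLieHom u q').trans
      (congrArg _ h2)⟩

end ProjectiveCover

end

end GradedAdjoint

theorem theorem1 {L : Type u} [LieRing L] [LieAlgebra ℂ L] [FiniteDimensional ℂ L]
    [LieAlgebra.IsSimple ℂ L] (H : LieSubalgebra ℂ L) [H.IsCartanSubalgebra]
    (b : (LieAlgebra.IsKilling.rootSystem H).Base)
    (lam ξ : GradedAdjoint.DomWt b) (Ψ : Set H.root) (hΨpos : ∀ α ∈ Ψ, b.IsPos α)
    (hΨ : Ψ = {α | ∀ β : H.root, (GradedAdjoint.form (GradedAdjoint.rt β) ξ.1).re ≤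
      (GradedAdjoint.form (GradedAdjoint.rt α) ξ.1).re})
    (Γ : Set (GradedAdjoint.Lam b)) (hΓ : Γ = GradedAdjoint.GammaSet lam Ψ) :
    Γ.Finite ∧ GradedAdjoint.IntervalClosed Γ ∧
    ∀ γ ∈ Γ,
      FiniteDimensional ℂ (GradedAdjoint.trunc (GradedAdjoint.P γ) Γ).carrier ∧
      (∃ (hP : GradedAdjoint.inG2Gamma Γ (GradedAdjoint.trunc (GradedAdjoint.P γ) Γ))
        (hV : GradedAdjoint.inG2Gamma Γ (GradedAdjoint.evIrr γ))
        (π : (⟨GradedAdjoint.trunc (GradedAdjoint.P γ) Γ, hP⟩ : GradedAdjoint.G2Gamma Γ) ⟶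
          (⟨GradedAdjoint.evIrr γ, hV⟩ : GradedAdjoint.G2Gamma Γ)),
        GradedAdjoint.IsProjectiveCover π) ∧
      GradedAdjoint.IsPresentedBy (GradedAdjoint.pGenTrunc γ Γ)
        (GradedAdjoint.hwRel γ.1 ∪ GradedAdjoint.adRel b Ψ) := by
  subst hΓ
  obtain ⟨C, hC⟩ := GradedAdjoint.exists_isMaximizing hΨpos hΨ
  have hfin := GradedAdjoint.finite_gammaSet (lam := lam) hC
  refine ⟨hfin, GradedAdjoint.intervalClosed_gammaSet hC, fun γ hγ => ?_⟩
  have hP := GradedAdjoint.inG2Gamma_trunc (GradedAdjoint.inG2_P γ) (GradedAdjoint.GammaSet lam Ψ)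
  have hV := GradedAdjoint.inG2Gamma_evIrr hγ
  exact ⟨hP.finiteDimensional hfin, ⟨hP, hV, GradedAdjoint.exists_isProjectiveCover hP hV⟩,
    GradedAdjoint.isPresentedBy_pGenTrunc hC hγ⟩
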